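/- Let $n\ge 1$, work over $K=\mathbf{Q}(q)$, and put $\sigma_i=(i,i+1)$. **Hecke action.** Let $\widehat H_N(Q)$ be the $K$-algebra generated by $T_i$ ($1\le i\le N-1$) and $y_j^{\pm1}$ ($1\le j\le N$) with relations $T_i^2=(Q-1)T_i+Q$, $T_iT_{i+1}T_i=T_{i+1}T_iT_{i+1}$, $T_iT_j=T_jT_i$ ($|i-j|>1$), $y_iy_j=y_jy_i$, $y_jy_j^{-1}=y_j^{-1}y_j=1$, $y_jT_i=T_iy_j$ ($j\neq i,i+1$), $y_jT_j=T_jy_{j+1}-(Q-1)y_{j+1}$, $y_{j+1}T_j=T_jy_j+(Q-1)y_{j+1}$. Let $V(z)=\big(\bigoplus_{m=1}^nKv_m\big)\otimes K[z^{\pm1}]$ with basis $u_a$ ($a\in\mathbf Z$), where $u_{m-nr}=z^rv_m$, and write $v_{\mathbf m}\cdot z^{\mathbf r}=z^{r_1}v_{m_1}\otimes\cdots\otimes z^{r_N}v_{m_N}$. The algebra $\widehat H_N(q^{-2})$ acts on the right on $V(z)^{\otimes N}$: $y_j$ acts as multiplication by $z_j^{-1}$ (that is, $u_a\mapsto u_{a+n}$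 in the $j$-th factor), and, with $\partial_i f=(f-\sigma_if)/(z_i-z_{i+1})$, $$(v_{\mathbf m}\cdot z^{\mathbf r})T_i=\begin{cases}-q^{-1}v_{\mathbf m\sigma_i}\cdot\sigma_i(z^{\mathbf r})+(q^{-2}-1)v_{\mathbf m}\cdot\partial_i(z_iz^{\mathbf r}),&m_i<m_{i+1},\\-v_{\mathbf m}\cdot\sigma_i(z^{\mathbf r})+(q^{-2}-1)v_{\mathbf m}\cdot z_i\partial_i(z^{\mathbf r}),&m_i=m_{i+1},\\-q^{-1}v_{\mathbf m\sigma_i}\cdot\sigma_i(z^{\mathbf r})+(q^{-2}-1)v_{\mathbf m}\cdot z_i\partial_i(z^{\mathbf r}),&m_i>m_{i+1}.\end{cases}$$ **The $q$-Fock space.** Put $A^{(N)}=\sum_{\sigma\in\mathfrak S_N}T_\sigma$, where $T_\sigma=T_{i_1}\cdots T_{i_r}$ for a reduced decomposition $\sigma=\sigma_{i_1}\cdots\sigma_{i_r}$. Let $\bigwedge_q^NV(z)=V(z)^{\otimes N}/\ker A^{(N)}$, and let $\mathcal F_q=\varinjlim_N\bigwedge_q^NV(z)$ along $w\mapsto w\wedge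 u_{-N}$ (the Kashiwara–Miwa–Stern $q$-Fock space). The vectors $|\lambda\rangle=u_{\lambda_1}\wedge u_{\lambda_2-1}\wedge u_{\lambda_3-2}\wedge\cdots$, $\lambda$ running over all partitions, form a basis of $\mathcal F_q$. **Ribbon operators.** Draw Young diagrams with the longest row at the bottom. An $n$-ribbon is a connected skew diagram with $n$ cells containing no $2\times2$ square; its initial cell is its rightmost bottommost cell. An $n$-ribbon tableau of shape $\beta/\alpha$ and weight $(k)$ is a tiling $T$ of $\beta/\alpha$ by $k$ $n$-ribbons whose initial cells are the bottom cells of their columns in $\beta/\alpha$; $\mathrm{Tab}_n(\beta/\alpha,(k))$ is the set of these tableaux (it is empty unless $\alpha\subseteq\beta$). The spin $s(T)$ is the sum over the ribbons $R$ of $T$ of $(h(R)-1)/2$, where $h(R)$ is the number of rows that $R$ meets. For $k\ge1$ define linear operators on $\mathcal F_q$ by $$V_k|\lambda\rangle=\sum_\mu\Big(\sum_{T\in\mathrm{Tab}_n(\mu/\lambda,(k))}(-q)^{-2s(T)}\Big)|\mu\rangle,\qquad U_k|\lambda\rangle=\sum_\nu\Big(\sum_{T\in\mathrm{Tab}_n(\lambda/\nu,(k))}(-q)^{-2s(T)}\Big)|\nu\rangle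 .$$ **Statement.** Let $h_k$ be the complete homogeneous symmetric function. For all $N$ and $k\ge1$ the elements $h_k(y_1,\dots,y_N)$ and $h_k(y_1^{-1},\dots,y_N^{-1})$ are central in $\widehat H_N(q^{-2})$ and act on $\bigwedge_q^NV(z)$. In the limit $N\to\infty$, $$V_k=h_k(y_1,y_2,\dots),\qquad U_k=h_k(y_1^{-1},y_2^{-1},\dots)$$ as operators on $\mathcal F_q$. That is, for every $N$ and every $w\in\bigwedge_q^NV(z)$, one has for all sufficiently large $M$ $$V_k(w\wedge u_{-N}\wedge u_{-N-1}\wedge\cdots)=\big(h_k(y_1,\dots,y_M)(w\wedge u_{-N}\wedge\cdots\wedge u_{-M+1})\big)\wedge u_{-M}\wedge u_{-M-1}\wedge\cdots,$$ and likewise for $U_k$ and $h_k(y_1^{-1},\dots,y_M^{-1})$. In particular $[U_i,U_j]=[V_i,V_j]=0$ for all $i,j\ge1$. -/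

import Mathlib

open scoped BigOperators

noncomputable section

namespace QFock

/-! ### The ground field -/

/-- The field `ℚ(q)`. -/
abbrev K : Type := RatFunc ℚ

/-- The indeterminate `q`. -/
def q : K := RatFunc.X

/-! ### Adjacent transpositions, reduced words, `T_σ` -/

/-- The position `i` (counted from `0`) attached to the index `i` of an adjacent transposition. -/
def lo {N : ℕ} (i : Fin (N - 1)) : Fin N := ⟨i, by omega⟩

/-- The position `i + 1`. -/
def hi {N : ℕ} (i : Fin (N - 1)) : Fin N := ⟨i + 1, by omega⟩

/-- The adjacent transposition `σ_i = (i, i+1)`. -/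
def adj {N : ℕ} (i : Fin (N - 1)) : Equiv.Perm (Fin N) := Equiv.swap (lo i) (hi i)

/-- `l = [i₁, …, i_r]` is a reduced decomposition `σ = σ_{i₁} ⋯ σ_{i_r}`. -/
def IsReducedWord {N : ℕ} (σ : Equiv.Perm (Fin N)) (l : List (Fin (N - 1))) : Prop :=
  (l.map adj).prod = σ ∧
    ∀ l' : List (Fin (N - 1)), (l'.map adj).prod = σ → l.length ≤ l'.length

theorem exists_word {N : ℕ} (σ : Equiv.Perm (Fin N)) :
    ∃ l : List (Fin (N - 1)), (l.map adj).prod = σ := by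
  cases N with
  | zero => exact ⟨[], Subsingleton.elim _ _⟩
  | succ n =>
    have h : σ ∈ Submonoid.closure
        (Set.range fun i : Fin n => Equiv.swap i.castSucc i.succ) := by
      rw [Equiv.Perm.mclosure_swap_castSucc_succ]; trivial
    induction h using Submonoid.closure_induction with
    | mem x hx =>
      obtain ⟨i, rfl⟩ := hx
      exact ⟨[i], by simp [adj, lo, hi, Fin.castSucc, Fin.succ]; rfl⟩
    | one => exact ⟨[], by simp⟩
    | mul x y _ _ hx hy =>
      obtain ⟨l, rfl⟩ := hx
      obtain ⟨l', rfl⟩ := hy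
      exact ⟨l ++ l', by simp⟩

theorem exists_reducedWord {N : ℕ} (σ : Equiv.Perm (Fin N)) :
    ∃ l : List (Fin (N - 1)), IsReducedWord σ l := by
  classical
  have h : ∃ r : ℕ, ∃ l : List (Fin (N - 1)), (l.map adj).prod = σ ∧ l.length = r := by
    obtain ⟨l, hl⟩ := exists_word σ
    exact ⟨_, l, hl, rfl⟩
  obtain ⟨l, hl, hr⟩ := Nat.find_spec h
  exact ⟨l, hl, fun l' hl' => hr ▸ Nat.find_min' h ⟨l', hl', rfl⟩⟩

/-- `T_σ = T_{i₁} ⋯ T_{i_r}`, computed along a reduced decomposition of `σ`. -/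
def tPerm {N : ℕ} {A : Type*} [Monoid A] (T : Fin (N - 1) → A) (σ : Equiv.Perm (Fin N)) : A :=
  ((exists_reducedWord σ).choose.map T).prod

/-! ### The affine Hecke algebra -/

/-- The generators `T_i`, `y_j`, `y_j⁻¹`. -/
inductive HeckeGen (N : ℕ) : Type
  | T (i : Fin (N - 1))
  | y (j : Fin N)
  | yInv (j : Fin N)

/-- Generators of the free algebra. -/
def fT {N : ℕ} (i : Fin (N - 1)) : FreeAlgebra K (HeckeGen N) := FreeAlgebra.ι K (HeckeGen.T i)

/-- Generators of the free algebra. -/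
def fy {N : ℕ} (j : Fin N) : FreeAlgebra K (HeckeGen N) := FreeAlgebra.ι K (HeckeGen.y j)

/-- Generators of the free algebra. -/
def fyInv {N : ℕ} (j : Fin N) : FreeAlgebra K (HeckeGen N) :=
  FreeAlgebra.ι K (HeckeGen.yInv j)

/-- The defining relations of the affine Hecke algebra with parameter `Q`. -/
inductive HeckeRel (N : ℕ) (Q : K) :
    FreeAlgebra K (HeckeGen N) → FreeAlgebra K (HeckeGen N) → Prop
  | quad (i : Fin (N - 1)) :
      HeckeRel N Q (fT i * fT i) ((Q - 1) • fT i + algebraMap K _ Q)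
  | braid (i j : Fin (N - 1)) (h : (j : ℕ) = i + 1) :
      HeckeRel N Q (fT i * fT j * fT i) (fT j * fT i * fT j)
  | far (i j : Fin (N - 1)) (h : (i : ℕ) + 1 < j) :
      HeckeRel N Q (fT i * fT j) (fT j * fT i)
  | yComm (i j : Fin N) : HeckeRel N Q (fy i * fy j) (fy j * fy i)
  | yMulInv (j : Fin N) : HeckeRel N Q (fy j * fyInv j) 1
  | yInvMul (j : Fin N) : HeckeRel N Q (fyInv j * fy j) 1
  | yT (j : Fin N) (i : Fin (N - 1)) (h₁ : j ≠ lo i) (h₂ : j ≠ hi i) :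
      HeckeRel N Q (fy j * fT i) (fT i * fy j)
  | loT (i : Fin (N - 1)) :
      HeckeRel N Q (fy (lo i) * fT i) (fT i * fy (hi i) - (Q - 1) • fy (hi i))
  | hiT (i : Fin (N - 1)) :
      HeckeRel N Q (fy (hi i) * fT i) (fT i * fy (lo i) + (Q - 1) • fy (hi i))

/-- The affine Hecke algebra of type `A_{N-1}` with parameter `Q`, over `ℚ(q)`. -/
abbrev AffineHecke (N : ℕ) (Q : K) : Type := RingQuot (HeckeRel N Q)

/-- The generator `T_i`. -/
def hT {N : ℕ} {Q : K} (i : Fin (N - 1)) : AffineHecke N Q := RingQuot.mkAlgHom K _ (fT i)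

/-- The generator `y_j`. -/
def hy {N : ℕ} {Q : K} (j : Fin N) : AffineHecke N Q := RingQuot.mkAlgHom K _ (fy j)

/-- The inverse `y_j⁻¹`. -/
def hyInv {N : ℕ} {Q : K} (j : Fin N) : AffineHecke N Q := RingQuot.mkAlgHom K _ (fyInv j)

open Classical in
/-- The complete homogeneous symmetric function `h_k(x_1, …, x_N)`: the sum of the products
`x_{j₁} ⋯ x_{j_k}` over all `j₁ ≤ ⋯ ≤ j_k`. -/
def hComplete {N : ℕ} {A : Type*} [Semiring A] (x : Fin N → A) (k : ℕ) : A :=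
  ∑ f : Fin k → Fin N with Monotone f, (List.ofFn fun i => x (f i)).prod

/-! ### Laurent polynomials and divided differences -/

/-- The Laurent polynomial ring `ℚ(q)[z_1^{±1}, …, z_N^{±1}]`. -/
abbrev Laurent (N : ℕ) : Type := AddMonoidAlgebra K (Fin N → ℤ)

/-- The Laurent monomial `z^r`. -/
def zmon {N : ℕ} (r : Fin N → ℤ) : Laurent N := AddMonoidAlgebra.single r 1

/-- The variable `z_j`. -/
def zvar {N : ℕ} (j : Fin N) : Laurent N := zmon (Pi.single j 1)

/-- The linear map on Laurent polynomials with prescribed values on the monomials. -/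
def laurentLin {N : ℕ} {M : Type*} [AddCommMonoid M] [Module K M] (g : (Fin N → ℤ) → M) :
    Laurent N →ₗ[K] M :=
  (Finsupp.linearCombination K g).comp (AddMonoidAlgebra.coeffLinearEquiv K).toLinearMap

theorem laurentLin_zmon {N : ℕ} {M : Type*} [AddCommMonoid M] [Module K M]
    (g : (Fin N → ℤ) → M) (r : Fin N → ℤ) : laurentLin g (zmon r) = g r := by
  simp [laurentLin, zmon]

/-- `σ_i` exchanges `z_i` and `z_{i+1}`. -/
def sigmaZ {N : ℕ} (i : Fin (N - 1)) : Laurent N →ₗ[K] Laurent N :=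
  laurentLin fun r => zmon (r ∘ adj i)

/-- The divided difference `∂_i(f) = (f - σ_i f) / (z_i - z_{i+1})`, written out on monomials
(only one of the two sums is non-empty); see `ddiff_spec`. -/
def ddiff {N : ℕ} (i : Fin (N - 1)) : Laurent N →ₗ[K] Laurent N :=
  laurentLin fun r =>
    (∑ j ∈ Finset.range (r (lo i) - r (hi i)).toNat,
      zmon (r - Pi.single (lo i) (1 + (j : ℤ)) + Pi.single (hi i) (j : ℤ))) -
    ∑ j ∈ Finset.range (r (hi i) - r (lo i)).toNat,
      zmon (r + Pi.single (lo i) (j : ℤ) - Pi.single (hi i) (1 + (j : ℤ)))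

theorem zvar_mul_zmon {N : ℕ} (j : Fin N) (r : Fin N → ℤ) :
    zvar j * zmon r = zmon (r + Pi.single j 1) := by
  simp [zvar, zmon, AddMonoidAlgebra.single_mul_single, add_comm]

theorem comp_adj {N : ℕ} (i : Fin (N - 1)) (r : Fin N → ℤ) :
    r ∘ adj i = r - Pi.single (lo i) (r (lo i) - r (hi i)) +
      Pi.single (hi i) (r (lo i) - r (hi i)) := by
  have hne : lo i ≠ hi i := by simp [lo, hi]
  funext s
  by_cases h1 : s = lo i
  · subst h1; simp [adj, hne]
  · by_cases h2 : s = hi i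
    · subst h2; simp [adj, hne.symm]
    · simp [adj, Equiv.swap_apply_of_ne_of_ne h1 h2, h1, h2]

theorem ddiff_spec {N : ℕ} (i : Fin (N - 1)) (f : Laurent N) :
    (zvar (lo i) - zvar (hi i)) * ddiff i f = f - sigmaZ i f := by
  suffices h : (LinearMap.mulLeft K (zvar (lo i) - zvar (hi i) : Laurent N)).comp (ddiff i) =
      LinearMap.id - sigmaZ i from LinearMap.congr_fun h f
  refine AddMonoidAlgebra.lhom_ext' fun r => LinearMap.ext_ring ?_
  change (zvar (lo i) - zvar (hi i)) * ddiff i (zmon r) = zmon r - sigmaZ i (zmon r)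
  rw [ddiff, sigmaZ, laurentLin_zmon, laurentLin_zmon, mul_sub, Finset.mul_sum, Finset.mul_sum]
  have e1 : ∀ j : ℕ, (zvar (lo i) - zvar (hi i)) *
      (zmon (r - Pi.single (lo i) (1 + (j : ℤ)) + Pi.single (hi i) (j : ℤ)) : Laurent N) =
      zmon (r - Pi.single (lo i) (j : ℤ) + Pi.single (hi i) (j : ℤ)) -
      zmon (r - Pi.single (lo i) ((j + 1 : ℕ) : ℤ) + Pi.single (hi i) ((j + 1 : ℕ) : ℤ)) := by
    intro j
    rw [sub_mul, zvar_mul_zmon, zvar_mul_zmon]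
    congr 2 <;> push_cast <;> simp only [Pi.single_add] <;> abel
  have e2 : ∀ j : ℕ, (zvar (lo i) - zvar (hi i)) *
      (zmon (r + Pi.single (lo i) (j : ℤ) - Pi.single (hi i) (1 + (j : ℤ))) : Laurent N) =
      zmon (r + Pi.single (lo i) ((j + 1 : ℕ) : ℤ) - Pi.single (hi i) ((j + 1 : ℕ) : ℤ)) -
      zmon (r + Pi.single (lo i) (j : ℤ) - Pi.single (hi i) (j : ℤ)) := by
    intro j
    rw [sub_mul, zvar_mul_zmon, zvar_mul_zmon]
    congr 2 <;> push_cast <;> simp only [Pi.single_add] <;> abel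
  rw [Finset.sum_congr rfl fun j _ => e1 j, Finset.sum_congr rfl fun j _ => e2 j,
    Finset.sum_range_sub', Finset.sum_range_sub (fun j : ℕ =>
      (zmon (r + (Pi.single (lo i) (j : ℤ) : Fin N → ℤ) - (Pi.single (hi i) (j : ℤ) : Fin N → ℤ)) :
        Laurent N)), comp_adj]
  rcases le_total (r (lo i)) (r (hi i)) with h | h
  · rw [Int.toNat_eq_zero.mpr (sub_nonpos.mpr h), Int.toNat_of_nonneg (sub_nonneg.mpr h)]
    simp only [Nat.cast_zero, Pi.single_zero, sub_zero, add_zero, sub_self,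
      zero_sub, neg_sub]
    congr 2
    simp only [Pi.single_sub]
    abel
  · rw [Int.toNat_eq_zero.mpr (sub_nonpos.mpr h), Int.toNat_of_nonneg (sub_nonneg.mpr h)]
    simp

/-! ### The space `V(z)^{⊗N}` and the right action of the affine Hecke algebra -/

/-- The space `V(z)^{⊗N}`, with basis the tensors `u_{a_1} ⊗ ⋯ ⊗ u_{a_N}`, `a_j ∈ ℤ`. -/
abbrev Tens (N : ℕ) : Type := (Fin N → ℤ) →₀ K

/-- The `m ∈ {1, …, n}` with `u_a = z^r v_m`, that is `a = m - n r`. -/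
def color (n : ℕ) (a : ℤ) : ℤ := (a - 1) % n + 1

/-- The exponent `r` with `u_a = z^r v_m`, that is `a = m - n r`. -/
def zdeg (n : ℕ) (a : ℤ) : ℤ := -((a - 1) / n)

theorem color_sub_zdeg (n : ℕ) (a : ℤ) : color n a - n * zdeg n a = a := by
  have := Int.emod_add_mul_ediv (a - 1) n
  unfold color zdeg
  linarith

theorem color_mem (n : ℕ) (hn : 1 ≤ n) (a : ℤ) : 1 ≤ color n a ∧ color n a ≤ n := by
  have h0 : (0 : ℤ) < n := by exact_mod_cast hn
  have h1 := Int.emod_nonneg (a - 1) h0.ne'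
  have h2 := Int.emod_lt_of_pos (a - 1) h0
  unfold color
  omega

/-- `f ↦ v_m · f`; on monomials, `v_m · z^r = z^{r_1} v_{m_1} ⊗ ⋯ ⊗ z^{r_N} v_{m_N}` is the tensor
with indices `m_j - n r_j`. -/
def vMul (n : ℕ) {N : ℕ} (m : Fin N → ℤ) : Laurent N →ₗ[K] Tens N :=
  laurentLin fun r => Finsupp.single (fun j => m j - n * r j) 1

/-- The operator `T_i` on `V(z)^{⊗N}`, on the basis vector `v_m · f` with `f = z^r`. -/
def heckeT (n : ℕ) {N : ℕ} (i : Fin (N - 1)) : Tens N →ₗ[K] Tens N :=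
  Finsupp.linearCombination K fun a =>
    let m : Fin N → ℤ := fun j => color n (a j)
    let f : Laurent N := zmon fun j => zdeg n (a j)
    let z : Laurent N := zvar (lo i)
    if m (lo i) < m (hi i) then
      -q⁻¹ • vMul n (m ∘ adj i) (sigmaZ i f) + (q⁻¹ ^ 2 - 1) • vMul n m (ddiff i (z * f))
    else if m (lo i) = m (hi i) then
      -vMul n m (sigmaZ i f) + (q⁻¹ ^ 2 - 1) • vMul n m (z * ddiff i f)
    else
      -q⁻¹ • vMul n (m ∘ adj i) (sigmaZ i f) + (q⁻¹ ^ 2 - 1) • vMul n m (z * ddiff i f)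

/-- The operator `y_j` on `V(z)^{⊗N}`: multiplication by `z_j⁻¹`. -/
def heckeY (n : ℕ) {N : ℕ} (j : Fin N) : Tens N →ₗ[K] Tens N :=
  Finsupp.linearCombination K fun a =>
    vMul n (fun s => color n (a s))
      (zmon (Pi.single j (-1)) * zmon fun s => zdeg n (a s))

/-- The `q`-antisymmetrizer `A^{(N)} = ∑_σ T_σ` on `V(z)^{⊗N}`. As the `T_i` act on the right,
products are formed in the opposite of the endomorphism ring. -/
def antisym (n N : ℕ) : Tens N →ₗ[K] Tens N :=
  MulOpposite.unop (∑ σ : Equiv.Perm (Fin N),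
    tPerm (fun i => MulOpposite.op (heckeT n i : Module.End K (Tens N))) σ)

/-! ### `q`-wedges and the thermodynamic limit -/

/-- The `q`-exterior power `⋀_q^N V(z) = V(z)^{⊗N} / ker A^{(N)}`. -/
abbrev Wedge (n N : ℕ) : Type := Tens N ⧸ LinearMap.ker (antisym n N)

/-- Index sequences of the semi-infinite tensors `u_{i_1} ⊗ u_{i_2} ⊗ ⋯` with `i_k = -k + 1` for
`k ≫ 0`; here positions are counted from `0`, so that the condition reads `s k = -k`. -/
abbrev InfIndex : Type := {s : ℕ → ℤ // ∃ N : ℕ, ∀ k, N ≤ k → s k = -(k : ℤ)}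

/-- `(a_1, …, a_N) ↦ (a_1, …, a_N, -N, -N-1, …)`. -/
def extendIndex {N : ℕ} (a : Fin N → ℤ) : ℕ → ℤ :=
  fun k => if h : k < N then a ⟨k, h⟩ else -(k : ℤ)

/-- The span of the semi-infinite tensors, the union of the spaces `V(z)^{⊗N}` along the
injections `w ↦ w ⊗ u_{-N}`. -/
abbrev InfTens : Type := InfIndex →₀ K

/-- The map `V(z)^{⊗N} → InfTens`, `w ↦ w ⊗ u_{-N} ⊗ u_{-N-1} ⊗ ⋯`. -/
def toInf (N : ℕ) : Tens N →ₗ[K] InfTens :=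
  Finsupp.lmapDomain K K fun a =>
    ⟨extendIndex a, N, fun k hk => by simp [extendIndex, Nat.not_lt.mpr hk]⟩

/-- The map `V(z)^{⊗N} → V(z)^{⊗M}`, `w ↦ w ⊗ u_{-N} ⊗ ⋯ ⊗ u_{-M+1}` (used for `N ≤ M`). -/
def stab (N M : ℕ) : Tens N →ₗ[K] Tens M :=
  Finsupp.lmapDomain K K fun a j => extendIndex a j

/-- The relations of the `q`-Fock space, i.e. all `w ⊗ u_{-N} ⊗ u_{-N-1} ⊗ ⋯` with
`w ∈ ker A^{(N)}`. -/
def wedgeRel (n : ℕ) : Submodule K InfTens :=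
  ⨆ N : ℕ, (LinearMap.ker (antisym n N)).map (toInf N)

/-- The `q`-Fock space `ℱ_q = lim_{N → ∞} ⋀_q^N V(z)`, the direct limit of the `q`-exterior powers
along `w ↦ w ∧ u_{-N}`. -/
abbrev FockQ (n : ℕ) : Type := InfTens ⧸ wedgeRel n

/-- The canonical map `⋀_q^N V(z) → ℱ_q`, `w ↦ w ∧ u_{-N} ∧ u_{-N-1} ∧ ⋯`. -/
def wedgeToFock (n N : ℕ) : Wedge n N →ₗ[K] FockQ n :=
  Submodule.mapQ _ _ (toInf N)
    (Submodule.map_le_iff_le_comap.mp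
      (le_iSup (fun N : ℕ => (LinearMap.ker (antisym n N)).map (toInf N)) N))

/-- The operators `X N` on `V(z)^{⊗N}` descend to `⋀_q^N V(z)`, and the operator `Y` on `ℱ_q` is
their thermodynamic limit: for every `w`, one has
`Y (w ∧ u_{-N} ∧ ⋯) = X_M (w ∧ u_{-N} ∧ ⋯ ∧ u_{-M+1}) ∧ u_{-M} ∧ ⋯` for all large `M`. -/
def IsThermoLimit (n : ℕ) (X : ∀ N : ℕ, Tens N →ₗ[K] Tens N) (Y : FockQ n →ₗ[K] FockQ n) :
    Prop :=
  (∀ (N : ℕ) (w : Tens N), antisym n N w = 0 → antisym n N (X N w) = 0) ∧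
  ∀ (N : ℕ) (w : Tens N), ∀ᶠ M : ℕ in Filter.atTop,
    Y (wedgeToFock n N (Submodule.Quotient.mk w)) =
      wedgeToFock n M (Submodule.Quotient.mk (X M (stab N M w)))

/-- The semi-infinite wedge `u_{λ_1} ∧ u_{λ_2 - 1} ∧ u_{λ_3 - 2} ∧ ⋯`. -/
def wedgeOf (n : ℕ) (lam : YoungDiagram) : FockQ n :=
  Submodule.Quotient.mk (Finsupp.single
    ⟨fun k => (lam.rowLen k : ℤ) - k, lam.colLen 0, fun k hk => by
      have h : lam.rowLen k = 0 := by
        by_contra h0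
        have h1 : (k, 0) ∈ lam := YoungDiagram.mem_iff_lt_rowLen.mpr (Nat.pos_of_ne_zero h0)
        have h2 := YoungDiagram.mem_iff_lt_colLen.mp h1
        omega
      simp [h]⟩ 1)

/-! ### Ribbon tableaux and the operators `U_k`, `V_k` -/

/-- `R` is an `n`-ribbon with initial cell `c`. Cells are pairs (row, column), row `0` being the
longest one. The ribbon is read from its initial cell (largest column, smallest row); each step
goes to the next row in the same column, or to the previous column in the same row. -/
def IsRibbon (n : ℕ) (c : ℕ × ℕ) (R : Finset (ℕ × ℕ)) : Prop :=
  ∃ p : ℕ → ℕ × ℕ, p 0 = c ∧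
    (∀ j, j + 1 < n →
      ((p (j + 1)).1 = (p j).1 + 1 ∧ (p (j + 1)).2 = (p j).2) ∨
      ((p (j + 1)).1 = (p j).1 ∧ (p (j + 1)).2 + 1 = (p j).2)) ∧
    R = (Finset.range n).image p

open Classical in
/-- The `n`-ribbon tableaux of shape `β/α` and weight `(k)`: the tilings of `β/α` by `k`
`n`-ribbons whose initial cells are the bottom cells (smallest row) of their columns in `β/α`. -/
def tilings (n k : ℕ) (al be : YoungDiagram) : Finset (Finset (Finset (ℕ × ℕ))) :=
  (be.cells \ al.cells).powerset.powerset.filter fun P =>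
    al ≤ be ∧ P.card = k ∧ (P : Set (Finset (ℕ × ℕ))).PairwiseDisjoint id ∧
    P.biUnion id = be.cells \ al.cells ∧
    ∀ R ∈ P, ∃ c : ℕ × ℕ, IsRibbon n c R ∧ c.1 = al.colLen c.2

/-- `2 s(T) = ∑_R (h(R) - 1)`, where `h(R)` is the number of rows that `R` meets. -/
def twiceSpin (P : Finset (Finset (ℕ × ℕ))) : ℕ :=
  ∑ R ∈ P, ((R.image Prod.fst).card - 1)

/-- `∑_T (-q)^{-2 s(T)}` over the `n`-ribbon tableaux `T` of shape `β/α` and weight `(k)`. -/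
def ribbonCoeff (n k : ℕ) (al be : YoungDiagram) : K :=
  ∑ P ∈ tilings n k al be, (-q) ^ (-(twiceSpin P : ℤ))

theorem ribbonCoeff_ne_zero {n k : ℕ} {al be : YoungDiagram} (h : ribbonCoeff n k al be ≠ 0) :
    al ≤ be ∧ be.card ≤ al.card + k * n := by
  classical
  obtain ⟨P, hP, -⟩ := Finset.exists_ne_zero_of_sum_ne_zero h
  obtain ⟨-, h1, h2, -, h4, h5⟩ := Finset.mem_filter.mp hP
  refine ⟨h1, ?_⟩
  have h6 : (be.cells \ al.cells).card ≤ k * n := by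
    rw [← h4, ← h2]
    refine Finset.card_biUnion_le_card_mul _ _ _ fun R hR => ?_
    obtain ⟨c, ⟨p, -, -, rfl⟩, -⟩ := h5 R hR
    exact Finset.card_image_le.trans (by simp)
  have h7 := Finset.le_card_sdiff al.cells be.cells
  have h8 : be.card = be.cells.card := rfl
  have h9 : al.card = al.cells.card := rfl
  omega

theorem finite_card_le (m : ℕ) : {be : YoungDiagram | be.card ≤ m}.Finite := by
  refine Set.Finite.of_finite_image (f := YoungDiagram.cells)
    (Set.Finite.subset (Finset.finite_toSet (Finset.range m ×ˢ Finset.range m).powerset) ?_)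
    (fun a _ b _ hab => YoungDiagram.ext hab)
  rintro _ ⟨be, hbe, rfl⟩
  have hbe' : be.cells.card ≤ m := hbe
  simp only [Finset.coe_powerset, Set.mem_preimage, Set.mem_powerset_iff, Finset.coe_subset]
  rintro ⟨i, j⟩ hij
  have hij' : (i, j) ∈ be := hij
  have h1 := YoungDiagram.mem_iff_lt_colLen.mp hij'
  have h2 := YoungDiagram.mem_iff_lt_rowLen.mp hij'
  have h3 : (be.col j).card ≤ be.cells.card := Finset.card_le_card (Finset.filter_subset _ _)
  have h4 : (be.row i).card ≤ be.cells.card := Finset.card_le_card (Finset.filter_subset _ _)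
  rw [← YoungDiagram.colLen_eq_card] at h3
  rw [← YoungDiagram.rowLen_eq_card] at h4
  simp only [Finset.mem_product, Finset.mem_range]
  omega

/-- The space `ℱ = ⨁_λ ℚ(q) |λ⟩`, where `|λ⟩` stands for the Schur function `s_λ`. -/
abbrev Fock : Type := YoungDiagram →₀ K

/-- `V_k |λ⟩ = ∑_μ (∑_T (-q)^{-2 s(T)}) |μ⟩`, `T` of shape `μ/λ` and weight `(k)`. -/
def ribbonV (n k : ℕ) : Fock →ₗ[K] Fock :=
  Finsupp.linearCombination K fun lam =>
    Finsupp.ofSupportFinite (fun mu => ribbonCoeff n k lam mu)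
      ((finite_card_le (lam.card + k * n)).subset fun _ h => (ribbonCoeff_ne_zero h).2)

/-- `U_k |λ⟩ = ∑_ν (∑_T (-q)^{-2 s(T)}) |ν⟩`, `T` of shape `λ/ν` and weight `(k)`. -/
def ribbonU (n k : ℕ) : Fock →ₗ[K] Fock :=
  Finsupp.linearCombination K fun lam =>
    Finsupp.ofSupportFinite (fun nu => ribbonCoeff n k nu lam)
      ((finite_card_le lam.card).subset fun _ h =>
        Finset.card_le_card (YoungDiagram.cells_subset_iff.mpr (ribbonCoeff_ne_zero h).1))

end QFock

end

open scoped BigOperators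
noncomputable section
set_option linter.unusedSimpArgs false
namespace QFock

/-! ### Inversions and reduced words -/

/-! The operators `T_i`, `y_j` satisfy the affine Hecke relations, and symmetric functions of the
`y_j` are central. Since the antisymmetrizer is itself the image of a Hecke element, central
elements preserve its kernel and act on the q-wedges. That kernel is the sum of the images of the
`T_i - q⁻²` (`ker_antisym`): modulo these images every tensor straightens to strictly decreasing
ones, and on the span of the decreasing tensors the antisymmetrizer is unitriangular for the
statistic `∑ a_j²`. In the limit a decreasing wedge of length `N` with an index at most `-N` is
killed by the tail, so the vectors `|λ⟩` form a basis (`fockMap_bijective`).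

The heart is the action of symmetric functions of the `y_j` on a decreasing wedge. Straightening
`u_a ∧ u_b` with `a < b` in general produces correction terms, but none when `b < a + n`: then it is
just `u_a ∧ u_b = -q⁻¹ u_b ∧ u_a`. The product `∏ (1 - t y_j)` never needs more than this. It raises
every index at most once, by `n`; if the smallest index `v` is treated after all the others, then
`u_{v+n}` only has to pass indices strictly between `v` and `v + n`. Hence this product acts as the
ordered product of the `1 - t R_x`, larger `x` first, where `R_x` moves a bead from `x` to `x + n`
with the factor `-q⁻¹` for each bead jumped over (`coeff_eSeries_beadTens_sub_mem`). As `R_x² = 0`,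
the inverse is the product of the `1 + t R_x`, smaller `x` first, and this must be `∑ h_k(y) t^k`.
The inversion is legitimate modulo straightening because the `h_k` are central and so preserve the
relations (`hComplete_apply_sub_mem`).

In terms of diagrams, beads sit at `λ_i - i`, and moving one from `x` to `x + n` adds a ribbon
occupying the diagonals `x, …, x + n - 1`, whose height minus one is the number of beads jumped
over. In a tableau of weight `(k)` the initial cells have distinct contents, and the ribbon with the
rightmost initial diagonal can be removed. So each tableau arises exactly once by adding ribbons in
increasing order of `x` (`coeff_upSeries_beads_below`), and `h_k(y)` is `V_k`.

For the inverses `y_j⁻¹`, negating all indices and reversing their order exchanges `y` with `y⁻¹`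
and preserves the exact straightening rules, while the reflected `R_x` is the transpose of
`R_{-x-n}`. Thus `h_k(y⁻¹)` acts by the transpose of `V_k`, which is `U_k`. Beads pushed into the
tail vanish only in the limit, so this comparison is made in the Fock space, whereas the one for
`V_k` already holds in a large finite wedge power. The `V_k` commute because the `h_k(y)` are
central, and the `U_k` commute by transposition. -/

theorem lo_ne_hi {N : ℕ} (i : Fin (N - 1)) : lo i ≠ hi i := by simp [lo, hi]

theorem lo_lt_hi {N : ℕ} (i : Fin (N - 1)) : lo i < hi i := by simp [lo, hi, Fin.lt_def]

theorem adj_mul_adj {N : ℕ} (i : Fin (N - 1)) : adj i * adj i = 1 := Equiv.swap_mul_self _ _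

theorem adj_adj_mul {N : ℕ} (i : Fin (N - 1)) (σ : Equiv.Perm (Fin N)) :
    adj i * (adj i * σ) = σ := by rw [← mul_assoc, adj_mul_adj, one_mul]

theorem adj_inv {N : ℕ} (i : Fin (N - 1)) : (adj i)⁻¹ = adj i := Equiv.swap_inv _ _

theorem adj_lt_iff {N : ℕ} (i : Fin (N - 1)) (a b : Fin N) :
    adj i a < adj i b ↔ (a < b ∧ ¬ (a = lo i ∧ b = hi i)) ∨ (a = hi i ∧ b = lo i) := by
  simp only [adj, Equiv.swap_apply_def]
  split_ifs with h1 h2 h3 h4 h5 h6 h7 h8 <;>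
    simp only [Fin.ext_iff, Fin.lt_def, lo, hi] at * <;> omega

/-- The number of inversions of a permutation. -/
def inversions {N : ℕ} (σ : Equiv.Perm (Fin N)) : Finset (Fin N × Fin N) :=
  Finset.univ.filter fun p => p.1 < p.2 ∧ σ p.2 < σ p.1

/-- Left multiplication by `σ_i` exchanges the values `i` and `i + 1`, so only the pair of places
carrying these two values changes its relative order. -/
theorem card_inversions_adj_mul {N : ℕ} (i : Fin (N - 1)) (σ : Equiv.Perm (Fin N))
    (h : σ⁻¹ (lo i) < σ⁻¹ (hi i)) :
    (inversions (adj i * σ)).card = (inversions σ).card + 1 := by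
  have hl : ∀ a, σ a = lo i ↔ a = σ⁻¹ (lo i) := fun a => by
    rw [Equiv.Perm.eq_inv_iff_eq]
  have hh : ∀ a, σ a = hi i ↔ a = σ⁻¹ (hi i) := fun a => by
    rw [Equiv.Perm.eq_inv_iff_eq]
  have e : inversions (adj i * σ) = insert (σ⁻¹ (lo i), σ⁻¹ (hi i)) (inversions σ) := by
    ext ⟨a, b⟩
    simp only [inversions, Finset.mem_filter, Finset.mem_univ, true_and, Finset.mem_insert,
      Equiv.Perm.mul_apply, adj_lt_iff, Prod.mk.injEq, hl, hh]
    constructor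
    · rintro ⟨h1, ⟨h2, -⟩ | ⟨h2, h3⟩⟩
      · exact Or.inr ⟨h1, h2⟩
      · exact Or.inl ⟨h3, h2⟩
    · rintro (⟨rfl, rfl⟩ | ⟨h1, h2⟩)
      · exact ⟨h, Or.inr ⟨rfl, rfl⟩⟩
      · refine ⟨h1, Or.inl ⟨h2, ?_⟩⟩
        rintro ⟨rfl, rfl⟩
        exact absurd h1 h.asymm
  rw [e, Finset.card_insert_of_notMem]
  simp [inversions, (lo_lt_hi i).le]

theorem card_inversions_adj_mul' {N : ℕ} (i : Fin (N - 1)) (σ : Equiv.Perm (Fin N))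
    (h : σ⁻¹ (hi i) < σ⁻¹ (lo i)) :
    (inversions (adj i * σ)).card + 1 = (inversions σ).card := by
  rw [← card_inversions_adj_mul i (adj i * σ), adj_adj_mul]
  simpa [mul_inv_rev, adj_inv, adj] using h

theorem inv_lo_lt_or {N : ℕ} (i : Fin (N - 1)) (σ : Equiv.Perm (Fin N)) :
    σ⁻¹ (lo i) < σ⁻¹ (hi i) ∨ σ⁻¹ (hi i) < σ⁻¹ (lo i) :=
  lt_or_gt_of_ne fun h => lo_ne_hi i (σ⁻¹.injective h)

theorem card_inversions_word_le {N : ℕ} (l : List (Fin (N - 1))) :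
    (inversions (l.map adj).prod).card ≤ l.length := by
  induction l with
  | nil =>
    simp only [List.map_nil, List.prod_nil, inversions, List.length_nil, Nat.le_zero,
      Finset.card_eq_zero, Finset.filter_eq_empty_iff]
    rintro p - ⟨h1, h2⟩
    exact absurd h1 h2.asymm
  | cons i l ih =>
    simp only [List.map_cons, List.prod_cons, List.length_cons]
    rcases inv_lo_lt_or i (l.map adj).prod with h | h
    · have := card_inversions_adj_mul i _ h; omega
    · have := card_inversions_adj_mul' i _ h; omega

/-- The inverse is then an order automorphism of a finite chain, and there is only one. -/
theorem eq_one_of_no_descent {N : ℕ} (σ : Equiv.Perm (Fin N))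
    (h : ∀ i, σ⁻¹ (lo i) < σ⁻¹ (hi i)) : σ = 1 := by
  cases N with
  | zero => exact Subsingleton.elim _ _
  | succ N =>
    have hm : StrictMono (σ⁻¹ : Equiv.Perm (Fin (N + 1))) := Fin.strictMono_iff_lt_succ.mpr
      fun i => h i
    have h2 := Subsingleton.elim (hm.orderIsoOfSurjective _ σ⁻¹.surjective) (OrderIso.refl _)
    rw [← inv_eq_one]
    ext a
    exact congrArg Fin.val (DFunLike.congr_fun h2 a)

/-- Stripping off one left descent at a time lowers the inversion number by one. Together with
`card_inversions_word_le` this identifies the reduced length with the inversion number. -/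
theorem exists_word_length_eq {N : ℕ} (d : ℕ) (σ : Equiv.Perm (Fin N))
    (hd : (inversions σ).card = d) : ∃ l : List (Fin (N - 1)), (l.map adj).prod = σ ∧ l.length = d := by
  induction d generalizing σ with
  | zero =>
    refine ⟨[], ?_, rfl⟩
    by_contra hne
    refine hne (eq_one_of_no_descent σ fun i => ?_).symm
    refine (inv_lo_lt_or i σ).resolve_right fun h => ?_
    have := card_inversions_adj_mul' i _ h
    omega
  | succ d ih =>
    by_cases h : ∀ i, σ⁻¹ (lo i) < σ⁻¹ (hi i)
    · rw [eq_one_of_no_descent σ h] at hd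
      have := card_inversions_word_le ([] : List (Fin (N - 1)))
      simp only [List.map_nil, List.prod_nil, List.length_nil] at this
      omega
    · push Not at h
      obtain ⟨i, hi'⟩ := h
      have h2 := (inv_lo_lt_or i σ).resolve_left hi'.not_gt
      have h3 := card_inversions_adj_mul' i _ h2
      obtain ⟨l, hl, hl'⟩ := ih (adj i * σ) (by omega)
      exact ⟨i :: l, by simp [hl, adj_adj_mul], by simp [hl']⟩

theorem IsReducedWord.length_eq {N : ℕ} {σ : Equiv.Perm (Fin N)} {l : List (Fin (N - 1))}
    (h : IsReducedWord σ l) : l.length = (inversions σ).card := by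
  obtain ⟨l', h1, h2⟩ := exists_word_length_eq _ σ rfl
  have h3 := h.2 l' h1
  have h4 := card_inversions_word_le l
  rw [h.1] at h4
  omega

/-- If the first letter were an ascent, the rest of the word would be too short for the inversions
of the permutation it represents. -/
theorem descent_of_word_cons {N : ℕ} {σ : Equiv.Perm (Fin N)} {i : Fin (N - 1)}
    {t : List (Fin (N - 1))} (h1 : ((i :: t).map adj).prod = σ)
    (h2 : (i :: t).length = (inversions σ).card) : σ⁻¹ (hi i) < σ⁻¹ (lo i) := by
  refine (inv_lo_lt_or i σ).resolve_left fun h => ?_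
  have h3 := card_inversions_adj_mul i σ h
  have h4 := card_inversions_word_le t
  rw [← h1, List.map_cons, List.prod_cons, adj_adj_mul] at h3
  rw [← h1, List.map_cons, List.prod_cons, List.length_cons] at h2
  omega

/-- Matsumoto's theorem for the symmetric group: a family satisfying the braid relations has the
same product along all reduced words of a permutation. -/
theorem prod_reduced_eq {N : ℕ} {A : Type*} [Monoid A] (T : Fin (N - 1) → A)
    (braid : ∀ i j : Fin (N - 1), (j : ℕ) = i + 1 → T i * T j * T i = T j * T i * T j)
    (far : ∀ i j : Fin (N - 1), (i : ℕ) + 1 < j → T i * T j = T j * T i) (d : ℕ) :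
    ∀ (σ : Equiv.Perm (Fin N)) (l l' : List (Fin (N - 1))), (inversions σ).card = d →
      (l.map adj).prod = σ → (l'.map adj).prod = σ → l.length = d → l'.length = d →
      (l.map T).prod = (l'.map T).prod := by
  induction d using Nat.strong_induction_on with
  | _ d IH =>
  intro σ l l' hσ hl hl' hd hd'
  rcases l with _ | ⟨i, t⟩
  · obtain rfl : l' = [] := List.length_eq_zero_iff.mp (by rw [hd', ← hd]; rfl)
    rfl
  rcases l' with _ | ⟨j, t'⟩
  · simp at hd hd'; omega
  have hi' := descent_of_word_cons hl (hd.trans hσ.symm)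
  have hj' := descent_of_word_cons hl' (hd'.trans hσ.symm)
  have ht : (t.map adj).prod = adj i * σ := by
    rw [← hl, List.map_cons, List.prod_cons, adj_adj_mul]
  have ht' : (t'.map adj).prod = adj j * σ := by
    rw [← hl', List.map_cons, List.prod_cons, adj_adj_mul]
  have ci := card_inversions_adj_mul' i σ hi'
  have cj := card_inversions_adj_mul' j σ hj'
  simp only [List.length_cons] at hd hd'
  simp only [List.map_cons, List.prod_cons]
  clear hl hl'
  wlog hij : i ≤ j generalizing i j t t'
  · exact (this j t' hd' i t hd hj' hi' ht' ht cj ci (le_of_not_ge hij)).symm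
  rcases hij.eq_or_lt with rfl | hlt
  · rw [IH _ (by omega) _ t t' rfl ht ht' (by omega) (by omega)]
  have hs : ∀ (k : Fin (N - 1)) (τ : Equiv.Perm (Fin N)) (a : Fin N),
      (adj k * τ)⁻¹ a = τ⁻¹ (adj k a) := fun k τ a => by
    rw [mul_inv_rev, adj_inv]; rfl
  have hne : ∀ (k : Fin (N - 1)) (a : Fin N), (a : ℕ) ≠ k → (a : ℕ) ≠ k + 1 → adj k a = a :=
    fun k a h1 h2 => Equiv.swap_apply_of_ne_of_ne (by simpa [Fin.ext_iff, lo] using h1)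
      (by simpa [Fin.ext_iff, hi] using h2)
  have hlo : ∀ k : Fin (N - 1), adj k (lo k) = hi k := fun k => Equiv.swap_apply_left _ _
  have hhi : ∀ k : Fin (N - 1), adj k (hi k) = lo k := fun k => Equiv.swap_apply_right _ _
  rw [Fin.lt_def] at hlt
  by_cases hb : (j : ℕ) = i + 1
  -- Adjacent letters: with both `i` and `j` descents, `σ` loses three inversions under `σ_i σ_j
  -- σ_i`. A reduced word `u` of what remains gives the reduced words `iji·u` and `jij·u` of `σ`; by
  -- induction the tails of the given words may be replaced by theirs, and one braid relation joins
  -- the two.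
  · have e : hi i = lo j := by simp [lo, hi, hb]
    have f1 : adj i (hi j) = hi j := hne _ _ (by simp [hi, hb]; omega) (by simp [hi, hb])
    have f2 : adj j (lo i) = lo i := hne _ _ (by simp [lo, hb]) (by simp [lo, hb]; omega)
    have c2 := card_inversions_adj_mul' j (adj i * σ) (by
      rw [hs, hs, f1, ← e, hhi]; exact (e ▸ hj').trans (e ▸ hi'))
    have c3 := card_inversions_adj_mul' i (adj j * (adj i * σ)) (by
      rw [hs, hs, hs, hs, f2, hlo, e, hlo, f1, ← e]; exact e ▸ hj')
    obtain ⟨u, hu, hu'⟩ := exists_word_length_eq _ _ (rfl :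
      (inversions (adj i * (adj j * (adj i * σ)))).card = _)
    have hbr : adj i * (adj j * (adj i * σ)) = adj j * (adj i * (adj j * σ)) := by
      simp only [← mul_assoc]
      congr 1
      ext a
      by_cases h1 : a = lo i
      · subst h1; simp only [Equiv.Perm.mul_apply, hlo, e, f2, f1]
      by_cases h2 : a = hi i
      · subst h2; simp only [Equiv.Perm.mul_apply, f2, hhi, hlo]; simp only [e, hlo, f1, hhi]
      by_cases h3 : a = hi j
      · subst h3; simp only [Equiv.Perm.mul_apply, f1, hhi, ← e, f2]
      have g1 : adj i a = a := Equiv.swap_apply_of_ne_of_ne h1 h2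
      have g2 : adj j a = a := Equiv.swap_apply_of_ne_of_ne (e ▸ h2) h3
      simp only [Equiv.Perm.mul_apply, g1, g2]
    rw [IH _ (by omega) _ t (j :: i :: u) rfl ht (by simp [hu, adj_adj_mul]) (by omega)
        (by simp only [List.length_cons]; omega),
      IH _ (by omega) _ t' (i :: j :: u) rfl ht' (by simp [hu, hbr, adj_adj_mul]) (by omega)
        (by simp only [List.length_cons]; omega)]
    simp only [List.map_cons, List.prod_cons, ← mul_assoc]
    rw [braid i j hb]
  -- Distant letters: the same argument with the words `ij·u` and `ji·u`.
  · have c2 := card_inversions_adj_mul' j (adj i * σ) (by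
      rw [hs, hs, hne i (hi j) (by simp [hi]; omega) (by simp [hi]; omega),
        hne i (lo j) (by simp [lo]; omega) (by simp [lo]; omega)]; exact hj')
    obtain ⟨u, hu, hu'⟩ := exists_word_length_eq _ _ (rfl :
      (inversions (adj j * (adj i * σ))).card = _)
    have hbr : adj j * (adj i * σ) = adj i * (adj j * σ) := by
      simp only [← mul_assoc]
      congr 1
      refine (Equiv.Perm.disjoint_iff_disjoint_support.mpr ?_).commute
      simp only [adj]
      rw [Equiv.Perm.support_swap (lo_ne_hi _), Equiv.Perm.support_swap (lo_ne_hi _)]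
      simp [Fin.ext_iff, lo, hi]
      omega
    rw [IH _ (by omega) _ t (j :: u) rfl ht (by simp [hu, adj_adj_mul]) (by omega)
        (by simp only [List.length_cons]; omega),
      IH _ (by omega) _ t' (i :: u) rfl ht' (by simp [hu, hbr, adj_adj_mul]) (by omega)
        (by simp only [List.length_cons]; omega)]
    simp only [List.map_cons, List.prod_cons, ← mul_assoc]
    rw [far i j (by omega)]

/-- This removes the arbitrary choice of a reduced word from `tPerm`, for families satisfying the
braid relations. -/
theorem tPerm_eq {N : ℕ} {A : Type*} [Monoid A] (T : Fin (N - 1) → A)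
    (braid : ∀ i j : Fin (N - 1), (j : ℕ) = i + 1 → T i * T j * T i = T j * T i * T j)
    (far : ∀ i j : Fin (N - 1), (i : ℕ) + 1 < j → T i * T j = T j * T i)
    {σ : Equiv.Perm (Fin N)} {l : List (Fin (N - 1))} (h1 : (l.map adj).prod = σ)
    (h2 : l.length = (inversions σ).card) : tPerm T σ = (l.map T).prod :=
  have h := (exists_reducedWord σ).choose_spec
  prod_reduced_eq T braid far _ σ _ l rfl h.1 h1 h.length_eq h2

theorem tPerm_adj_mul {N : ℕ} {A : Type*} [Monoid A] (T : Fin (N - 1) → A)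
    (braid : ∀ i j : Fin (N - 1), (j : ℕ) = i + 1 → T i * T j * T i = T j * T i * T j)
    (far : ∀ i j : Fin (N - 1), (i : ℕ) + 1 < j → T i * T j = T j * T i)
    (i : Fin (N - 1)) (σ : Equiv.Perm (Fin N)) (h : σ⁻¹ (lo i) < σ⁻¹ (hi i)) :
    tPerm T (adj i * σ) = T i * tPerm T σ := by
  obtain ⟨l, h1, h2⟩ := exists_word_length_eq _ σ rfl
  rw [tPerm_eq T braid far h1 h2, tPerm_eq T braid far (l := i :: l) (by simp [h1])
    (by rw [card_inversions_adj_mul i σ h, List.length_cons, h2])]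
  simp

/-- Permutations come in pairs `σ`, `σ_i σ`, and the longer member contributes `T_i T_σ`. The factor
`1 + T_i` is what makes the antisymmetrizer kill the image of `T_i - q⁻²`. -/
theorem sum_tPerm_eq {N : ℕ} {A : Type*} [Semiring A] (T : Fin (N - 1) → A)
    (braid : ∀ i j : Fin (N - 1), (j : ℕ) = i + 1 → T i * T j * T i = T j * T i * T j)
    (far : ∀ i j : Fin (N - 1), (i : ℕ) + 1 < j → T i * T j = T j * T i) (i : Fin (N - 1)) :
    ∑ σ, tPerm T σ = (1 + T i) * ∑ σ with σ⁻¹ (lo i) < σ⁻¹ (hi i), tPerm T σ := by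
  rw [add_mul, one_mul, Finset.mul_sum, ← Finset.sum_filter_add_sum_filter_not Finset.univ
    (fun σ : Equiv.Perm (Fin N) => σ⁻¹ (lo i) < σ⁻¹ (hi i))]
  congr 1
  symm
  refine Finset.sum_bij' (fun σ _ => adj i * σ) (fun σ _ => adj i * σ) ?_ ?_ ?_ ?_ ?_
  · intro σ h
    simp only [Finset.mem_filter, Finset.mem_univ, true_and] at h
    simpa only [Finset.mem_filter, Finset.mem_univ, true_and, mul_inv_rev, adj_inv,
      Equiv.Perm.mul_apply, adj, Equiv.swap_inv, Equiv.swap_apply_left, Equiv.swap_apply_right, not_lt] using h.le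
  · intro σ h
    simp only [Finset.mem_filter, Finset.mem_univ, true_and] at h
    simpa only [Finset.mem_filter, Finset.mem_univ, true_and, mul_inv_rev, adj_inv,
      Equiv.Perm.mul_apply, adj, Equiv.swap_inv, Equiv.swap_apply_left, Equiv.swap_apply_right] using
      (inv_lo_lt_or i σ).resolve_left h
  · intro σ _; exact adj_adj_mul i σ
  · intro σ _; exact adj_adj_mul i σ
  · intro σ h
    exact (tPerm_adj_mul T braid far i σ (Finset.mem_filter.mp h).2).symm

scoped instance : Algebra ℕ K := Semiring.toNatAlgebra

scoped instance : Algebra ℤ K := Ring.toIntAlgebra _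

scoped instance (N : ℕ) : AddCommGroup (Tens N) := Finsupp.instAddCommGroup

scoped instance (N : ℕ) : Ring (Module.End K (Tens N)) := Module.End.instRing

/-! ### Laurent polynomials -/

theorem laurent_hom_ext {N : ℕ} {M : Type*} [AddCommMonoid M] [Module K M]
    {f g : Laurent N →ₗ[K] M} (h : ∀ r, f (zmon r) = g (zmon r)) : f = g :=
  AddMonoidAlgebra.lhom_ext' fun r => LinearMap.ext_ring (h r)

theorem zmon_mul_zmon {N : ℕ} (r s : Fin N → ℤ) : zmon r * zmon s = zmon (r + s) := by
  simp [zmon, AddMonoidAlgebra.single_mul_single]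

theorem zmon_zero {N : ℕ} : (zmon 0 : Laurent N) = 1 := rfl

theorem sigmaZ_zmon {N : ℕ} (i : Fin (N - 1)) (r : Fin N → ℤ) :
    sigmaZ i (zmon r) = zmon (r ∘ adj i) := laurentLin_zmon _ _

theorem sigmaZ_mul {N : ℕ} (i : Fin (N - 1)) (f g : Laurent N) :
    sigmaZ i (f * g) = sigmaZ i f * sigmaZ i g := by
  suffices h : (LinearMap.mul K (Laurent N)).compr₂ (sigmaZ i) =
      (LinearMap.mul K (Laurent N)).compl₁₂ (sigmaZ i) (sigmaZ i) from
    LinearMap.congr_fun (LinearMap.congr_fun h f) g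
  refine laurent_hom_ext fun r => laurent_hom_ext fun s => ?_
  simp only [LinearMap.compr₂_apply, LinearMap.mul_apply', LinearMap.compl₁₂_apply, zmon_mul_zmon,
    sigmaZ_zmon]
  rfl

theorem single_comp_adj {N : ℕ} (i : Fin (N - 1)) (j : Fin N) (c : ℤ) :
    (Pi.single j c : Fin N → ℤ) ∘ adj i = Pi.single (adj i j) c := by
  funext s
  simp only [Function.comp_apply, Pi.single_apply]
  congr 1
  rw [eq_iff_iff, ← (adj i).apply_eq_iff_eq (y := j)]
  simp [adj]

theorem adj_lo {N : ℕ} (i : Fin (N - 1)) : adj i (lo i) = hi i := Equiv.swap_apply_left _ _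

theorem adj_hi {N : ℕ} (i : Fin (N - 1)) : adj i (hi i) = lo i := Equiv.swap_apply_right _ _

theorem adj_of_ne {N : ℕ} {i : Fin (N - 1)} {j : Fin N} (h1 : j ≠ lo i) (h2 : j ≠ hi i) :
    adj i j = j := Equiv.swap_apply_of_ne_of_ne h1 h2

theorem comp_adj_comp_adj {N : ℕ} {α : Type*} (i : Fin (N - 1)) (r : Fin N → α) :
    (r ∘ adj i) ∘ adj i = r := by
  funext s; simp [adj]

/-- The inverse `z_j⁻¹` of a variable. -/
def zinv {N : ℕ} (j : Fin N) : Laurent N := zmon (Pi.single j (-1))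

theorem zvar_mul_zinv {N : ℕ} (j : Fin N) : zvar j * zinv j = 1 := by
  rw [zvar, zinv, zmon_mul_zmon, ← Pi.single_add]; simp [zmon_zero]

theorem sigmaZ_zvar {N : ℕ} (i : Fin (N - 1)) (j : Fin N) :
    sigmaZ i (zvar j) = zvar (adj i j) := by
  rw [zvar, sigmaZ_zmon, single_comp_adj]; rfl

theorem sigmaZ_zinv {N : ℕ} (i : Fin (N - 1)) (j : Fin N) :
    sigmaZ i (zinv j) = zinv (adj i j) := by
  rw [zinv, sigmaZ_zmon, single_comp_adj]; rfl

theorem zvar_sub_zvar_ne_zero {N : ℕ} (i : Fin (N - 1)) :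
    (zvar (lo i) - zvar (hi i) : Laurent N) ≠ 0 := by
  rw [sub_ne_zero]
  intro h
  have h2 := congrArg (fun f : Laurent N => f.coeff (Pi.single (lo i) 1)) h
  have h3 : (Pi.single (hi i) 1 : Fin N → ℤ) ≠ Pi.single (lo i) 1 := fun h => by
    have := congrFun h (lo i)
    simp [lo_ne_hi] at this
  simp [zvar, zmon, Finsupp.single_apply, h3] at h2

/-- Laurent polynomials form a domain, so the divided difference is determined by its defining
equation. The Leibniz-type identities that follow are checked by clearing the denominator in this
way. -/
theorem ddiff_eq_iff {N : ℕ} (i : Fin (N - 1)) (f g : Laurent N) :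
    ddiff i f = g ↔ f - sigmaZ i f = (zvar (lo i) - zvar (hi i)) * g := by
  rw [← ddiff_spec]
  exact ⟨fun h => by rw [h], fun h => mul_left_cancel₀ (zvar_sub_zvar_ne_zero i) h⟩

theorem ddiff_zvar_lo_mul {N : ℕ} (i : Fin (N - 1)) (f : Laurent N) :
    ddiff i (zvar (lo i) * f) = f + zvar (hi i) * ddiff i f := by
  rw [ddiff_eq_iff, sigmaZ_mul, sigmaZ_zvar, adj_lo]
  linear_combination -zvar (hi i) * ddiff_spec i f

theorem zvar_lo_mul_ddiff_zinv_lo {N : ℕ} (i : Fin (N - 1)) (f : Laurent N) :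
    zvar (lo i) * ddiff i (zinv (lo i) * f) =
      zinv (hi i) * (zvar (lo i) * ddiff i f) - zinv (hi i) * f := by
  apply mul_left_cancel₀ (zvar_sub_zvar_ne_zero i)
  have h := ddiff_spec i (zinv (lo i) * f)
  rw [sigmaZ_mul, sigmaZ_zinv, adj_lo] at h
  linear_combination zvar (lo i) * h - zinv (hi i) * zvar (lo i) * ddiff_spec i f +
    f * zvar_mul_zinv (lo i) - f * zvar_mul_zinv (hi i)

theorem ddiff_zvar_lo_mul_zinv_hi {N : ℕ} (i : Fin (N - 1)) (f : Laurent N) :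
    ddiff i (zvar (lo i) * (zinv (hi i) * f)) =
      zinv (lo i) * ddiff i (zvar (lo i) * f) + zinv (hi i) * f := by
  apply mul_left_cancel₀ (zvar_sub_zvar_ne_zero i)
  have h1 := ddiff_spec i (zvar (lo i) * (zinv (hi i) * f))
  have h2 := ddiff_spec i (zvar (lo i) * f)
  rw [sigmaZ_mul, sigmaZ_mul, sigmaZ_zinv, adj_hi, sigmaZ_zvar, adj_lo] at h1
  rw [sigmaZ_mul, sigmaZ_zvar, adj_lo] at h2
  linear_combination h1 - zinv (lo i) * h2 -
    f * zvar_mul_zinv (lo i) + f * zvar_mul_zinv (hi i)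

theorem zvar_lo_mul_ddiff_zinv_hi {N : ℕ} (i : Fin (N - 1)) (f : Laurent N) :
    zvar (lo i) * ddiff i (zinv (hi i) * f) =
      zinv (lo i) * (zvar (lo i) * ddiff i f) + zinv (hi i) * f := by
  apply mul_left_cancel₀ (zvar_sub_zvar_ne_zero i)
  have h := ddiff_spec i (zinv (hi i) * f)
  rw [sigmaZ_mul, sigmaZ_zinv, adj_hi] at h
  linear_combination zvar (lo i) * h - zinv (lo i) * zvar (lo i) * ddiff_spec i f +
    f * zvar_mul_zinv (hi i) - f * zvar_mul_zinv (lo i)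

theorem ddiff_zinv_mul {N : ℕ} (i : Fin (N - 1)) {j : Fin N} (h1 : j ≠ lo i) (h2 : j ≠ hi i)
    (f : Laurent N) : ddiff i (zinv j * f) = zinv j * ddiff i f := by
  rw [ddiff_eq_iff, sigmaZ_mul, sigmaZ_zinv, adj_of_ne h1 h2]
  linear_combination -zinv j * ddiff_spec i f

theorem ddiff_one {N : ℕ} (i : Fin (N - 1)) : ddiff i (1 : Laurent N) = 0 := by
  rw [ddiff_eq_iff, ← zmon_zero, sigmaZ_zmon]; simp

/-! ### The operators on `v_m · f` -/

/-- The entries of `m` are colours, i.e. lie in `{1, …, n}`. -/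
def IsColoring (n : ℕ) {N : ℕ} (m : Fin N → ℤ) : Prop := ∀ j, 1 ≤ m j ∧ m j ≤ n

theorem IsColoring.comp {n N : ℕ} {m : Fin N → ℤ} (h : IsColoring n m) (g : Fin N → Fin N) :
    IsColoring n (m ∘ g) := fun j => h (g j)

theorem vMul_zmon (n : ℕ) {N : ℕ} (m r : Fin N → ℤ) :
    vMul n m (zmon r) = Finsupp.single (fun j => m j - n * r j) 1 := laurentLin_zmon _ _

theorem sub_mul_ediv_emod {n : ℕ} {m r : ℤ} (h : 1 ≤ m ∧ m ≤ n) :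
    (m - n * r - 1) / n = -r ∧ (m - n * r - 1) % n = m - 1 := by
  rw [Int.ediv_emod_unique (by omega)]
  refine ⟨by ring, by omega, by omega⟩

theorem color_sub_mul {n : ℕ} {m : ℤ} (h : 1 ≤ m ∧ m ≤ n) (r : ℤ) : color n (m - n * r) = m := by
  rw [color, (sub_mul_ediv_emod h).2]; ring

theorem zdeg_sub_mul {n : ℕ} {m : ℤ} (h : 1 ≤ m ∧ m ≤ n) (r : ℤ) : zdeg n (m - n * r) = r := by
  rw [zdeg, (sub_mul_ediv_emod h).1]; ring

theorem single_eq_vMul (n : ℕ) {N : ℕ} (a : Fin N → ℤ) :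
    (Finsupp.single a 1 : Tens N) =
      vMul n (fun j => color n (a j)) (zmon fun j => zdeg n (a j)) := by
  rw [vMul_zmon]; simp only [color_sub_zdeg]

/-- Testing on `v_m · f` with an arbitrary Laurent polynomial `f` lets the commutation relations be
computed from identities for `∂_i` instead of on monomials. -/
theorem tens_hom_ext {n N : ℕ} (hn : 1 ≤ n) {M : Type*} [AddCommMonoid M] [Module K M]
    {f g : Tens N →ₗ[K] M} (h : ∀ m r, IsColoring n m → f (vMul n m r) = g (vMul n m r)) :
    f = g := by
  refine Finsupp.lhom_ext' fun a => LinearMap.ext_ring ?_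
  change f (Finsupp.single a 1) = g (Finsupp.single a 1)
  rw [single_eq_vMul n]
  exact h _ _ fun j => color_mem n hn (a j)

/-- The condition on `m` is essential: `heckeT` reads the colours back from the indices `m_j - n
r_j`, which recovers `m` only if its entries lie in `{1, …, n}`. -/
theorem heckeT_vMul {n N : ℕ} (i : Fin (N - 1)) {m : Fin N → ℤ} (hm : IsColoring n m)
    (f : Laurent N) : heckeT n i (vMul n m f) =
    if m (lo i) < m (hi i) then
      -q⁻¹ • vMul n (m ∘ adj i) (sigmaZ i f) +
        (q⁻¹ ^ 2 - 1) • vMul n m (ddiff i (zvar (lo i) * f))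
    else if m (lo i) = m (hi i) then
      -vMul n m (sigmaZ i f) + (q⁻¹ ^ 2 - 1) • vMul n m (zvar (lo i) * ddiff i f)
    else
      -q⁻¹ • vMul n (m ∘ adj i) (sigmaZ i f) +
        (q⁻¹ ^ 2 - 1) • vMul n m (zvar (lo i) * ddiff i f) := by
  let T1 : Laurent N →ₗ[K] Tens N := -q⁻¹ • vMul n (m ∘ adj i) ∘ₗ sigmaZ i +
        (q⁻¹ ^ 2 - 1) • vMul n m ∘ₗ ddiff i ∘ₗ LinearMap.mulLeft K (zvar (lo i))
  let T2 : Laurent N →ₗ[K] Tens N := -(vMul n m ∘ₗ sigmaZ i) +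
        (q⁻¹ ^ 2 - 1) • vMul n m ∘ₗ LinearMap.mulLeft K (zvar (lo i)) ∘ₗ ddiff i
  let T3 : Laurent N →ₗ[K] Tens N := -q⁻¹ • vMul n (m ∘ adj i) ∘ₗ sigmaZ i +
        (q⁻¹ ^ 2 - 1) • vMul n m ∘ₗ LinearMap.mulLeft K (zvar (lo i)) ∘ₗ ddiff i
  suffices h : heckeT n i ∘ₗ vMul n m = if m (lo i) < m (hi i) then T1 else
      if m (lo i) = m (hi i) then T2 else T3 by
    have h' := LinearMap.congr_fun h f
    rw [LinearMap.comp_apply] at h'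
    rw [h']
    split_ifs <;> rfl
  refine laurent_hom_ext fun r => ?_
  rw [LinearMap.comp_apply, vMul_zmon, heckeT, Finsupp.linearCombination_single, one_smul]
  simp only [color_sub_mul (hm _), zdeg_sub_mul (hm _)]
  split_ifs <;> rfl

theorem heckeY_single (n : ℕ) {N : ℕ} (j : Fin N) (a : Fin N → ℤ) :
    heckeY n j (Finsupp.single a 1) = Finsupp.single (a + Pi.single j (n : ℤ)) 1 := by
  rw [heckeY, Finsupp.linearCombination_single, one_smul, zmon_mul_zmon, vMul_zmon]
  congr 1
  funext s
  have := color_sub_zdeg n (a s)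
  by_cases h : s = j
  · subst h; simp; linarith
  · simp [h]; linarith

theorem heckeY_vMul (n : ℕ) {N : ℕ} (j : Fin N) (m : Fin N → ℤ) (f : Laurent N) :
    heckeY n j (vMul n m f) = vMul n m (zinv j * f) := by
  suffices h : heckeY n j ∘ₗ vMul n m = vMul n m ∘ₗ LinearMap.mulLeft K (zinv j) from
    LinearMap.congr_fun h f
  refine laurent_hom_ext fun r => ?_
  rw [LinearMap.comp_apply, LinearMap.comp_apply, vMul_zmon, heckeY_single,
    LinearMap.mulLeft_apply, zinv, zmon_mul_zmon, vMul_zmon]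
  congr 1
  funext s
  by_cases h : s = j
  · subst h; simp; ring
  · simp [h]

/-- The operator `y_j⁻¹` on `V(z)^{⊗N}`: multiplication by `z_j`. -/
def heckeYInv (n : ℕ) {N : ℕ} (j : Fin N) : Tens N →ₗ[K] Tens N :=
  Finsupp.lmapDomain K K fun a => a - Pi.single j (n : ℤ)

theorem heckeYInv_single (n : ℕ) {N : ℕ} (j : Fin N) (a : Fin N → ℤ) :
    heckeYInv n j (Finsupp.single a 1) = Finsupp.single (a - Pi.single j (n : ℤ)) 1 := by
  simp [heckeYInv, Finsupp.mapDomain_single]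

theorem tens_hom_ext_single {N : ℕ} {M : Type*} [AddCommMonoid M] [Module K M]
    {f g : Tens N →ₗ[K] M} (h : ∀ a, f (Finsupp.single a 1) = g (Finsupp.single a 1)) : f = g :=
  Finsupp.lhom_ext' fun a => LinearMap.ext_ring (h a)

theorem heckeY_mul_heckeYInv (n : ℕ) {N : ℕ} (j : Fin N) :
    (heckeY n j * heckeYInv n j : Module.End K (Tens N)) = 1 :=
  tens_hom_ext_single fun a => by
    rw [Module.End.mul_apply, heckeYInv_single, heckeY_single, sub_add_cancel]; rfl

theorem heckeYInv_mul_heckeY (n : ℕ) {N : ℕ} (j : Fin N) :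
    (heckeYInv n j * heckeY n j : Module.End K (Tens N)) = 1 :=
  tens_hom_ext_single fun a => by
    rw [Module.End.mul_apply, heckeY_single, heckeYInv_single, add_sub_cancel_right]; rfl

theorem heckeY_comm (n : ℕ) {N : ℕ} (i j : Fin N) :
    (heckeY n i * heckeY n j : Module.End K (Tens N)) = heckeY n j * heckeY n i :=
  tens_hom_ext_single fun a => by
    simp only [Module.End.mul_apply, heckeY_single]; rw [add_right_comm]

/-- The algebra acts on the right, so `y_j T_j` corresponds to the composition that applies `y`
first; every Hecke relation appears here with its factors reversed. -/
theorem heckeT_mul_heckeY_lo {n N : ℕ} (hn : 1 ≤ n) (i : Fin (N - 1)) :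
    (heckeT n i * heckeY n (lo i) : Module.End K (Tens N)) =
      heckeY n (hi i) * heckeT n i - (q⁻¹ ^ 2 - 1) • heckeY n (hi i) := by
  refine tens_hom_ext hn fun m f hm => ?_
  simp only [Module.End.mul_apply, LinearMap.sub_apply, LinearMap.smul_apply, heckeY_vMul,
    heckeT_vMul i hm]
  have e : ∀ g : Laurent N, zvar (lo i) * (zinv (lo i) * g) = g := fun g => by
    rw [← mul_assoc, zvar_mul_zinv, one_mul]
  have e2 : ∀ g : Laurent N, zinv (hi i) * (zvar (hi i) * g) = g := fun g => by
    rw [← mul_assoc, mul_comm (zinv _), zvar_mul_zinv, one_mul]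
  split_ifs
  · simp only [map_add, map_smul, heckeY_vMul, sigmaZ_mul, sigmaZ_zinv, adj_lo, e,
      ddiff_zvar_lo_mul, mul_add, e2]
    module
  · simp only [map_add, map_smul, map_neg, heckeY_vMul, sigmaZ_mul, sigmaZ_zinv, adj_lo,
      zvar_lo_mul_ddiff_zinv_lo, map_sub]
    module
  · simp only [map_add, map_smul, map_neg, heckeY_vMul, sigmaZ_mul, sigmaZ_zinv, adj_lo,
      zvar_lo_mul_ddiff_zinv_lo, map_sub]
    module

theorem heckeT_mul_heckeY_hi {n N : ℕ} (hn : 1 ≤ n) (i : Fin (N - 1)) :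
    (heckeT n i * heckeY n (hi i) : Module.End K (Tens N)) =
      heckeY n (lo i) * heckeT n i + (q⁻¹ ^ 2 - 1) • heckeY n (hi i) := by
  refine tens_hom_ext hn fun m f hm => ?_
  simp only [Module.End.mul_apply, LinearMap.add_apply, LinearMap.smul_apply, heckeY_vMul,
    heckeT_vMul i hm]
  split_ifs <;>
  · simp only [map_add, map_smul, map_neg, heckeY_vMul, sigmaZ_mul, sigmaZ_zinv, adj_hi,
      ddiff_zvar_lo_mul_zinv_hi, zvar_lo_mul_ddiff_zinv_hi]
    module

theorem heckeT_mul_heckeY_of_ne {n N : ℕ} (hn : 1 ≤ n) (i : Fin (N - 1)) {j : Fin N}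
    (h1 : j ≠ lo i) (h2 : j ≠ hi i) :
    (heckeT n i * heckeY n j : Module.End K (Tens N)) = heckeY n j * heckeT n i := by
  refine tens_hom_ext hn fun m f hm => ?_
  simp only [Module.End.mul_apply, heckeY_vMul, heckeT_vMul i hm]
  have e : ∀ g : Laurent N, zvar (lo i) * (zinv j * g) = zinv j * (zvar (lo i) * g) :=
    fun g => mul_left_comm _ _ _
  split_ifs <;>
  · simp only [map_add, map_smul, map_neg, heckeY_vMul, sigmaZ_mul, sigmaZ_zinv,
      adj_of_ne h1 h2, e, ddiff_zinv_mul i h1 h2]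

/-- An endomorphism which permutes the `y_j` and kills the tensors of degree `0` in `z`
vanishes. -/
theorem eq_zero_of_intertwining {n N : ℕ} (hn : 1 ≤ n) (D : Module.End K (Tens N))
    (g : Fin N → Fin N) (hD : ∀ j, D * heckeY n j = heckeY n (g j) * D)
    (h0 : ∀ m, IsColoring n m → D (Finsupp.single m 1) = 0) : D = 0 := by
  have hY : ∀ j w, heckeY n (N := N) j w = 0 → w = 0 := fun j w hw => by
    have := LinearMap.congr_fun (heckeYInv_mul_heckeY n j) w
    rw [Module.End.mul_apply, hw, map_zero] at this
    exact this.symm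
  have hD' : ∀ j w, D (heckeY n j w) = heckeY n (g j) (D w) := fun j w =>
    LinearMap.congr_fun (hD j) w
  -- Vanishing spreads along the orbit of `y_j`: upwards by the intertwining relation, downwards
  -- because `y_{g j}` is injective.
  have step : ∀ (j : Fin N) (k : ℤ) (a : Fin N → ℤ), D (Finsupp.single a 1) = 0 →
      D (Finsupp.single (a + (n : Fin N → ℤ) * Pi.single j k) 1) = 0 := by
    intro j k a ha
    induction k using Int.induction_on with
    | zero => simpa using ha
    | succ k ih =>
      have := hD' j (Finsupp.single (a + (n : Fin N → ℤ) * Pi.single j (k : ℤ)) 1)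
      rw [ih, map_zero, heckeY_single] at this
      rw [← this]
      congr 2
      funext s
      simp only [Pi.add_apply, Pi.mul_apply, Pi.single_apply, Pi.natCast_apply]
      split_ifs <;> ring
    | pred k ih =>
      apply hY (g j)
      rw [← hD', heckeY_single, ← ih]
      congr 2
      funext s
      simp only [Pi.add_apply, Pi.mul_apply, Pi.single_apply, Pi.natCast_apply, Pi.sub_apply]
      split_ifs <;> ring
  refine tens_hom_ext_single fun a => ?_
  have key : ∀ (S : Finset (Fin N)) (r : Fin N → ℤ) (a : Fin N → ℤ),
      D (Finsupp.single a 1) = 0 →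
      D (Finsupp.single (a + (n : Fin N → ℤ) * ∑ j ∈ S, Pi.single j (r j)) 1) = 0 := by
    intro S r a ha
    classical
    induction S using Finset.induction_on with
    | empty => simpa using ha
    | insert j S hj ih =>
      rw [Finset.sum_insert hj, mul_add, add_left_comm, add_comm]
      exact step j _ _ ih
  have := key Finset.univ (fun j => -zdeg n (a j)) (fun j => color n (a j))
    (h0 _ fun j => color_mem n hn (a j))
  rw [LinearMap.zero_apply, ← this]
  congr 2
  funext s
  rw [Finset.univ_sum_single (fun j => -zdeg n (a j))]
  have := color_sub_zdeg n (a s)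
  simp only [Pi.add_apply, Pi.mul_apply, Pi.natCast_apply]
  linarith

/-- In degree zero `∂_i 1 = 0`, and what is left is the finite Hecke action on colours. It permutes
colourings, so the relations among the `T_i` become finite case checks. -/
theorem heckeT_single_coloring {n N : ℕ} (i : Fin (N - 1)) {m : Fin N → ℤ}
    (hm : IsColoring n m) : heckeT n i (Finsupp.single m 1) =
    if m (lo i) < m (hi i) then
      -q⁻¹ • Finsupp.single (m ∘ adj i) 1 + (q⁻¹ ^ 2 - 1) • Finsupp.single m 1
    else if m (lo i) = m (hi i) then -Finsupp.single m 1
    else -q⁻¹ • Finsupp.single (m ∘ adj i) 1 := by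
  have e : ∀ m : Fin N → ℤ, (Finsupp.single m 1 : Tens N) = vMul n m 1 := fun m => by
    rw [← zmon_zero, vMul_zmon]; simp
  have e1 : sigmaZ i (1 : Laurent N) = 1 := by rw [← zmon_zero, sigmaZ_zmon]; rfl
  rw [e, e, heckeT_vMul i hm]
  simp only [ddiff_zvar_lo_mul, ddiff_one, e1, mul_zero, add_zero, map_zero, smul_zero]

/-! ### The quadratic, distant and braid relations for the operators `T_i`. -/

theorem q_ne_zero : q ≠ 0 := RatFunc.X_ne_zero

theorem heckeT_quad {n N : ℕ} (hn : 1 ≤ n) (i : Fin (N - 1)) :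
    (heckeT n i * heckeT n i : Module.End K (Tens N)) =
      (q⁻¹ ^ 2 - 1) • heckeT n i + (q⁻¹ ^ 2) • 1 := by
  rw [← sub_eq_zero]
  have h1 := heckeT_mul_heckeY_lo hn i
  have h2 := heckeT_mul_heckeY_hi hn i
  have h1' := fun X => congrArg (fun Z : Module.End K (Tens N) => Z * X) h1
  have h2' := fun X => congrArg (fun Z : Module.End K (Tens N) => Z * X) h2
  simp only [mul_assoc, sub_mul, add_mul, smul_mul_assoc] at h1' h2'
  -- The quadratic expression in `T_i` commutes with every `y_j`, which is a formal consequence of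
  -- the mixed relations; so it only has to vanish in degree zero.
  refine eq_zero_of_intertwining hn _ id (fun j => ?_) fun m hm => ?_
  · by_cases hl : j = lo i
    · subst hl
      simp only [sub_mul, add_mul, mul_assoc, smul_mul_assoc, h1, mul_sub, mul_add, h2', h1', h2,
        mul_smul_comm, one_mul, mul_one, id]
      module
    by_cases hh : j = hi i
    · subst hh
      simp only [sub_mul, add_mul, mul_assoc, smul_mul_assoc, h1, mul_sub, mul_add, h2', h1', h2,
        mul_smul_comm, one_mul, mul_one, id]
      module
    have h3 := heckeT_mul_heckeY_of_ne hn i hl hh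
    have h3' := fun X => congrArg (fun Z : Module.End K (Tens N) => Z * X) h3
    simp only [mul_assoc] at h3'
    simp only [sub_mul, add_mul, mul_assoc, smul_mul_assoc, mul_sub, mul_add, h3', h3,
        mul_smul_comm, one_mul, mul_one, id]
  · simp only [LinearMap.sub_apply, LinearMap.add_apply, Module.End.mul_apply,
      LinearMap.smul_apply, Module.End.one_apply, heckeT_single_coloring i hm]
    rcases lt_trichotomy (m (lo i)) (m (hi i)) with h | h | h
    · simp only [h, if_true, map_add, map_smul, heckeT_single_coloring i hm,
        heckeT_single_coloring i (hm.comp (adj i)), Function.comp_apply, adj_lo, adj_hi,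
        h.not_gt, h.ne', if_false, comp_adj_comp_adj]
      module
    · simp only [h, lt_irrefl, if_true, if_false, map_neg, heckeT_single_coloring i hm]
      module
    · simp only [h, h.not_gt, h.ne', if_true, map_smul, heckeT_single_coloring i hm,
        heckeT_single_coloring i (hm.comp (adj i)), Function.comp_apply, adj_lo, adj_hi,
        if_false, comp_adj_comp_adj]
      module

/-- The commutation relations between `T_i` and `y_k`, in uniform shape. -/
theorem heckeT_mul_heckeY {n N : ℕ} (hn : 1 ≤ n) (i : Fin (N - 1)) (k : Fin N)
    (X : Module.End K (Tens N)) :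
    heckeT n i * (heckeY n k * X) = heckeY n (adj i k) * (heckeT n i * X) +
      (if k = lo i then -(q⁻¹ ^ 2 - 1) else if k = hi i then q⁻¹ ^ 2 - 1 else 0 : K) •
        (heckeY n (hi i) * X) := by
  split_ifs with h1 h2
  · rw [h1, adj_lo, ← mul_assoc, heckeT_mul_heckeY_lo hn, sub_mul, mul_assoc, smul_mul_assoc,
      neg_smul, sub_eq_add_neg]
  · rw [h2, adj_hi, ← mul_assoc, heckeT_mul_heckeY_hi hn, add_mul, mul_assoc, smul_mul_assoc]
  · rw [adj_of_ne h1 h2, ← mul_assoc, heckeT_mul_heckeY_of_ne hn i h1 h2, zero_smul, add_zero,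
      mul_assoc]

theorem heckeT_mul_heckeY' {n N : ℕ} (hn : 1 ≤ n) (i : Fin (N - 1)) (k : Fin N) :
    (heckeT n i * heckeY n k : Module.End K (Tens N)) = heckeY n (adj i k) * heckeT n i +
      (if k = lo i then -(q⁻¹ ^ 2 - 1) else if k = hi i then q⁻¹ ^ 2 - 1 else 0 : K) •
        heckeY n (hi i) := by
  simpa using heckeT_mul_heckeY hn i k 1

theorem heckeT_far {n N : ℕ} (hn : 1 ≤ n) (i j : Fin (N - 1)) (hij : (i : ℕ) + 1 < j) :
    (heckeT n i * heckeT n j : Module.End K (Tens N)) = heckeT n j * heckeT n i := by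
  rw [← sub_eq_zero]
  obtain ⟨h1, h2, h3, h4⟩ : lo i ≠ lo j ∧ lo i ≠ hi j ∧ hi i ≠ lo j ∧ hi i ≠ hi j := by
    simp only [lo, hi, ne_eq, Fin.mk.injEq]; omega
  have e1 : adj i (lo j) = lo j := adj_of_ne h1.symm h3.symm
  have e2 : adj i (hi j) = hi j := adj_of_ne h2.symm h4.symm
  have e3 : adj j (lo i) = lo i := adj_of_ne h1 h2
  have e4 : adj j (hi i) = hi i := adj_of_ne h3 h4
  -- The lower-order terms created by moving `y_k` to the left agree in both products, so the
  -- difference intertwines the `y_k` according to the permutation `σ_i σ_j`.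
  refine eq_zero_of_intertwining hn _ (fun k => adj i (adj j k)) (fun k => ?_) fun m hm => ?_
  · by_cases g1 : k = lo i
    · subst g1
      simp only [sub_mul, mul_sub, mul_add, mul_assoc, heckeT_mul_heckeY hn, heckeT_mul_heckeY' hn,
        mul_smul_comm, e1, e2, e3, e4, h1, h2, h3, h4, adj_lo, if_true, if_false]
      module
    by_cases g2 : k = hi i
    · subst g2
      simp only [sub_mul, mul_sub, mul_add, mul_assoc, heckeT_mul_heckeY hn, heckeT_mul_heckeY' hn,
        mul_smul_comm, e1, e2, e3, e4, h1, h2, h3, h4, adj_hi, (lo_ne_hi i).symm, if_true,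
        if_false]
      module
    have e5 : adj i k = k := adj_of_ne g1 g2
    by_cases g3 : k = lo j
    · subst g3
      simp only [sub_mul, mul_sub, mul_add, mul_assoc, heckeT_mul_heckeY hn, heckeT_mul_heckeY' hn,
        mul_smul_comm, e1, e2, e3, e4, h1.symm, h2.symm, h3.symm, h4.symm, adj_lo, if_true,
        if_false]
      module
    by_cases g4 : k = hi j
    · subst g4
      simp only [sub_mul, mul_sub, mul_add, mul_assoc, heckeT_mul_heckeY hn, heckeT_mul_heckeY' hn,
        mul_smul_comm, e1, e2, e3, e4, h1.symm, h2.symm, h3.symm, h4.symm, adj_hi,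
        (lo_ne_hi j).symm, if_true, if_false]
      module
    have e6 : adj j k = k := adj_of_ne g3 g4
    simp only [sub_mul, mul_sub, mul_add, mul_assoc, heckeT_mul_heckeY hn, heckeT_mul_heckeY' hn,
        mul_smul_comm, e5, e6, g1, g2, g3, g4, if_false]
    module
  · have hc : ∀ m : Fin N → ℤ, m ∘ adj j ∘ adj i = m ∘ adj i ∘ adj j := fun m => by
      funext s
      simp only [Function.comp_apply]
      congr 1
      by_cases g1 : s = lo i
      · subst g1; simp only [adj_lo, e3, e4]
      by_cases g2 : s = hi i
      · subst g2; simp only [adj_hi, e3, e4]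
      by_cases g3 : s = lo j
      · subst g3; simp only [adj_lo, e1, e2]
      by_cases g4 : s = hi j
      · subst g4; simp only [adj_hi, e1, e2]
      simp only [adj_of_ne g1 g2, adj_of_ne g3 g4]
    have fi := fun m hm => heckeT_single_coloring (n := n) i (m := m) hm
    have fj := fun m hm => heckeT_single_coloring (n := n) j (m := m) hm
    simp only [LinearMap.sub_apply, Module.End.mul_apply, fi m hm, fj m hm]
    rcases lt_trichotomy (m (lo i)) (m (hi i)) with h | h | h <;>
    rcases lt_trichotomy (m (lo j)) (m (hi j)) with g | g | g <;>
    · simp (disch := omega) only [if_true, if_pos, if_neg, map_add, map_smul, map_neg, fi m hm, fj m hm,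
        fi _ (hm.comp (adj j)), fj _ (hm.comp (adj i)), Function.comp_apply, adj_lo, adj_hi,
        e1, e2, e3, e4, Function.comp_assoc, hc]
      module

theorem heckeT_braid {n N : ℕ} (hn : 1 ≤ n) (i j : Fin (N - 1)) (hij : (j : ℕ) = i + 1) :
    (heckeT n i * heckeT n j * heckeT n i : Module.End K (Tens N)) =
      heckeT n j * heckeT n i * heckeT n j := by
  rw [← sub_eq_zero]
  have h0 : hi i = lo j := by simp [lo, hi, hij]
  have h1 : lo i ≠ lo j := by simp [lo, hij]
  have h2 : lo i ≠ hi j := by simp only [lo, hi, ne_eq, Fin.mk.injEq]; omega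
  have h3 : lo j ≠ hi j := lo_ne_hi j
  have e1 : adj i (lo i) = lo j := h0 ▸ adj_lo i
  have e2 : adj i (lo j) = lo i := h0 ▸ adj_hi i
  have e3 : adj i (hi j) = hi j := adj_of_ne h2.symm (h0 ▸ h3.symm)
  have e4 : adj j (lo i) = lo i := adj_of_ne h1 h2
  have e5 : adj j (lo j) = hi j := adj_lo j
  have e6 : adj j (hi j) = lo j := adj_hi j
  have qi := heckeT_quad (N := N) hn i
  have qj := heckeT_quad (N := N) hn j
  have qi' : ∀ X : Module.End K (Tens N), heckeT n i * (heckeT n i * X) =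
      (q⁻¹ ^ 2 - 1) • (heckeT n i * X) + q⁻¹ ^ 2 • X := fun X => by
    rw [← mul_assoc, qi, add_mul, smul_mul_assoc, smul_mul_assoc, one_mul]
  have qj' : ∀ X : Module.End K (Tens N), heckeT n j * (heckeT n j * X) =
      (q⁻¹ ^ 2 - 1) • (heckeT n j * X) + q⁻¹ ^ 2 • X := fun X => by
    rw [← mul_assoc, qj, add_mul, smul_mul_assoc, smul_mul_assoc, one_mul]
  -- Moving `y_k` across three factors leaves terms with a repeated `T`, which is why the quadratic
  -- relation has to be available before the braid relation.
  refine eq_zero_of_intertwining hn _ (fun k => adj i (adj j (adj i k))) (fun k => ?_)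
    fun m hm => ?_
  · by_cases g1 : k = lo i
    · subst g1
      simp only [sub_mul, mul_sub, mul_add, mul_assoc, heckeT_mul_heckeY hn, heckeT_mul_heckeY' hn,
        mul_smul_comm, h0, e1, e2, e3, e4, e5, e6, h1, h2, h3, h1.symm, h2.symm, h3.symm,
        if_true, if_false, qi, qj, qi', qj', mul_one]
      module
    by_cases g2 : k = lo j
    · subst g2
      simp only [sub_mul, mul_sub, mul_add, mul_assoc, heckeT_mul_heckeY hn, heckeT_mul_heckeY' hn,
        mul_smul_comm, h0, e1, e2, e3, e4, e5, e6, h1, h2, h3, h1.symm, h2.symm, h3.symm,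
        if_true, if_false, qi, qj, qi', qj', mul_one]
      module
    by_cases g3 : k = hi j
    · subst g3
      simp only [sub_mul, mul_sub, mul_add, mul_assoc, heckeT_mul_heckeY hn, heckeT_mul_heckeY' hn,
        mul_smul_comm, h0, e1, e2, e3, e4, e5, e6, h1, h2, h3, h1.symm, h2.symm, h3.symm,
        if_true, if_false, qi, qj, qi', qj', mul_one]
      module
    have f1 : adj i k = k := adj_of_ne g1 (h0 ▸ g2)
    have f2 : adj j k = k := adj_of_ne g2 g3
    simp only [sub_mul, mul_sub, mul_add, mul_assoc, heckeT_mul_heckeY hn, heckeT_mul_heckeY' hn,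
        mul_smul_comm, h0, f1, f2, g1, g2, g3, if_false]
    module
  -- Only the colours in three neighbouring places matter. With these as parameters `T_i` and `T_j`
  -- act by transposing arguments, and the check depends only on the relative order of three
  -- integers.
  · let F : ℤ → ℤ → ℤ → Fin N → ℤ := fun x y z s =>
      if s = lo i then x else if s = lo j then y else if s = hi j then z else m s
    have F1 : ∀ x y z, F x y z (lo i) = x := fun x y z => by simp [F]
    have F2 : ∀ x y z, F x y z (lo j) = y := fun x y z => by simp [F, h1.symm]
    have F3 : ∀ x y z, F x y z (hi j) = z := fun x y z => by simp [F, h2.symm, h3.symm]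
    have F4 : ∀ x y z s, s ≠ lo i → s ≠ lo j → s ≠ hi j → F x y z s = m s :=
      fun x y z s hs1 hs2 hs3 => by simp [F, hs1, hs2, hs3]
    have Fi : ∀ x y z, F x y z ∘ adj i = F y x z := fun x y z => by
      funext s
      by_cases g1 : s = lo i
      · subst g1; simp only [Function.comp_apply, e1, F1, F2]
      by_cases g2 : s = lo j
      · subst g2; simp only [Function.comp_apply, e2, F1, F2]
      by_cases g3 : s = hi j
      · subst g3; simp only [Function.comp_apply, e3, F3]
      simp only [Function.comp_apply, adj_of_ne g1 (h0 ▸ g2), F4 _ _ _ _ g1 g2 g3]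
    have Fj : ∀ x y z, F x y z ∘ adj j = F x z y := fun x y z => by
      funext s
      by_cases g1 : s = lo i
      · subst g1; simp only [Function.comp_apply, e4, F1]
      by_cases g2 : s = lo j
      · subst g2; simp only [Function.comp_apply, e5, F2, F3]
      by_cases g3 : s = hi j
      · subst g3; simp only [Function.comp_apply, e6, F2, F3]
      simp only [Function.comp_apply, adj_of_ne g2 g3, F4 _ _ _ _ g1 g2 g3]
    have hF : ∀ x y z : ℤ, (1 ≤ x ∧ x ≤ n) → (1 ≤ y ∧ y ≤ n) → (1 ≤ z ∧ z ≤ n) →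
        IsColoring n (F x y z) := fun x y z hx hy hz s => by
      simp only [F]; split_ifs
      exacts [hx, hy, hz, hm s]
    have fi := fun (x y z : ℤ) hx hy hz => heckeT_single_coloring i (hF x y z hx hy hz)
    have fj := fun (x y z : ℤ) hx hy hz => heckeT_single_coloring j (hF x y z hx hy hz)
    simp only [h0, F1, F2, F3, Fi, Fj] at fi fj
    have hmF : m = F (m (lo i)) (m (lo j)) (m (hi j)) := by
      funext s
      simp only [F]; split_ifs with g1 g2 g3 <;> simp [*]
    suffices key : ∀ x y z : ℤ, (1 ≤ x ∧ x ≤ n) → (1 ≤ y ∧ y ≤ n) → (1 ≤ z ∧ z ≤ n) →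
        (heckeT n i * heckeT n j * heckeT n i - heckeT n j * heckeT n i * heckeT n j :
          Module.End K (Tens N)) (Finsupp.single (F x y z) 1) = 0 by
      rw [hmF]; exact key _ _ _ (hm _) (hm _) (hm _)
    clear hmF
    intro x y z hx hy hz
    clear_value F
    simp only [LinearMap.sub_apply, Module.End.mul_apply]
    rcases lt_trichotomy x y with h | h | h <;>
    rcases lt_trichotomy y z with g | g | g <;>
    rcases lt_trichotomy x z with l | l | l <;>
    first
    | omega
    | (try subst h); (try subst g); (try subst l)
      simp (disch := omega) only [fi, fj, if_true, if_pos, if_neg, map_add, map_smul, map_neg]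
      module

/-! ### The representation of the affine Hecke algebra -/

/-- The images of the generators of the affine Hecke algebra. -/
def heckeGenMap (n N : ℕ) : HeckeGen N → (Module.End K (Tens N))ᵐᵒᵖ
  | .T i => MulOpposite.op (heckeT n i)
  | .y j => MulOpposite.op (heckeY n j)
  | .yInv j => MulOpposite.op (heckeYInv n j)

/-- Passing to the opposite ring reverses products: the commutation relations are used backwards and
the two inverse relations exchange roles. -/
theorem heckeRel_lift {n N : ℕ} (hn : 1 ≤ n) {a b : FreeAlgebra K (HeckeGen N)}
    (h : HeckeRel N (q⁻¹ ^ 2) a b) :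
    FreeAlgebra.lift K (heckeGenMap n N) a = FreeAlgebra.lift K (heckeGenMap n N) b := by
  apply MulOpposite.unop_injective
  induction h with
  | quad i =>
    simp only [fT, map_mul, map_add, map_smul, FreeAlgebra.lift_ι_apply, heckeGenMap,
      MulOpposite.unop_mul, MulOpposite.unop_op, MulOpposite.unop_add, MulOpposite.unop_smul,
      AlgHom.commutes, heckeT_quad hn, MulOpposite.algebraMap_apply, Algebra.algebraMap_eq_smul_one, map_one,
      MulOpposite.unop_one]
  | braid i j h =>
    simp only [fT, map_mul, FreeAlgebra.lift_ι_apply, heckeGenMap,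
      MulOpposite.unop_mul, MulOpposite.unop_op]
    simpa only [mul_assoc] using heckeT_braid hn i j h
  | far i j h =>
    simp only [fT, map_mul, FreeAlgebra.lift_ι_apply, heckeGenMap,
      MulOpposite.unop_mul, MulOpposite.unop_op]
    exact (heckeT_far hn i j h).symm
  | yComm i j =>
    simp only [fy, map_mul, FreeAlgebra.lift_ι_apply, heckeGenMap,
      MulOpposite.unop_mul, MulOpposite.unop_op]
    exact heckeY_comm n j i
  | yMulInv j =>
    simp only [fy, fyInv, map_mul, map_one, FreeAlgebra.lift_ι_apply, heckeGenMap,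
      MulOpposite.unop_mul, MulOpposite.unop_op, MulOpposite.unop_one]
    exact heckeYInv_mul_heckeY n j
  | yInvMul j =>
    simp only [fy, fyInv, map_mul, map_one, FreeAlgebra.lift_ι_apply, heckeGenMap,
      MulOpposite.unop_mul, MulOpposite.unop_op, MulOpposite.unop_one]
    exact heckeY_mul_heckeYInv n j
  | yT j i h₁ h₂ =>
    simp only [fT, fy, map_mul, FreeAlgebra.lift_ι_apply, heckeGenMap,
      MulOpposite.unop_mul, MulOpposite.unop_op]
    exact heckeT_mul_heckeY_of_ne hn i h₁ h₂
  | loT i =>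
    simp only [fT, fy, map_mul, map_sub, map_smul, FreeAlgebra.lift_ι_apply, heckeGenMap,
      MulOpposite.unop_mul, MulOpposite.unop_op, MulOpposite.unop_sub, MulOpposite.unop_smul]
    exact heckeT_mul_heckeY_lo hn i
  | hiT i =>
    simp only [fT, fy, map_mul, map_add, map_smul, FreeAlgebra.lift_ι_apply, heckeGenMap,
      MulOpposite.unop_mul, MulOpposite.unop_op, MulOpposite.unop_add, MulOpposite.unop_smul]
    exact heckeT_mul_heckeY_hi hn i

/-- The right action of the affine Hecke algebra on `V(z)^{⊗N}`. -/
def heckeRep {n : ℕ} (hn : 1 ≤ n) (N : ℕ) :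
    AffineHecke N (q⁻¹ ^ 2) →ₐ[K] (Module.End K (Tens N))ᵐᵒᵖ :=
  RingQuot.liftAlgHom K ⟨FreeAlgebra.lift K (heckeGenMap n N), fun _ _ h => heckeRel_lift hn h⟩

theorem heckeRep_hT {n : ℕ} (hn : 1 ≤ n) {N : ℕ} (i : Fin (N - 1)) :
    heckeRep hn N (hT i) = MulOpposite.op (heckeT n i) := by
  rw [heckeRep, hT, RingQuot.liftAlgHom_mkAlgHom_apply, fT, FreeAlgebra.lift_ι_apply]; rfl

theorem heckeRep_hy {n : ℕ} (hn : 1 ≤ n) {N : ℕ} (j : Fin N) :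
    heckeRep hn N (hy j) = MulOpposite.op (heckeY n j) := by
  rw [heckeRep, hy, RingQuot.liftAlgHom_mkAlgHom_apply, fy, FreeAlgebra.lift_ι_apply]; rfl

theorem heckeRep_hyInv {n : ℕ} (hn : 1 ≤ n) {N : ℕ} (j : Fin N) :
    heckeRep hn N (hyInv j) = MulOpposite.op (heckeYInv n j) := by
  rw [heckeRep, hyInv, RingQuot.liftAlgHom_mkAlgHom_apply, fyInv, FreeAlgebra.lift_ι_apply]; rfl

/-! ### Generating series of complete homogeneous functions of commuting elements -/

open PowerSeries in
/-- The series `∑ h_k(x) t^k`. -/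
def hSeries {N : ℕ} {A : Type*} [Semiring A] (x : Fin N → A) : PowerSeries A :=
  PowerSeries.mk (hComplete x)

/-- The product `(1 - t x_1) ⋯ (1 - t x_N)`. -/
def eSeries {N : ℕ} {A : Type*} [Ring A] (x : Fin N → A) : PowerSeries A :=
  (List.ofFn fun j => 1 - PowerSeries.X * PowerSeries.C (x j)).prod

theorem hComplete_zero {N : ℕ} {A : Type*} [Semiring A] (x : Fin N → A) : hComplete x 0 = 1 := by
  classical
  rw [hComplete, Finset.filter_true_of_mem fun f _ i => i.elim0]
  simp

theorem hComplete_fin_zero {A : Type*} [Semiring A] (x : Fin 0 → A) (k : ℕ) :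
    hComplete x (k + 1) = 0 := by
  simp [hComplete, Finset.univ_eq_empty_iff.mpr
    (show IsEmpty (Fin (k + 1) → Fin 0) from ⟨fun f => (f 0).elim0⟩)]

theorem monotone_cons_zero {N k : ℕ} (f : Fin k → Fin (N + 1)) :
    Monotone (Fin.cons 0 f : Fin (k + 1) → Fin (N + 1)) ↔ Monotone f := by
  constructor
  · intro h i j hij
    simpa using h (Fin.succ_le_succ_iff.mpr hij)
  · intro h i j hij
    refine Fin.cases ?_ (fun i' => ?_) i hij <;> [skip; skip]
    · intro _; simp
    · intro hij
      refine Fin.cases (fun h0 => ?_) (fun j' hj => ?_) j hij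
      · exact absurd h0 (Fin.succ_pos i').not_ge
      · simpa using h (Fin.succ_le_succ_iff.mp hj)

/-- Split the weakly increasing index sequences by whether they begin with `0`; those that do
consist of a `0` followed by an arbitrary increasing sequence. -/
theorem hComplete_succ {N : ℕ} {A : Type*} [Semiring A] (x : Fin (N + 1) → A) (k : ℕ) :
    hComplete x (k + 1) = hComplete (Fin.tail x) (k + 1) + x 0 * hComplete x k := by
  classical
  rw [hComplete, ← Finset.sum_filter_add_sum_filter_not _ (fun f => f 0 ≠ 0)]
  congr 1
  · rw [hComplete, Finset.filter_filter]
    symm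
    refine Finset.sum_bij (fun f _ i => (f i).succ) ?_ ?_ ?_ ?_
    · intro f hf
      simp only [Finset.mem_filter, Finset.mem_univ, true_and] at hf ⊢
      exact ⟨fun i j hij => Fin.succ_le_succ_iff.mpr (hf hij), Fin.succ_ne_zero _⟩
    · intro f _ g _ h
      funext i
      exact Fin.succ_injective _ (congrFun h i)
    · intro f hf
      simp only [Finset.mem_filter, Finset.mem_univ, true_and] at hf
      have h0 : ∀ i, f i ≠ 0 := fun i h => hf.2 (by
        have := hf.1 (Fin.zero_le i); rw [h] at this; exact Fin.le_zero_iff.mp this)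
      refine ⟨fun i => (f i).pred (h0 i), ?_, by funext i; simp⟩
      simp only [Finset.mem_filter, Finset.mem_univ, true_and]
      exact fun i j hij => Fin.pred_le_pred_iff.mpr (hf.1 hij)
    · intro f _
      rfl
  · rw [hComplete, Finset.mul_sum, Finset.filter_filter]
    symm
    refine Finset.sum_bij (fun f _ => (Fin.cons 0 f : Fin (k + 1) → Fin (N + 1))) ?_ ?_ ?_ ?_
    · intro f hf
      simp only [Finset.mem_filter, Finset.mem_univ, true_and] at hf ⊢
      exact ⟨(monotone_cons_zero f).mpr hf, by simp⟩
    · intro f _ g _ h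
      exact Fin.cons_right_injective (α := fun _ => Fin (N + 1)) 0 h
    · intro f hf
      simp only [Finset.mem_filter, Finset.mem_univ, true_and, not_not] at hf
      have e : (Fin.cons 0 (Fin.tail f) : Fin (k + 1) → Fin (N + 1)) = f := by
        rw [← hf.2]; exact Fin.cons_self_tail f
      refine ⟨Fin.tail f, ?_, e⟩
      simp only [Finset.mem_filter, Finset.mem_univ, true_and]
      rw [← monotone_cons_zero, e]; exact hf.1
    · intro f _
      simp [List.ofFn_succ]

/-- No commutativity is needed: the ordered products put the smallest index leftmost, just where the
factor `1 - t x_0` stands. -/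
theorem one_sub_mul_hSeries {N : ℕ} {A : Type*} [Ring A] (x : Fin (N + 1) → A) :
    (1 - PowerSeries.X * PowerSeries.C (x 0)) * hSeries x = hSeries (Fin.tail x) := by
  ext k
  cases k with
  | zero => simp [sub_mul, mul_assoc, hSeries, hComplete_zero]
  | succ k =>
    rw [sub_mul, one_mul, mul_assoc, map_sub, PowerSeries.coeff_succ_X_mul,
      PowerSeries.coeff_C_mul, hSeries, hSeries, PowerSeries.coeff_mk, PowerSeries.coeff_mk,
      PowerSeries.coeff_mk, hComplete_succ, add_sub_cancel_right]

theorem hSeries_fin_zero {A : Type*} [Ring A] (x : Fin 0 → A) : hSeries x = 1 := by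
  ext k
  cases k with
  | zero => simp [hSeries, hComplete_zero]
  | succ k => simp [hSeries, hComplete_fin_zero, PowerSeries.coeff_one]

theorem commute_C {A : Type*} [Semiring A] {a b : A} (h : Commute a b) :
    Commute (PowerSeries.C a) (PowerSeries.C b) := h.map PowerSeries.C

theorem commute_one_sub {A : Type*} [Ring A] {a b : A} (h : Commute a b) :
    Commute (PowerSeries.C a) (1 - PowerSeries.X * PowerSeries.C b) :=
  (Commute.one_right _).sub_right ((PowerSeries.commute_X _).mul_right (commute_C h))

theorem commute_eSeries {N : ℕ} {A : Type*} [Ring A] {x : Fin N → A} {a : A}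
    (h : ∀ j, Commute a (x j)) : Commute (PowerSeries.C a) (eSeries x) := by
  refine Commute.list_prod_right _ _ fun y hy => ?_
  obtain ⟨j, rfl⟩ := List.mem_ofFn.mp hy
  exact commute_one_sub (h j)

theorem eSeries_mul_hSeries {N : ℕ} {A : Type*} [Ring A] (x : Fin N → A)
    (hx : ∀ i j, Commute (x i) (x j)) : eSeries x * hSeries x = 1 := by
  induction N with
  | zero => rw [hSeries_fin_zero, eSeries]; simp
  | succ N ih =>
    have h1 : Commute (1 - PowerSeries.X * PowerSeries.C (x 0)) (eSeries (Fin.tail x)) :=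
      (Commute.one_left _).sub_left (((PowerSeries.commute_X _).symm).mul_left
        (commute_eSeries fun j => hx 0 j.succ))
    rw [eSeries, List.ofFn_succ, List.prod_cons]
    change (1 - PowerSeries.X * PowerSeries.C (x 0)) * eSeries (Fin.tail x) * hSeries x = 1
    rw [h1.eq, mul_assoc, one_sub_mul_hSeries, ih (Fin.tail x) fun i j => hx i.succ j.succ]

theorem commute_hComplete {N : ℕ} {A : Type*} [Semiring A] {x : Fin N → A} {a : A}
    (h : ∀ j, Commute a (x j)) (k : ℕ) : Commute a (hComplete x k) := by
  refine Commute.sum_right _ _ _ fun f _ => Commute.list_prod_right _ _ fun y hy => ?_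
  obtain ⟨j, rfl⟩ := List.mem_ofFn.mp hy
  exact h _

theorem hSeries_mul_eSeries {N : ℕ} {A : Type*} [Ring A] (x : Fin N → A)
    (hx : ∀ i j, Commute (x i) (x j)) : hSeries x * eSeries x = 1 := by
  rw [← eSeries_mul_hSeries x hx]
  refine Commute.list_prod_right _ _ fun y hy => ?_
  obtain ⟨j, rfl⟩ := List.mem_ofFn.mp hy
  refine (Commute.one_right _).sub_right ((PowerSeries.commute_X _).mul_right ?_)
  refine PowerSeries.ext fun k => ?_
  rw [PowerSeries.coeff_mul_C, PowerSeries.coeff_C_mul, hSeries, PowerSeries.coeff_mk]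
  exact (commute_hComplete (fun i => hx j i) k).symm

/-- An operator mixing only `x_i` and `x_{i+1}` commutes with `(1 - t x_i)(1 - t x_{i+1})`, whose
coefficients are their sum and product. So it commutes with `∏ (1 - t x_j)` and hence with the
inverse series of the `h_k`. -/
theorem commute_hComplete_of_symm {N : ℕ} {A : Type*} [Ring A] {x : Fin N → A}
    (hx : ∀ i j, Commute (x i) (x j)) {T : A} (i : Fin (N - 1))
    (hT : ∀ j, j ≠ lo i → j ≠ hi i → Commute T (x j))
    (hadd : Commute T (x (lo i) + x (hi i))) (hmul : Commute T (x (lo i) * x (hi i))) (k : ℕ) :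
    Commute T (hComplete x k) := by
  have hE : Commute (PowerSeries.C T) (eSeries x) := by
    set g : Fin N → PowerSeries A := fun j => 1 - PowerSeries.X * PowerSeries.C (x j) with hg
    have hlen : (List.ofFn g).length = N := List.length_ofFn
    have hi1 : (i : ℕ) + 1 < N := by omega
    have hsplit : List.ofFn g = (List.ofFn g).take i ++ g (lo i) :: g (hi i) ::
        (List.ofFn g).drop (i + 2) := by
      conv_lhs => rw [← List.take_append_drop i (List.ofFn g)]
      rw [List.drop_eq_getElem_cons (by omega), List.drop_eq_getElem_cons (by omega)]
      simp [lo, hi]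
    rw [eSeries, ← hg, hsplit, List.prod_append, List.prod_cons, List.prod_cons,
      ← mul_assoc (g (lo i))]
    refine Commute.mul_right (Commute.list_prod_right _ _ fun y hy => ?_)
      (Commute.mul_right ?_ (Commute.list_prod_right _ _ fun y hy => ?_))
    · obtain ⟨j, hj, rfl⟩ := List.mem_take_iff_getElem.mp hy
      rw [List.getElem_ofFn]
      refine commute_one_sub (hT _ ?_ ?_) <;> simp only [lo, hi, ne_eq, Fin.mk.injEq] <;> omega
    · have e : g (lo i) * g (hi i) = 1 - PowerSeries.X * PowerSeries.C (x (lo i) + x (hi i)) +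
          PowerSeries.X * (PowerSeries.X * PowerSeries.C (x (lo i) * x (hi i))) := by
        have h := (PowerSeries.commute_X (PowerSeries.C (x (lo i)))).eq
        simp only [hg, map_add, map_mul, sub_mul, mul_sub, one_mul, mul_one, mul_add, mul_assoc]
        rw [← mul_assoc (PowerSeries.C (x (lo i))), h]
        simp only [mul_assoc]
        abel
      rw [e]
      exact (commute_one_sub hadd).add_right ((PowerSeries.commute_X _).mul_right
        ((PowerSeries.commute_X _).mul_right (commute_C hmul)))
    · obtain ⟨j, hj, rfl⟩ := List.mem_drop_iff_getElem.mp hy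
      rw [List.getElem_ofFn]
      refine commute_one_sub (hT _ ?_ ?_) <;> simp only [lo, hi, ne_eq, Fin.mk.injEq] <;> omega
  have hH : Commute (PowerSeries.C T) (hSeries x) := by
    have h1 := eSeries_mul_hSeries x hx
    have h2 := hSeries_mul_eSeries x hx
    calc PowerSeries.C T * hSeries x
        = hSeries x * (eSeries x * PowerSeries.C T) * hSeries x := by
          rw [← mul_assoc (hSeries x), h2, one_mul]
      _ = hSeries x * PowerSeries.C T := by rw [← hE.eq, mul_assoc, mul_assoc, h1, mul_one]
  have := congrArg (PowerSeries.coeff k) hH.eq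
  rwa [PowerSeries.coeff_mul_C, PowerSeries.coeff_C_mul, hSeries, PowerSeries.coeff_mk] at this

/-! ### Central elements of the affine Hecke algebra -/

theorem hecke_rel {N : ℕ} {Q : K} {a b : FreeAlgebra K (HeckeGen N)} (h : HeckeRel N Q a b) :
    RingQuot.mkAlgHom K (HeckeRel N Q) a = RingQuot.mkAlgHom K (HeckeRel N Q) b :=
  RingQuot.mkAlgHom_rel K h

theorem hy_comm {N : ℕ} {Q : K} (i j : Fin N) : Commute (hy i : AffineHecke N Q) (hy j) := by
  have h := hecke_rel (HeckeRel.yComm (Q := Q) i j)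
  simp only [map_mul] at h
  exact h

theorem hy_mul_hyInv {N : ℕ} {Q : K} (j : Fin N) : (hy j * hyInv j : AffineHecke N Q) = 1 := by
  have h := hecke_rel (HeckeRel.yMulInv (Q := Q) j)
  simp only [map_mul, map_one] at h
  exact h

theorem hyInv_mul_hy {N : ℕ} {Q : K} (j : Fin N) : (hyInv j * hy j : AffineHecke N Q) = 1 := by
  have h := hecke_rel (HeckeRel.yInvMul (Q := Q) j)
  simp only [map_mul, map_one] at h
  exact h

theorem hy_mul_hT {N : ℕ} {Q : K} {j : Fin N} {i : Fin (N - 1)} (h₁ : j ≠ lo i) (h₂ : j ≠ hi i) :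
    Commute (hy j : AffineHecke N Q) (hT i) := by
  have h := hecke_rel (HeckeRel.yT (Q := Q) j i h₁ h₂)
  simp only [map_mul] at h
  exact h

theorem hy_lo_mul_hT {N : ℕ} {Q : K} (i : Fin (N - 1)) :
    (hy (lo i) * hT i : AffineHecke N Q) = hT i * hy (hi i) - (Q - 1) • hy (hi i) := by
  have h := hecke_rel (HeckeRel.loT (Q := Q) i)
  simp only [map_mul, map_sub, map_smul] at h
  exact h

theorem hy_hi_mul_hT {N : ℕ} {Q : K} (i : Fin (N - 1)) :
    (hy (hi i) * hT i : AffineHecke N Q) = hT i * hy (lo i) + (Q - 1) • hy (hi i) := by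
  have h := hecke_rel (HeckeRel.hiT (Q := Q) i)
  simp only [map_mul, map_add, map_smul] at h
  exact h

/-- The unit `y_j` of the affine Hecke algebra. -/
def hyUnit {N : ℕ} {Q : K} (j : Fin N) : (AffineHecke N Q)ˣ :=
  ⟨hy j, hyInv j, hy_mul_hyInv j, hyInv_mul_hy j⟩

theorem commute_hyInv {N : ℕ} {Q : K} {a : AffineHecke N Q} {j : Fin N} (h : Commute a (hy j)) :
    Commute a (hyInv j) :=
  Commute.units_inv_right (u := hyUnit j) h

theorem hyInv_comm {N : ℕ} {Q : K} (i j : Fin N) :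
    Commute (hyInv i : AffineHecke N Q) (hyInv j) :=
  commute_hyInv (commute_hyInv (hy_comm j i)).symm

/-- Commuting with the unit `y_j` implies commuting with `y_j⁻¹`, so two of the three kinds of
generators suffice. -/
theorem mem_center_of_commute {N : ℕ} {Q : K} {a : AffineHecke N Q}
    (hT' : ∀ i, Commute (hT i) a) (hy' : ∀ j, Commute (hy j) a) :
    a ∈ Subalgebra.center K (AffineHecke N Q) := by
  rw [Subalgebra.mem_center_iff]
  intro b
  obtain ⟨b, rfl⟩ := RingQuot.mkAlgHom_surjective K (HeckeRel N Q) b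
  induction b using FreeAlgebra.induction with
  | grade0 r => rw [AlgHom.commutes]; exact Algebra.commutes r a
  | grade1 g =>
    cases g with
    | T i => exact hT' i
    | y j => exact hy' j
    | yInv j => exact (commute_hyInv (hy' j).symm).symm
  | mul b c hb hc =>
    rw [map_mul]
    exact Commute.mul_left hb hc
  | add b c hb hc =>
    rw [map_add]
    exact Commute.add_left hb hc

theorem hT_commute_hy_mul {N : ℕ} {Q : K} (i : Fin (N - 1)) :
    Commute (hT i : AffineHecke N Q) (hy (lo i) * hy (hi i)) := by
  have h1 := hy_lo_mul_hT (Q := Q) i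
  have h2 := hy_hi_mul_hT (Q := Q) i
  symm
  calc hy (lo i) * hy (hi i) * hT i
      = hy (lo i) * (hy (hi i) * hT i) := mul_assoc _ _ _
    _ = hy (lo i) * hT i * hy (lo i) + (Q - 1) • (hy (lo i) * hy (hi i)) := by
        rw [h2, mul_add, mul_smul_comm, mul_assoc]
    _ = hT i * (hy (lo i) * hy (hi i)) := by
        rw [h1, sub_mul, smul_mul_assoc, (hy_comm (lo i) (hi i)).eq, mul_assoc, sub_add_cancel]

theorem hComplete_hy_mem_center {N : ℕ} {Q : K} (k : ℕ) :
    hComplete hy k ∈ Subalgebra.center K (AffineHecke N Q) := by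
  refine mem_center_of_commute (fun i => ?_) fun j => commute_hComplete (hy_comm j) k
  refine commute_hComplete_of_symm hy_comm i (fun j h1 h2 => (hy_mul_hT h1 h2).symm) ?_
    (hT_commute_hy_mul i) k
  symm
  change (_ + _) * _ = _ * (_ + _)
  rw [add_mul, hy_lo_mul_hT, hy_hi_mul_hT, mul_add]
  abel

theorem hComplete_hyInv_mem_center {N : ℕ} {Q : K} (k : ℕ) :
    hComplete hyInv k ∈ Subalgebra.center K (AffineHecke N Q) := by
  refine mem_center_of_commute (fun i => ?_) fun j =>
    commute_hComplete (fun i => commute_hyInv (hy_comm j i)) k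
  have hmul : Commute (hT i : AffineHecke N Q) (hyInv (lo i) * hyInv (hi i)) := by
    have h : Commute (hT i : AffineHecke N Q)
        ↑(hyUnit (lo i) * hyUnit (hi i) : (AffineHecke N Q)ˣ) := hT_commute_hy_mul i
    have h2 := h.units_inv_right
    rw [mul_inv_rev, Units.val_mul] at h2
    rw [(hyInv_comm (lo i) (hi i)).eq]
    exact h2
  refine commute_hComplete_of_symm hyInv_comm i
    (fun j h1 h2 => commute_hyInv (hy_mul_hT h1 h2).symm) ?_ hmul k
  -- The sum of two inverses is the sum divided by the product, so the claim reduces to the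
  -- symmetric functions of `y_i` and `y_{i+1}`.
  have e : (hyInv (lo i) + hyInv (hi i) : AffineHecke N Q) =
      (hy (lo i) + hy (hi i)) * (hyInv (lo i) * hyInv (hi i)) := by
    rw [add_mul, ← mul_assoc, hy_mul_hyInv, one_mul, (hyInv_comm (lo i) (hi i)).eq, ← mul_assoc,
      hy_mul_hyInv, one_mul, add_comm]
  rw [e]
  refine Commute.mul_right ?_ hmul
  symm
  change (_ + _) * _ = _ * (_ + _)
  rw [add_mul, hy_lo_mul_hT, hy_hi_mul_hT, mul_add]
  abel

/-! ### Straightening -/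

/-- The index sequence `a` with `a_i`, `a_{i+1}` replaced by `a_i + n t`, `a_{i+1} - n t`. -/
def shift (n : ℕ) {N : ℕ} (i : Fin (N - 1)) (a : Fin N → ℤ) (t : ℤ) : Fin N → ℤ :=
  a + Pi.single (lo i) (n * t) - Pi.single (hi i) (n * t)

theorem shift_lo (n : ℕ) {N : ℕ} (i : Fin (N - 1)) (a : Fin N → ℤ) (t : ℤ) :
    shift n i a t (lo i) = a (lo i) + n * t := by simp [shift, lo_ne_hi]

theorem shift_hi (n : ℕ) {N : ℕ} (i : Fin (N - 1)) (a : Fin N → ℤ) (t : ℤ) :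
    shift n i a t (hi i) = a (hi i) - n * t := by simp [shift, (lo_ne_hi i).symm]

theorem shift_of_ne (n : ℕ) {N : ℕ} {i : Fin (N - 1)} (a : Fin N → ℤ) (t : ℤ) {j : Fin N}
    (h1 : j ≠ lo i) (h2 : j ≠ hi i) : shift n i a t j = a j := by simp [shift, h1, h2]

theorem shift_zero (n : ℕ) {N : ℕ} (i : Fin (N - 1)) (a : Fin N → ℤ) : shift n i a 0 = a := by
  simp [shift]

/-- The span of the tensors obtained from `u_a` by moving `a_i` and `a_{i+1}` towards each other
by a multiple of `n`, such that they stay strictly between their former values. -/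
def inner (n : ℕ) {N : ℕ} (i : Fin (N - 1)) (a : Fin N → ℤ) : Submodule K (Tens N) :=
  Submodule.span K ((fun t : ℤ => Finsupp.single (shift n i a t) (1 : K)) ''
    {t | (0 < n * t ∧ n * t < a (hi i) - a (lo i)) ∨ (a (hi i) - a (lo i) < n * t ∧ n * t < 0)})

theorem single_shift_mem_inner {n N : ℕ} {i : Fin (N - 1)} {a : Fin N → ℤ} {t : ℤ}
    (h : (0 < n * t ∧ n * t < a (hi i) - a (lo i)) ∨
      (a (hi i) - a (lo i) < n * t ∧ n * t < 0)) :
    (Finsupp.single (shift n i a t) 1 : Tens N) ∈ inner n i a :=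
  Submodule.subset_span ⟨t, h, rfl⟩

/-- A divided difference spreads a monomial along the line on which the two exponents have constant
sum. In terms of indices the first sum starts at `u_a` itself, while the second one starts one step
away from it; this asymmetry governs the leading terms of `T_i`. -/
theorem vMul_zvar_mul_ddiff (n : ℕ) {N : ℕ} (i : Fin (N - 1)) (m r : Fin N → ℤ) :
    vMul n m (zvar (lo i) * ddiff i (zmon r)) =
      (∑ j ∈ Finset.range (r (lo i) - r (hi i)).toNat,
        Finsupp.single (shift n i (fun s => m s - n * r s) j) 1) -
      ∑ j ∈ Finset.range (r (hi i) - r (lo i)).toNat,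
        Finsupp.single (shift n i (fun s => m s - n * r s) (-(j + 1 : ℤ))) 1 := by
  rw [ddiff, laurentLin_zmon, mul_sub, Finset.mul_sum, Finset.mul_sum, map_sub, map_sum, map_sum]
  simp only [zvar_mul_zmon, vMul_zmon]
  congr 1 <;>
  · refine Finset.sum_congr rfl fun j _ => ?_
    congr 1
    funext s
    simp only [shift, Pi.add_apply, Pi.sub_apply, Pi.single_apply]
    split_ifs <;> ring

theorem vMul_ddiff_zvar_mul (n : ℕ) {N : ℕ} (i : Fin (N - 1)) (m r : Fin N → ℤ) :
    vMul n m (ddiff i (zvar (lo i) * zmon r)) =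
      (∑ j ∈ Finset.range (r (lo i) + 1 - r (hi i)).toNat,
        Finsupp.single (shift n i (fun s => m s - n * r s) j) 1) -
      ∑ j ∈ Finset.range (r (hi i) - (r (lo i) + 1)).toNat,
        Finsupp.single (shift n i (fun s => m s - n * r s) (-(j + 1 : ℤ))) 1 := by
  rw [zvar_mul_zmon, ddiff, laurentLin_zmon, map_sub, map_sum, map_sum]
  simp only [vMul_zmon, Pi.add_apply, Pi.single_eq_same, Pi.single_eq_of_ne (lo_ne_hi i).symm,
    add_zero]
  congr 1 <;>
  · refine Finset.sum_congr rfl fun j _ => ?_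
    congr 1
    funext s
    simp only [shift, Pi.add_apply, Pi.sub_apply, Pi.single_apply]
    split_ifs <;> ring

theorem vMul_comp_adj_sigmaZ (n : ℕ) {N : ℕ} (i : Fin (N - 1)) (m r : Fin N → ℤ) :
    vMul n (m ∘ adj i) (sigmaZ i (zmon r)) =
      Finsupp.single ((fun s => m s - n * r s) ∘ adj i) 1 := by
  rw [sigmaZ_zmon, vMul_zmon]; rfl

/-- The leading coefficient of the straightening of `u_x ∧ u_y` with `x < y`. -/
def swapCoeff (n : ℕ) (x y : ℤ) : K := if color n x = color n y then -1 else -q⁻¹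

theorem exists_coloring {n : ℕ} (hn : 1 ≤ n) {N : ℕ} (a : Fin N → ℤ) :
    ∃ m r : Fin N → ℤ, IsColoring n m ∧ a = fun s => m s - n * r s :=
  ⟨fun s => color n (a s), fun s => zdeg n (a s), fun s => color_mem n hn (a s),
    funext fun s => (color_sub_zdeg n (a s)).symm⟩

theorem vMul_sigmaZ_of_eq (n : ℕ) {N : ℕ} (i : Fin (N - 1)) {m : Fin N → ℤ} (r : Fin N → ℤ)
    (h : m (lo i) = m (hi i)) :
    vMul n m (sigmaZ i (zmon r)) = Finsupp.single ((fun s => m s - n * r s) ∘ adj i) 1 := by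
  rw [← vMul_comp_adj_sigmaZ]
  congr 1
  congr 1
  funext s
  by_cases h1 : s = lo i
  · subst h1; simp [adj_lo, h]
  by_cases h2 : s = hi i
  · subst h2; simp [adj_hi, h]
  simp [adj_of_ne h1 h2]

/-- For `a_i < a_{i+1}` only the first sum of the divided difference survives. Its initial term is
`u_a`, and all later ones lie strictly between the old indices. -/
theorem heckeT_single_of_lt {n : ℕ} (hn : 1 ≤ n) {N : ℕ} (i : Fin (N - 1)) {a : Fin N → ℤ}
    (h : a (lo i) < a (hi i)) : ∃ w ∈ inner n i a, heckeT n i (Finsupp.single a 1) =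
      swapCoeff n (a (lo i)) (a (hi i)) • Finsupp.single (a ∘ adj i) 1 +
        (q⁻¹ ^ 2 - 1) • Finsupp.single a 1 + w := by
  obtain ⟨m, r, hm, rfl⟩ := exists_coloring hn a
  beta_reduce at h
  have hn' : (0 : ℤ) < n := by exact_mod_cast hn
  have hlo := hm (lo i)
  have hhi := hm (hi i)
  have key : ∀ c : ℕ, (n : ℤ) * c < (m (hi i) - n * r (hi i)) - (m (lo i) - n * r (lo i)) →
      ∃ w ∈ inner n i (fun s => m s - n * r s),
      (∑ j ∈ Finset.range (c + 1), (Finsupp.single (shift n i (fun s => m s - n * r s) j) 1 :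
        Tens N)) = Finsupp.single (fun s => m s - n * r s) 1 + w := by
    intro c hc
    refine ⟨_, ?_, (Finset.sum_range_succ' _ _).trans (by
      rw [Nat.cast_zero, shift_zero, add_comm])⟩
    refine Submodule.sum_mem _ fun j hj => single_shift_mem_inner (Or.inl ⟨by positivity, ?_⟩)
    refine lt_of_le_of_lt (mul_le_mul_of_nonneg_left ?_ hn'.le) hc
    exact_mod_cast Finset.mem_range.mp hj
  rw [← vMul_zmon, heckeT_vMul i hm]
  simp only [swapCoeff, color_sub_mul (hm _)]
  split_ifs with h1 h2 h2
  · omega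
  · have h3 : r (hi i) ≤ r (lo i) := by
      by_contra h3
      have : (n : ℤ) * (r (lo i) + 1) ≤ n * r (hi i) := mul_le_mul_of_nonneg_left (by omega) hn'.le
      rw [mul_add, mul_one] at this; linarith
    obtain ⟨w, hw, e⟩ := key (r (lo i) - r (hi i)).toNat (by
      rw [Int.toNat_of_nonneg (by omega), mul_sub]; linarith)
    refine ⟨(q⁻¹ ^ 2 - 1 : K) • w, Submodule.smul_mem _ _ hw, ?_⟩
    rw [vMul_ddiff_zvar_mul, vMul_comp_adj_sigmaZ, vMul_zmon,
      show (r (lo i) + 1 - r (hi i)).toNat = (r (lo i) - r (hi i)).toNat + 1 by omega,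
      show (r (hi i) - (r (lo i) + 1)).toNat = 0 by omega, e]
    simp only [Finset.range_zero, Finset.sum_empty, sub_zero, smul_add]
    abel
  · have h3 : r (hi i) < r (lo i) := by
      by_contra h3
      have : (n : ℤ) * (r (lo i)) ≤ n * r (hi i) := mul_le_mul_of_nonneg_left (by omega) hn'.le
      linarith
    obtain ⟨w, hw, e⟩ := key (r (lo i) - r (hi i) - 1).toNat (by
      rw [Int.toNat_of_nonneg (by omega), mul_sub, mul_sub]; linarith)
    refine ⟨(q⁻¹ ^ 2 - 1 : K) • w, Submodule.smul_mem _ _ hw, ?_⟩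
    rw [vMul_zvar_mul_ddiff, vMul_sigmaZ_of_eq n i r h2, vMul_zmon,
      show (r (lo i) - r (hi i)).toNat = (r (lo i) - r (hi i) - 1).toNat + 1 by omega,
      show (r (hi i) - r (lo i)).toNat = 0 by omega, e]
    simp only [Finset.range_zero, Finset.sum_empty, sub_zero, smul_add, neg_smul, one_smul]
    abel
  · have h3 : r (hi i) < r (lo i) := by
      by_contra h3
      have : (n : ℤ) * (r (lo i)) ≤ n * r (hi i) := mul_le_mul_of_nonneg_left (by omega) hn'.le
      omega
    obtain ⟨w, hw, e⟩ := key (r (lo i) - r (hi i) - 1).toNat (by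
      rw [Int.toNat_of_nonneg (by omega), mul_sub, mul_sub]; linarith)
    refine ⟨(q⁻¹ ^ 2 - 1 : K) • w, Submodule.smul_mem _ _ hw, ?_⟩
    rw [vMul_zvar_mul_ddiff, vMul_comp_adj_sigmaZ, vMul_zmon,
      show (r (lo i) - r (hi i)).toNat = (r (lo i) - r (hi i) - 1).toNat + 1 by omega,
      show (r (hi i) - r (lo i)).toNat = 0 by omega, e]
    simp only [Finset.range_zero, Finset.sum_empty, sub_zero, smul_add]
    abel

/-- For `a_i > a_{i+1}` only the second sum survives, so there is no term in `u_a`. This absence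
makes the antisymmetrizer unitriangular on decreasing tensors. -/
theorem heckeT_single_of_gt {n : ℕ} (hn : 1 ≤ n) {N : ℕ} (i : Fin (N - 1)) {a : Fin N → ℤ}
    (h : a (hi i) < a (lo i)) : ∃ κ : K, ∃ w ∈ inner n i a, heckeT n i (Finsupp.single a 1) =
      κ • Finsupp.single (a ∘ adj i) 1 + w := by
  obtain ⟨m, r, hm, rfl⟩ := exists_coloring hn a
  beta_reduce at h
  have hn' : (0 : ℤ) < n := by exact_mod_cast hn
  have hlo := hm (lo i)
  have hhi := hm (hi i)
  have key : ∀ c : ℕ, (n : ℤ) * c < (m (lo i) - n * r (lo i)) - (m (hi i) - n * r (hi i)) →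
      (∑ j ∈ Finset.range c, (Finsupp.single (shift n i (fun s => m s - n * r s)
        (-(j + 1 : ℤ))) 1 : Tens N)) ∈ inner n i (fun s => m s - n * r s) := by
    intro c hc
    refine Submodule.sum_mem _ fun j hj => single_shift_mem_inner (Or.inr ⟨?_, ?_⟩)
    · have : (n : ℤ) * (j + 1) ≤ n * c := by
        refine mul_le_mul_of_nonneg_left ?_ hn'.le
        exact_mod_cast Finset.mem_range.mp hj
      linarith
    · have : (0 : ℤ) < n * (j + 1) := by positivity
      linarith
  rw [← vMul_zmon, heckeT_vMul i hm]
  split_ifs with h1 h2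
  · have h3 : r (lo i) + 1 ≤ r (hi i) := by
      by_contra h3
      have : (n : ℤ) * (r (hi i)) ≤ n * r (lo i) := mul_le_mul_of_nonneg_left (by omega) hn'.le
      omega
    refine ⟨-q⁻¹, (q⁻¹ ^ 2 - 1 : K) • -_, Submodule.smul_mem _ _ (Submodule.neg_mem _
      (key (r (hi i) - (r (lo i) + 1)).toNat ?_)), ?_⟩
    · rw [Int.toNat_of_nonneg (by omega), mul_sub, mul_add]; linarith
    · rw [vMul_ddiff_zvar_mul, vMul_comp_adj_sigmaZ,
        show (r (lo i) + 1 - r (hi i)).toNat = 0 by omega]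
      simp only [Finset.range_zero, Finset.sum_empty, zero_sub]
  · have h3 : r (lo i) < r (hi i) := by
      by_contra h3
      have : (n : ℤ) * (r (hi i)) ≤ n * r (lo i) := mul_le_mul_of_nonneg_left (by omega) hn'.le
      omega
    have e : shift n i (fun s => m s - n * r s)
        (-(((r (hi i) - r (lo i) - 1).toNat : ℤ) + 1)) = (fun s => m s - n * r s) ∘ adj i := by
      rw [Int.toNat_of_nonneg (by omega)]
      funext s
      by_cases h1 : s = lo i
      · subst h1; rw [shift_lo, Function.comp_apply, adj_lo, h2]; ring
      by_cases h2' : s = hi i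
      · subst h2'; rw [shift_hi, Function.comp_apply, adj_hi, h2]; ring
      rw [shift_of_ne n _ _ h1 h2', Function.comp_apply, adj_of_ne h1 h2']
    -- For equal colours the far end of the sum is the swapped tensor itself; its coefficient joins
    -- the `-1` of the leading term.
    refine ⟨-1 - (q⁻¹ ^ 2 - 1), (q⁻¹ ^ 2 - 1 : K) • -_, Submodule.smul_mem _ _ (Submodule.neg_mem _
      (key (r (hi i) - r (lo i) - 1).toNat ?_)), ?_⟩
    · rw [Int.toNat_of_nonneg (by omega), mul_sub, mul_sub]; linarith
    · rw [vMul_zvar_mul_ddiff, vMul_sigmaZ_of_eq n i r h2,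
        show (r (lo i) - r (hi i)).toNat = 0 by omega,
        show (r (hi i) - r (lo i)).toNat = (r (hi i) - r (lo i) - 1).toNat + 1 by omega,
        Finset.sum_range_succ, e]
      simp only [Finset.range_zero, Finset.sum_empty, zero_sub]
      module
  · have h3 : r (lo i) ≤ r (hi i) := by
      by_contra h3
      have : (n : ℤ) * (r (hi i) + 1) ≤ n * r (lo i) := mul_le_mul_of_nonneg_left (by omega) hn'.le
      rw [mul_add, mul_one] at this; linarith
    refine ⟨-q⁻¹, (q⁻¹ ^ 2 - 1 : K) • -_, Submodule.smul_mem _ _ (Submodule.neg_mem _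
      (key (r (hi i) - r (lo i)).toNat ?_)), ?_⟩
    · rw [Int.toNat_of_nonneg (by omega), mul_sub]; omega
    · rw [vMul_zvar_mul_ddiff, vMul_comp_adj_sigmaZ,
        show (r (lo i) - r (hi i)).toNat = 0 by omega]
      simp only [Finset.range_zero, Finset.sum_empty, zero_sub]

theorem heckeT_single_of_eq {n : ℕ} (hn : 1 ≤ n) {N : ℕ} (i : Fin (N - 1)) {a : Fin N → ℤ}
    (h : a (lo i) = a (hi i)) : heckeT n i (Finsupp.single a 1) = -Finsupp.single a 1 := by
  obtain ⟨m, r, hm, rfl⟩ := exists_coloring hn a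
  beta_reduce at h
  have h1 := color_sub_mul (hm (lo i)) (r (lo i))
  have h2 := zdeg_sub_mul (hm (lo i)) (r (lo i))
  rw [h, color_sub_mul (hm _)] at h1
  rw [h, zdeg_sub_mul (hm _)] at h2
  rw [← vMul_zmon, heckeT_vMul i hm, if_neg h1.symm.not_lt, if_pos h1.symm,
    vMul_sigmaZ_of_eq n i r h1.symm, vMul_zvar_mul_ddiff, h2, vMul_zmon]
  have e : (fun s => m s - n * r s) ∘ adj i = fun s => m s - n * r s := by
    funext s
    by_cases h1 : s = lo i
    · subst h1; rw [Function.comp_apply, adj_lo, h]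
    by_cases h2' : s = hi i
    · subst h2'; rw [Function.comp_apply, adj_hi, h]
    rw [Function.comp_apply, adj_of_ne h1 h2']
  rw [e]
  simp

/-- The span of the images of the operators `T_i - q⁻²`. -/
def straightRel (n N : ℕ) : Submodule K (Tens N) :=
  ⨆ i : Fin (N - 1), LinearMap.range (heckeT n i - q⁻¹ ^ 2 • (1 : Module.End K (Tens N)))

theorem heckeT_sub_smul_mem {n N : ℕ} (i : Fin (N - 1)) (w : Tens N) :
    heckeT n i w - q⁻¹ ^ 2 • w ∈ straightRel n N :=
  Submodule.mem_iSup_of_mem i ⟨w, rfl⟩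

theorem one_add_inv_sq_ne_zero : (1 : K) + q⁻¹ ^ 2 ≠ 0 := by
  intro h
  have h2 : q ^ 2 + 1 = 0 := by
    have := q_ne_zero
    field_simp at h
    simpa using h
  have h3 : (Polynomial.X ^ 2 + 1 : Polynomial ℚ) = 0 := by
    apply RatFunc.algebraMap_injective ℚ
    simpa [q, RatFunc.algebraMap_X] using h2
  have h4 := congrArg (Polynomial.eval 0) h3
  simp at h4

/-- On such a tensor `T_i - q⁻²` is the scalar `-(1 + q⁻²)`, which is invertible in the ground
field. -/
theorem single_mem_straightRel_of_eq {n : ℕ} (hn : 1 ≤ n) {N : ℕ} (i : Fin (N - 1))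
    {a : Fin N → ℤ} (h : a (lo i) = a (hi i)) :
    (Finsupp.single a 1 : Tens N) ∈ straightRel n N := by
  have h1 := heckeT_sub_smul_mem (n := n) i (Finsupp.single a 1)
  rw [heckeT_single_of_eq hn i h, ← neg_add', neg_mem_iff] at h1
  rw [← Submodule.smul_mem_iff _ one_add_inv_sq_ne_zero, add_smul, one_smul]
  exact h1

/-- The straightening rule. -/
theorem exists_straightening {n : ℕ} (hn : 1 ≤ n) {N : ℕ} (i : Fin (N - 1)) {a : Fin N → ℤ}
    (h : a (lo i) < a (hi i)) : ∃ w ∈ inner n i a, Finsupp.single a 1 -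
      (swapCoeff n (a (lo i)) (a (hi i)) • Finsupp.single (a ∘ adj i) 1 + w) ∈ straightRel n N := by
  obtain ⟨w, hw, e⟩ := heckeT_single_of_lt hn i h
  refine ⟨w, hw, ?_⟩
  have h1 := heckeT_sub_smul_mem (n := n) i (Finsupp.single a 1)
  rw [e, ← neg_mem_iff] at h1
  convert h1 using 1
  module

/-- Correction terms move the indices by nonzero multiples of `n`, and a gap smaller than `n` leaves
no room for one. -/
theorem inner_eq_bot {n N : ℕ} {i : Fin (N - 1)} {a : Fin N → ℤ}
    (h : a (lo i) < a (hi i)) (h' : a (hi i) < a (lo i) + n) : inner n i a = ⊥ := by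
  rw [inner, Submodule.span_eq_bot]
  rintro _ ⟨t, ⟨h1, h2⟩ | ⟨h1, h2⟩, rfl⟩
  · exfalso
    rcases le_or_gt t 0 with ht | ht
    · have : (n : ℤ) * t ≤ 0 := mul_nonpos_of_nonneg_of_nonpos (by positivity) ht
      omega
    · have : (n : ℤ) * 1 ≤ n * t := mul_le_mul_of_nonneg_left (by omega) (by positivity)
      omega
  · omega

theorem color_ne {n : ℕ} (hn : 1 ≤ n) {x y : ℤ} (h : x < y) (h' : y < x + n) :
    color n x ≠ color n y := by
  intro e
  have hn' : (0 : ℤ) < n := by exact_mod_cast hn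
  have h1 := color_sub_zdeg n x
  have h2 := color_sub_zdeg n y
  have h3 : (n : ℤ) * (zdeg n x - zdeg n y) = y - x := by rw [mul_sub]; linarith
  rcases le_or_gt (zdeg n x - zdeg n y) 0 with ht | ht
  · have : (n : ℤ) * (zdeg n x - zdeg n y) ≤ 0 :=
      mul_nonpos_of_nonneg_of_nonpos (by positivity) ht
    omega
  · have : (n : ℤ) * 1 ≤ n * (zdeg n x - zdeg n y) :=
      mul_le_mul_of_nonneg_left (by omega) (by positivity)
    omega

/-- The straightening rule for neighbours at distance less than `n` has no correction terms. -/
theorem single_add_smul_mem_straightRel {n : ℕ} (hn : 1 ≤ n) {N : ℕ} (i : Fin (N - 1))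
    {a : Fin N → ℤ} (h : a (lo i) < a (hi i)) (h' : a (hi i) < a (lo i) + n) :
    Finsupp.single a 1 + q⁻¹ • Finsupp.single (a ∘ adj i) 1 ∈ straightRel n N := by
  obtain ⟨w, hw, e⟩ := exists_straightening hn i h
  rw [inner_eq_bot h h', Submodule.mem_bot] at hw
  rw [hw, add_zero, swapCoeff, if_neg (color_ne hn h h'), neg_smul, sub_neg_eq_add] at e
  exact e

/-- Wedges of the form `⋯ ∧ u_l ∧ u_m ∧ u_{m-1} ∧ ⋯ ∧ u_l ∧ ⋯` vanish. -/
theorem single_mem_straightRel_of_interval {n : ℕ} (hn : 1 ≤ n) {N : ℕ} (d : ℕ) :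
    ∀ (a : Fin N → ℤ) (p : ℕ) (hp : p + 1 + d < N) (l : ℤ), a ⟨p, by omega⟩ = l →
      (∀ j, (hj : j ≤ d) → a ⟨p + 1 + j, by omega⟩ = l + d - j) →
      (Finsupp.single a 1 : Tens N) ∈ straightRel n N := by
  induction d using Nat.strong_induction_on with
  | _ d IH =>
  intro a p hp l hl ha
  let i : Fin (N - 1) := ⟨p, by omega⟩
  have hlo : lo i = ⟨p, by omega⟩ := rfl
  have hhi : hi i = ⟨p + 1, by omega⟩ := rfl
  have h0 : a (hi i) = l + d := by simpa [hhi] using ha 0 (by omega)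
  rcases Nat.eq_zero_or_pos d with rfl | hd
  · exact single_mem_straightRel_of_eq hn i (by rw [h0, hlo, hl]; simp)
  obtain ⟨w, hw, e⟩ := exists_straightening hn i (a := a) (by rw [h0, hlo, hl]; omega)
  suffices h : swapCoeff n (a (lo i)) (a (hi i)) • Finsupp.single (a ∘ adj i) 1 + w ∈
      straightRel n N by
    have := Submodule.add_mem _ e h
    rwa [sub_add_cancel] at this
  have hne : ∀ j, 1 ≤ j → (hj : j ≤ d) → (⟨p + 1 + j, by omega⟩ : Fin N) ≠ lo i ∧
      (⟨p + 1 + j, by omega⟩ : Fin N) ≠ hi i := fun j h1 h2 => by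
    rw [hlo, hhi]; simp only [ne_eq, Fin.mk.injEq]; omega
  refine Submodule.add_mem _ (Submodule.smul_mem _ _ ?_) ?_
  -- After the swap `u_l` stands one place further right, in front of the interval `l + d - 1, …,
  -- l`.
  · refine IH (d - 1) (by omega) _ (p + 1) (by omega) l ?_ fun j hj => ?_
    · rw [← hhi, Function.comp_apply, adj_hi, hlo, hl]
    · have h1 := hne (j + 1) (by omega) (by omega)
      have h2 := ha (j + 1) (by omega)
      simp only [Function.comp_apply, show p + 1 + 1 + j = p + 1 + (j + 1) by ring]
      rw [adj_of_ne h1.1 h1.2, h2]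
      push_cast [Nat.cast_sub hd]
      ring
  · refine (Submodule.span_le.mpr ?_) hw
    rintro _ ⟨t, ht, rfl⟩
    rw [h0, hlo, hl] at ht
    simp only [Set.mem_ofPred_eq] at ht
    have ht' : 0 < (n : ℤ) * t ∧ (n : ℤ) * t < d := by omega
    obtain ⟨c, hc⟩ := Int.eq_ofNat_of_zero_le ht'.1.le
    rw [hc] at ht'
    have hc1 : 1 ≤ c := by omega
    -- In a correction term, with `c = n t`, the second index is `l + d - c`; the following indices
    -- `l + d - 1, …` descend to this same value, an interval of length `c`.
    refine IH (c - 1) (by omega) _ (p + 1) (by omega) (l + d - c) ?_ fun j hj => ?_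
    · rw [← hhi, shift_hi, h0, hc]
    · have h1 := hne (j + 1) (by omega) (by omega)
      have h2 := ha (j + 1) (by omega)
      simp only [show p + 1 + 1 + j = p + 1 + (j + 1) by ring]
      rw [shift_of_ne n _ _ h1.1 h1.2, h2]
      push_cast [Nat.cast_sub hc1]
      ring

/-- The submodule spanned by the tensors with strictly decreasing index sequences. -/
def wedgeSpan (N : ℕ) : Submodule K (Tens N) :=
  Submodule.span K ((fun b => Finsupp.single b 1) '' {b | StrictAnti b})

/-- The bookkeeping for the quadratic statistics: changing two neighbouring entries affects only two
summands. -/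
theorem sum_eq_sum_add {N : ℕ} (i : Fin (N - 1)) (f g : Fin N → ℤ)
    (h : ∀ j, j ≠ lo i → j ≠ hi i → f j = g j) :
    ∑ j, f j = ∑ j, g j + (f (lo i) - g (lo i)) + (f (hi i) - g (hi i)) := by
  have h1 : ∑ j, (f j - g j) = ∑ j ∈ {lo i, hi i}, (f j - g j) := by
    symm
    refine Finset.sum_subset (Finset.subset_univ _) fun j _ hj => ?_
    simp only [Finset.mem_insert, Finset.mem_singleton, not_or] at hj
    rw [h j hj.1 hj.2, sub_self]
  rw [Finset.sum_pair (lo_ne_hi i), Finset.sum_sub_distrib] at h1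
  linarith

theorem exists_le_of_not_strictAnti {N : ℕ} {a : Fin N → ℤ} (h : ¬ StrictAnti a) :
    ∃ i : Fin (N - 1), a (lo i) ≤ a (hi i) := by
  cases N with
  | zero => exact absurd (fun i => i.elim0) h
  | succ N =>
    rw [Fin.strictAnti_iff_succ_lt] at h
    push Not at h
    exact h

/-- Straightening terminates because `∑ (a_j + j)²` drops. The plain sum of squares would not do: it
is unchanged by the swap, and the weight `j` makes putting the larger index first a strict gain. -/
theorem single_mem_wedgeSpan_sup {n : ℕ} (hn : 1 ≤ n) {N : ℕ} (d : ℕ) :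
    ∀ a : Fin N → ℤ, (∑ j, (a j + j) ^ 2 : ℤ).toNat = d →
      (Finsupp.single a 1 : Tens N) ∈ wedgeSpan N ⊔ straightRel n N := by
  induction d using Nat.strong_induction_on with
  | _ d IH =>
  intro a hd
  by_cases hs : StrictAnti a
  · exact Submodule.mem_sup_left (Submodule.subset_span ⟨a, hs, rfl⟩)
  obtain ⟨i, hi'⟩ := exists_le_of_not_strictAnti hs
  rcases hi'.eq_or_lt with h | h
  · exact Submodule.mem_sup_right (single_mem_straightRel_of_eq hn i h)
  have hlt : ∀ b : Fin N → ℤ, ∑ j, (b j + j) ^ 2 < ∑ j, (a j + j) ^ 2 →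
      (Finsupp.single b 1 : Tens N) ∈ wedgeSpan N ⊔ straightRel n N := fun b hb => by
    refine IH _ ?_ b rfl
    rw [← hd]
    have : 0 ≤ ∑ j, (b j + j) ^ 2 := Finset.sum_nonneg fun j _ => sq_nonneg _
    omega
  have hp : ((hi i : Fin N) : ℤ) = (lo i : Fin N) + 1 := by simp [lo, hi]
  obtain ⟨w, hw, e⟩ := exists_straightening hn i h
  suffices h : swapCoeff n (a (lo i)) (a (hi i)) • Finsupp.single (a ∘ adj i) 1 + w ∈
      wedgeSpan N ⊔ straightRel n N by
    have := Submodule.add_mem _ ((le_sup_right : straightRel n N ≤ wedgeSpan N ⊔ straightRel n N) e) h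
    rwa [sub_add_cancel] at this
  refine Submodule.add_mem _ (Submodule.smul_mem _ _ (hlt _ ?_)) ((Submodule.span_le.mpr ?_) hw)
  · rw [sum_eq_sum_add i _ (fun j => (a j + j) ^ 2) fun j h1 h2 => by
      simp only [Function.comp_apply, adj_of_ne h1 h2]]
    simp only [Function.comp_apply, adj_lo, adj_hi, hp]
    nlinarith
  · rintro _ ⟨t, ht, rfl⟩
    refine hlt _ ?_
    rw [sum_eq_sum_add i _ (fun j => (a j + j) ^ 2) fun j h1 h2 => by
      simp only [shift_of_ne n a t h1 h2]]
    simp only [shift_lo, shift_hi, hp]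
    have ht' : 0 < (n : ℤ) * t ∧ (n : ℤ) * t < a (hi i) - a (lo i) := by
      rcases ht with ht | ht <;> [exact ht; omega]
    nlinarith [mul_pos ht'.1 (sub_pos.mpr ht'.2)]

theorem wedgeSpan_sup_straightRel {n : ℕ} (hn : 1 ≤ n) (N : ℕ) :
    wedgeSpan N ⊔ straightRel n N = ⊤ := by
  refine eq_top_iff.mpr fun w _ => ?_
  induction w using Finsupp.induction_linear with
  | zero => exact Submodule.zero_mem _
  | add f g hf hg => exact Submodule.add_mem _ (hf trivial) (hg trivial)
  | single a c =>
    rw [← mul_one c, ← smul_eq_mul, ← Finsupp.smul_single]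
    exact Submodule.smul_mem _ _ (single_mem_wedgeSpan_sup hn _ a rfl)

/-! ### The kernel of the antisymmetrizer -/

/-- The left factor `1 + T_i` of `∑ T_σ` is the one that acts first, because the action is on the
right. -/
theorem antisym_eq {n : ℕ} (hn : 1 ≤ n) {N : ℕ} (i : Fin (N - 1)) :
    ∃ X : Module.End K (Tens N), antisym n N = X * (1 + heckeT n i) := by
  rw [antisym, sum_tPerm_eq (fun i => MulOpposite.op (heckeT n i : Module.End K (Tens N)))
    (fun i j h => ?_) (fun i j h => ?_) i]
  · exact ⟨_, rfl⟩
  · apply MulOpposite.unop_injective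
    simpa only [MulOpposite.unop_mul, MulOpposite.unop_op, mul_assoc] using heckeT_braid hn i j h
  · apply MulOpposite.unop_injective
    exact (heckeT_far hn i j h).symm

/-- The quadratic relation says `(1 + T_i)(T_i - q⁻²) = 0`. -/
theorem straightRel_le_ker {n : ℕ} (hn : 1 ≤ n) (N : ℕ) :
    straightRel n N ≤ LinearMap.ker (antisym n N) := by
  refine iSup_le fun i => ?_
  rintro _ ⟨w, rfl⟩
  obtain ⟨X, hX⟩ := antisym_eq hn i
  have h : (1 + heckeT n i : Module.End K (Tens N)) * (heckeT n i - q⁻¹ ^ 2 • 1) = 0 := by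
    rw [add_mul, mul_sub, mul_sub, heckeT_quad hn]
    simp only [one_mul, mul_smul_comm, mul_one]
    module
  rw [LinearMap.mem_ker, hX, ← Module.End.mul_apply, mul_assoc, h, mul_zero]
  rfl

/-! ### Triangularity of the antisymmetrizer for the sum of squares. -/

/-- The span of the tensors `u_c` with `∑ c_j² < d`. -/
def lowSpan (N : ℕ) (d : ℤ) : Submodule K (Tens N) :=
  Submodule.span K ((fun c => Finsupp.single c 1) '' {c | ∑ j, c j ^ 2 < d})

theorem lowSpan_mono {N : ℕ} {d e : ℤ} (h : d ≤ e) : lowSpan N d ≤ lowSpan N e :=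
  Submodule.span_mono (Set.image_mono fun _ hx => Set.mem_ofPred_eq ▸ lt_of_lt_of_le hx h)

theorem sum_sq_comp_perm {N : ℕ} (a : Fin N → ℤ) (σ : Equiv.Perm (Fin N)) :
    ∑ j, (a ∘ σ) j ^ 2 = ∑ j, a j ^ 2 := Equiv.sum_comp σ fun j => a j ^ 2

theorem inner_le_lowSpan {n N : ℕ} (i : Fin (N - 1)) (a : Fin N → ℤ) :
    inner n i a ≤ lowSpan N (∑ j, a j ^ 2) := by
  refine Submodule.span_mono (Set.image_subset_iff.mpr ?_) |>.trans le_rfl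
  rintro t ht
  refine ⟨_, (?_ : ∑ j, _ ^ 2 < ∑ j, a j ^ 2), rfl⟩
  rw [sum_eq_sum_add i _ (fun j => a j ^ 2) fun j h1 h2 => by
      simp only [shift_of_ne n a t h1 h2]]
  simp only [shift_lo, shift_hi]
  rcases ht with ⟨h1, h2⟩ | ⟨h1, h2⟩
  · nlinarith [mul_pos h1 (sub_pos.mpr h2)]
  · nlinarith [mul_pos (neg_pos.mpr h2) (sub_pos.mpr h1)]

/-- Swapping entries preserves the sum of squares, and moving two entries towards each other lowers
it. -/
theorem heckeT_mem_lowSpan {n : ℕ} (hn : 1 ≤ n) {N : ℕ} (i : Fin (N - 1)) {d : ℤ} {w : Tens N}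
    (h : w ∈ lowSpan N d) : heckeT n i w ∈ lowSpan N d := by
  suffices h' : lowSpan N d ≤ (lowSpan N d).comap (heckeT n i) from h' h
  refine Submodule.span_le.mpr ?_
  rintro _ ⟨c, hc, rfl⟩
  have hc' : (Finsupp.single c 1 : Tens N) ∈ lowSpan N d := Submodule.subset_span ⟨c, hc, rfl⟩
  have hc2 : (Finsupp.single (c ∘ adj i) 1 : Tens N) ∈ lowSpan N d :=
    Submodule.subset_span ⟨c ∘ adj i, by
      simpa only [Set.mem_ofPred_eq, sum_sq_comp_perm] using hc, rfl⟩
  have hi' : inner n i c ≤ lowSpan N d := (inner_le_lowSpan i c).trans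
    (lowSpan_mono (le_of_lt hc))
  change heckeT n i (Finsupp.single c 1) ∈ lowSpan N d
  rcases lt_trichotomy (c (lo i)) (c (hi i)) with h | h | h
  · obtain ⟨w, hw, e⟩ := heckeT_single_of_lt hn i h
    rw [e]
    exact Submodule.add_mem _ (Submodule.add_mem _ (Submodule.smul_mem _ _ hc2)
      (Submodule.smul_mem _ _ hc')) (hi' hw)
  · rw [heckeT_single_of_eq hn i h]
    exact Submodule.neg_mem _ hc'
  · obtain ⟨κ, w, hw, e⟩ := heckeT_single_of_gt hn i h
    rw [e]
    exact Submodule.add_mem _ (Submodule.smul_mem _ _ hc2) (hi' hw)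

theorem card_inversions_inv {N : ℕ} (σ : Equiv.Perm (Fin N)) :
    (inversions σ⁻¹).card = (inversions σ).card := by
  refine Finset.card_bij' (fun p _ => (σ⁻¹ p.2, σ⁻¹ p.1)) (fun p _ => (σ p.2, σ p.1)) ?_ ?_ ?_ ?_
  · rintro ⟨a, b⟩ h
    simp only [inversions, Finset.mem_filter, Finset.mem_univ, true_and] at h ⊢
    exact ⟨h.2, by simpa using h.1⟩
  · rintro ⟨a, b⟩ h
    simp only [inversions, Finset.mem_filter, Finset.mem_univ, true_and] at h ⊢
    exact ⟨h.2, by simpa using h.1⟩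
  · rintro ⟨a, b⟩ _; simp
  · rintro ⟨a, b⟩ _; simp

theorem tPerm_mul_adj {N : ℕ} {A : Type*} [Monoid A] (T : Fin (N - 1) → A)
    (braid : ∀ i j : Fin (N - 1), (j : ℕ) = i + 1 → T i * T j * T i = T j * T i * T j)
    (far : ∀ i j : Fin (N - 1), (i : ℕ) + 1 < j → T i * T j = T j * T i)
    (i : Fin (N - 1)) (σ : Equiv.Perm (Fin N)) (h : σ (lo i) < σ (hi i)) :
    tPerm T (σ * adj i) = tPerm T σ * T i := by
  obtain ⟨l, h1, h2⟩ := exists_word_length_eq _ σ rfl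
  rw [tPerm_eq T braid far h1 h2, tPerm_eq T braid far (l := l ++ [i]) (by simp [h1])
    (by
      rw [← card_inversions_inv (σ * adj i), mul_inv_rev, adj_inv,
        card_inversions_adj_mul i σ⁻¹ (by simpa using h), card_inversions_inv, ← h2]
      simp)]
  simp

theorem tPerm_one {N : ℕ} {A : Type*} [Monoid A] (T : Fin (N - 1) → A) : tPerm T 1 = 1 := by
  have h := exists_reducedWord (1 : Equiv.Perm (Fin N))
  have h1 : h.choose.length ≤ 0 := h.choose_spec.2 [] (by simp)
  have h2 : h.choose = [] := List.length_eq_zero_iff.mp (by omega)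
  rw [tPerm, h2]
  simp

/-- The operators `T_i`, acting on the right. -/
abbrev heckeTOp (n N : ℕ) (i : Fin (N - 1)) : (Module.End K (Tens N))ᵐᵒᵖ :=
  MulOpposite.op (heckeT n i)

theorem heckeTOp_braid {n : ℕ} (hn : 1 ≤ n) {N : ℕ} (i j : Fin (N - 1)) (h : (j : ℕ) = i + 1) :
    heckeTOp n N i * heckeTOp n N j * heckeTOp n N i =
      heckeTOp n N j * heckeTOp n N i * heckeTOp n N j := by
  apply MulOpposite.unop_injective
  simpa only [MulOpposite.unop_mul, MulOpposite.unop_op, mul_assoc] using heckeT_braid hn i j h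

theorem heckeTOp_far {n : ℕ} (hn : 1 ≤ n) {N : ℕ} (i j : Fin (N - 1)) (h : (i : ℕ) + 1 < j) :
    heckeTOp n N i * heckeTOp n N j = heckeTOp n N j * heckeTOp n N i := by
  apply MulOpposite.unop_injective
  exact (heckeT_far hn i j h).symm

/-- Build `σ` by appending letters on the right, which act last. Each appended letter lengthens the
permutation, so it meets a decreasing pair of entries of the decreasing sequence `b`, and
`heckeT_single_of_gt` gives a single leading term. -/
theorem tPerm_single_sub_mem {n : ℕ} (hn : 1 ≤ n) {N : ℕ} {b : Fin N → ℤ} (hb : StrictAnti b)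
    (d : ℕ) : ∀ σ : Equiv.Perm (Fin N), (inversions σ).card = d → ∃ κ : K,
      (tPerm (heckeTOp n N) σ).unop
        (Finsupp.single b 1) - κ • Finsupp.single (b ∘ σ) 1 ∈ lowSpan N (∑ j, b j ^ 2) := by
  induction d with
  | zero =>
    intro σ hσ
    obtain ⟨l, h1, h2⟩ := exists_word_length_eq _ σ hσ
    rw [List.length_eq_zero_iff] at h2
    subst h2
    refine ⟨1, ?_⟩
    rw [← h1, List.map_nil, List.prod_nil, tPerm_one]
    simp
  | succ d IH =>
    intro σ hσ
    obtain ⟨i, hi'⟩ : ∃ i : Fin (N - 1), σ (hi i) < σ (lo i) := by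
      by_contra! hcon
      have h1 : σ⁻¹ = 1 := eq_one_of_no_descent σ⁻¹ fun i =>
        lt_of_le_of_ne (by simpa using hcon i) fun h => lo_ne_hi i (by simpa using h)
      rw [inv_eq_one] at h1
      subst h1
      simp only [inversions, Equiv.Perm.coe_one, id_eq] at hσ
      rw [Finset.card_eq_zero.mpr] at hσ
      · omega
      · exact Finset.filter_eq_empty_iff.mpr fun p _ h => lt_asymm h.1 h.2
    obtain ⟨τ, rfl⟩ : ∃ τ, σ = τ * adj i := ⟨σ * (adj i)⁻¹, by simp⟩
    simp only [Equiv.Perm.mul_apply, adj_lo, adj_hi] at hi'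
    have hτ : (inversions τ).card = d := by
      rw [← card_inversions_inv, mul_inv_rev, adj_inv,
        card_inversions_adj_mul i τ⁻¹ (by simpa using hi'), card_inversions_inv] at hσ
      omega
    obtain ⟨κ, h⟩ := IH τ hτ
    obtain ⟨κ', w, hw, e⟩ := heckeT_single_of_gt (n := n) hn i (a := b ∘ τ) (hb hi')
    refine ⟨κ * κ', ?_⟩
    rw [tPerm_mul_adj _ (heckeTOp_braid hn) (heckeTOp_far hn) i τ hi', MulOpposite.unop_mul,
      MulOpposite.unop_op, Module.End.mul_apply]
    have h1 := heckeT_mem_lowSpan hn i h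
    have h2 := inner_le_lowSpan i _ hw
    rw [sum_sq_comp_perm] at h2
    rw [map_sub, map_smul, e] at h1
    have h3 := Submodule.add_mem _ h1 (Submodule.smul_mem _ κ h2)
    convert h3 using 1
    rw [smul_add, ← smul_assoc, smul_eq_mul]
    change _ - (κ * κ') • Finsupp.single ((b ∘ τ) ∘ adj i) 1 = _
    abel

theorem apply_eq_zero_of_mem_lowSpan {N : ℕ} {d : ℤ} {w : Tens N} (h : w ∈ lowSpan N d)
    {b : Fin N → ℤ} (hb : d ≤ ∑ j, b j ^ 2) : w b = 0 := by
  suffices h' : lowSpan N d ≤ LinearMap.ker (Finsupp.lapply b : Tens N →ₗ[K] K) from h' h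
  refine Submodule.span_le.mpr ?_
  rintro _ ⟨c, hc, rfl⟩
  rw [SetLike.mem_coe, LinearMap.mem_ker, Finsupp.lapply_apply, Finsupp.single_apply, if_neg]
  rintro rfl
  exact absurd hb (not_le.mpr hc)

theorem eq_one_of_strictAnti_comp {N : ℕ} {b c : Fin N → ℤ} (hb : StrictAnti b)
    (hc : StrictAnti c) {σ : Equiv.Perm (Fin N)} (h : c ∘ σ = b) : σ = 1 := by
  have hσ : StrictMono σ := fun x y hxy => by
    have := hb hxy
    rw [← h] at this
    exact hc.lt_iff_gt.mp this
  have h2 := Subsingleton.elim (hσ.orderIsoOfSurjective _ σ.surjective) (OrderIso.refl _)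
  ext a
  exact congrArg Fin.val (DFunLike.congr_fun h2 a)

/-- The leading term of `T_σ u_c` has index `c ∘ σ`, decreasing only for `σ = 1`; the remaining
terms have smaller sum of squares and cannot reach `b`. -/
theorem antisym_single_apply {n : ℕ} (hn : 1 ≤ n) {N : ℕ} {b c : Fin N → ℤ} (hb : StrictAnti b)
    (hc : StrictAnti c) (h : ∑ j, c j ^ 2 ≤ ∑ j, b j ^ 2) :
    antisym n N (Finsupp.single c 1) b = if c = b then 1 else 0 := by
  have e : antisym n N (Finsupp.single c 1) b = ∑ σ : Equiv.Perm (Fin N),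
      (tPerm (heckeTOp n N) σ).unop (Finsupp.single c 1) b := by
    rw [antisym, Finset.unop_sum, LinearMap.sum_apply, Finsupp.finsetSum_apply]
  rw [e, Finset.sum_eq_single 1]
  · rw [tPerm_one, MulOpposite.unop_one, Module.End.one_apply, Finsupp.single_apply]
  · intro σ _ hσ
    obtain ⟨κ, hκ⟩ := tPerm_single_sub_mem hn hc _ σ rfl
    have h1 := apply_eq_zero_of_mem_lowSpan hκ h
    rw [Finsupp.sub_apply, Finsupp.smul_apply, Finsupp.single_apply, if_neg, smul_zero,
      sub_zero] at h1
    · exact h1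
    · exact fun h' => hσ (eq_one_of_strictAnti_comp hb hc h')
  · exact fun h' => absurd (Finset.mem_univ _) h'

/-- At an index of the support with maximal sum of squares the antisymmetrizer reproduces the
coefficient of `w`. -/
theorem eq_zero_of_mem_wedgeSpan {n : ℕ} (hn : 1 ≤ n) {N : ℕ} {w : Tens N}
    (hw : w ∈ wedgeSpan N) (h : antisym n N w = 0) : w = 0 := by
  rw [wedgeSpan, ← Finsupp.supported_eq_span_single, Finsupp.mem_supported] at hw
  by_contra hne
  obtain ⟨b, hb, hmax⟩ := Finset.exists_max_image w.support (fun b => ∑ j, b j ^ 2)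
    (Finsupp.support_nonempty_iff.mpr hne)
  have h1 : antisym n N w b = 0 := by rw [h]; rfl
  have h2 : antisym n N w = ∑ c ∈ w.support, w c • antisym n N (Finsupp.single c 1) := by
    conv_lhs => rw [← Finsupp.sum_single w]
    rw [Finsupp.sum, map_sum]
    refine Finset.sum_congr rfl fun c _ => ?_
    rw [← map_smul, Finsupp.smul_single, smul_eq_mul, mul_one]
  rw [h2, Finsupp.finsetSum_apply, Finset.sum_eq_single b] at h1
  · rw [Finsupp.smul_apply, antisym_single_apply hn (hw hb) (hw hb) le_rfl, if_pos rfl,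
      smul_eq_mul, mul_one] at h1
    exact (Finsupp.mem_support_iff.mp hb) h1
  · intro c hc hcb
    rw [Finsupp.smul_apply, antisym_single_apply hn (hw hb) (hw hc) (hmax c hc), if_neg hcb,
      smul_zero]
  · exact fun h' => absurd hb h'

/-- Straighten an element of the kernel to decreasing tensors; the decreasing part lies in the
kernel too, hence is zero. -/
theorem ker_antisym {n : ℕ} (hn : 1 ≤ n) (N : ℕ) :
    LinearMap.ker (antisym n N) = straightRel n N := by
  refine le_antisymm (fun w hw => ?_) (straightRel_le_ker hn N)
  have h : w ∈ wedgeSpan N ⊔ straightRel n N := by rw [wedgeSpan_sup_straightRel hn]; trivial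
  obtain ⟨u, hu, v, hv, rfl⟩ := Submodule.mem_sup.mp h
  have h1 := straightRel_le_ker hn N hv
  rw [LinearMap.mem_ker] at h1 hw
  rw [map_add, h1, add_zero] at hw
  rw [eq_zero_of_mem_wedgeSpan hn hu hw, zero_add]
  exact hv

scoped instance : AddCommGroup InfTens := Finsupp.instAddCommGroup
scoped instance : AddCommGroup Fock := Finsupp.instAddCommGroup

/-! ### Compatibility of the Hecke action with the stabilization maps -/

/-- Appending the tail of `t` to a sequence. -/
def appendTail {N : ℕ} (M : ℕ) (t : ℕ → ℤ) (r : Fin N → ℤ) : Fin M → ℤ :=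
  fun j => if h : (j : ℕ) < N then r ⟨j, h⟩ else t j

theorem appendTail_add_single {N M : ℕ} (t : ℕ → ℤ) (r : Fin N → ℤ) {j : Fin N} {j' : Fin M}
    (h : (j' : ℕ) = j) (x : ℤ) :
    appendTail M t (r + Pi.single j x) = appendTail M t r + Pi.single j' x := by
  funext s
  simp only [appendTail, Pi.add_apply, Pi.single_apply, Fin.ext_iff, h]
  split_ifs <;> first | rfl | (exfalso; omega) | simp

theorem appendTail_sub_single {N M : ℕ} (t : ℕ → ℤ) (r : Fin N → ℤ) {j : Fin N} {j' : Fin M}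
    (h : (j' : ℕ) = j) (x : ℤ) :
    appendTail M t (r - Pi.single j x) = appendTail M t r - Pi.single j' x := by
  rw [sub_eq_add_neg, ← Pi.single_neg, appendTail_add_single t r h, Pi.single_neg, sub_eq_add_neg]

theorem appendTail_of_lt {N M : ℕ} (t : ℕ → ℤ) (r : Fin N → ℤ) {j : Fin N} {j' : Fin M}
    (h : (j' : ℕ) = j) : appendTail M t r j' = r j := by
  rw [appendTail, dif_pos (by omega)]
  congr 1
  exact Fin.ext h

theorem appendTail_comp_adj {N M : ℕ} (t : ℕ → ℤ) (r : Fin N → ℤ) {i : Fin (N - 1)}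
    {i' : Fin (M - 1)} (h : (i' : ℕ) = i) :
    appendTail M t (r ∘ adj i) = appendTail M t r ∘ adj i' := by
  have h1 : ((lo i' : Fin M) : ℕ) = lo i := h
  have h2 : ((hi i' : Fin M) : ℕ) = hi i := by simp [hi, h]
  rw [comp_adj, comp_adj, appendTail_add_single t _ h2, appendTail_sub_single t _ h1,
    appendTail_of_lt t r h1, appendTail_of_lt t r h2]

/-- Multiplication of a Laurent polynomial by the monomial with exponents given by a tail. -/
def laurentTail {N : ℕ} (M : ℕ) (t : ℕ → ℤ) : Laurent N →ₗ[K] Laurent M :=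
  laurentLin fun r => zmon (appendTail M t r)

theorem laurentTail_zmon {N M : ℕ} (t : ℕ → ℤ) (r : Fin N → ℤ) :
    laurentTail M t (zmon r) = zmon (appendTail M t r) := laurentLin_zmon _ _

theorem laurentTail_sigmaZ {N M : ℕ} (t : ℕ → ℤ) {i : Fin (N - 1)} {i' : Fin (M - 1)}
    (h : (i' : ℕ) = i) (f : Laurent N) :
    laurentTail M t (sigmaZ i f) = sigmaZ i' (laurentTail M t f) := by
  suffices e : (laurentTail M t).comp (sigmaZ i) = (sigmaZ i').comp (laurentTail M t) from
    LinearMap.congr_fun e f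
  refine laurent_hom_ext fun r => ?_
  simp only [LinearMap.comp_apply, sigmaZ_zmon, laurentTail_zmon, appendTail_comp_adj t r h]

theorem laurentTail_zvar_mul {N M : ℕ} (t : ℕ → ℤ) {j : Fin N} {j' : Fin M}
    (h : (j' : ℕ) = j) (f : Laurent N) :
    laurentTail M t (zvar j * f) = zvar j' * laurentTail M t f := by
  suffices e : (laurentTail M t).comp (LinearMap.mulLeft K (zvar j)) =
      (LinearMap.mulLeft K (zvar j')).comp (laurentTail M t) from LinearMap.congr_fun e f
  refine laurent_hom_ext fun r => ?_
  simp only [LinearMap.comp_apply, LinearMap.mulLeft_apply, zvar_mul_zmon, laurentTail_zmon,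
    appendTail_add_single t r h]

theorem laurentTail_ddiff {N M : ℕ} (t : ℕ → ℤ) {i : Fin (N - 1)} {i' : Fin (M - 1)}
    (h : (i' : ℕ) = i) (f : Laurent N) :
    laurentTail M t (ddiff i f) = ddiff i' (laurentTail M t f) := by
  have h1 : ((lo i' : Fin M) : ℕ) = lo i := h
  have h2 : ((hi i' : Fin M) : ℕ) = hi i := by simp [hi, h]
  suffices e : (laurentTail M t).comp (ddiff i) = (ddiff i').comp (laurentTail M t) from
    LinearMap.congr_fun e f
  refine laurent_hom_ext fun r => ?_
  simp only [LinearMap.comp_apply, laurentTail_zmon]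
  rw [ddiff, ddiff, laurentLin_zmon, laurentLin_zmon]
  simp only [map_sub, map_sum, laurentTail_zmon, appendTail_add_single t _ h2,
    appendTail_add_single t _ h1, appendTail_sub_single t _ h1, appendTail_sub_single t _ h2,
    appendTail_of_lt t r h1, appendTail_of_lt t r h2]

theorem stab_single {N M : ℕ} (a : Fin N → ℤ) (c : K) :
    stab N M (Finsupp.single a c) =
      Finsupp.single (appendTail M (fun k => -(k : ℤ)) a) c :=
  Finsupp.mapDomain_single

theorem stab_vMul (n : ℕ) {N M : ℕ} (m : Fin N → ℤ) (f : Laurent N) :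
    stab N M (vMul n m f) = vMul n (appendTail M (fun k => color n (-k)) m)
      (laurentTail M (fun k => zdeg n (-k)) f) := by
  suffices e : (stab N M).comp (vMul n m) =
      (vMul n (appendTail M (fun k => color n (-k)) m)).comp
        (laurentTail M (fun k => zdeg n (-k))) from LinearMap.congr_fun e f
  refine laurent_hom_ext fun r => ?_
  simp only [LinearMap.comp_apply, laurentTail_zmon]
  rw [vMul_zmon, vMul_zmon, stab_single]
  congr 1
  funext j
  simp only [appendTail]
  split_ifs
  · rfl
  · exact (color_sub_zdeg n _).symm

/-- `T_i` sees only the factors `i` and `i + 1`; the appended tail contributes a monomial that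
passes through `σ_i` and `∂_i` as a constant. -/
theorem heckeT_stab {n : ℕ} (hn : 1 ≤ n) {N M : ℕ} {i : Fin (N - 1)} {i' : Fin (M - 1)}
    (h : (i' : ℕ) = i) (w : Tens N) :
    heckeT n i' (stab N M w) = stab N M (heckeT n i w) := by
  have h1 : ((lo i' : Fin M) : ℕ) = lo i := h
  have h2 : ((hi i' : Fin M) : ℕ) = hi i := by simp [hi, h]
  suffices e : (heckeT n i').comp (stab N M) = (stab N M).comp (heckeT n i) from
    LinearMap.congr_fun e w
  refine tens_hom_ext hn fun m r hm => ?_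
  have hm' : IsColoring n (appendTail M (fun k => color n (-k)) m) := fun j => by
    simp only [appendTail]
    split_ifs
    · exact hm _
    · exact color_mem n hn _
  simp only [LinearMap.comp_apply]
  rw [stab_vMul, heckeT_vMul i' hm', heckeT_vMul i hm, appendTail_of_lt _ m h1,
    appendTail_of_lt _ m h2]
  split_ifs <;>
  simp only [map_add, map_neg, map_smul, stab_vMul, laurentTail_sigmaZ _ h, laurentTail_ddiff _ h,
    laurentTail_zvar_mul _ h1, appendTail_comp_adj _ m h]

theorem stab_mem_straightRel {n : ℕ} (hn : 1 ≤ n) {N M : ℕ} (hNM : N ≤ M) {w : Tens N}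
    (h : w ∈ straightRel n N) : stab N M w ∈ straightRel n M := by
  suffices e : straightRel n N ≤ (straightRel n M).comap (stab N M) from e h
  refine iSup_le fun i => ?_
  rintro _ ⟨v, rfl⟩
  rw [Submodule.mem_comap, LinearMap.sub_apply, LinearMap.smul_apply, Module.End.one_apply, map_sub,
    map_smul, ← heckeT_stab (M := M) (i := i) (i' := ⟨i, by omega⟩) hn rfl]
  exact heckeT_sub_smul_mem _ _

/-! ### The direct limit -/

theorem extendIndex_mem {N : ℕ} (a : Fin N → ℤ) :
    ∃ N : ℕ, ∀ k, N ≤ k → extendIndex a k = -(k : ℤ) :=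
  ⟨N, fun k hk => by simp [extendIndex, Nat.not_lt.mpr hk]⟩

theorem toInf_single {N : ℕ} (a : Fin N → ℤ) (c : K) :
    toInf N (Finsupp.single a c) = Finsupp.single ⟨extendIndex a, extendIndex_mem a⟩ c :=
  Finsupp.mapDomain_single

theorem toInf_injective (N : ℕ) : Function.Injective (toInf N) := by
  refine Finsupp.mapDomain_injective fun a b h => ?_
  funext j
  have := congrFun (congrArg Subtype.val h) j
  simpa [extendIndex] using this

theorem toInf_stab {N M : ℕ} (h : N ≤ M) (w : Tens N) : toInf M (stab N M w) = toInf N w := by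
  suffices e : (toInf M).comp (stab N M) = toInf N from LinearMap.congr_fun e w
  refine tens_hom_ext_single fun a => ?_
  rw [LinearMap.comp_apply, stab_single, toInf_single, toInf_single]
  congr 1
  refine Subtype.ext (funext fun k => ?_)
  simp only [extendIndex, appendTail]
  split_ifs <;> first | rfl | (exfalso; omega)

theorem mem_wedgeRel_iff {n : ℕ} (hn : 1 ≤ n) {x : InfTens} :
    x ∈ wedgeRel n ↔ ∃ N, ∃ w ∈ straightRel n N, toInf N w = x := by
  rw [wedgeRel, Submodule.mem_iSup_of_directed]
  · simp only [ker_antisym hn, Submodule.mem_map]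
  · refine directed_of_isDirected_le fun N M h => ?_
    rintro _ ⟨w, hw, rfl⟩
    rw [ker_antisym hn] at hw
    refine ⟨stab N M w, ?_, toInf_stab h w⟩
    rw [ker_antisym hn]
    exact stab_mem_straightRel hn h hw

/-- The map `V(z)^{⊗N} → ℱ_q`. -/
def wedgeInf (n N : ℕ) : Tens N →ₗ[K] FockQ n := (wedgeRel n).mkQ.comp (toInf N)

theorem wedgeToFock_mk (n N : ℕ) (w : Tens N) :
    wedgeToFock n N (Submodule.Quotient.mk w) = wedgeInf n N w := rfl

theorem wedgeInf_stab (n : ℕ) {N M : ℕ} (h : N ≤ M) (w : Tens N) :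
    wedgeInf n M (stab N M w) = wedgeInf n N w := by
  rw [wedgeInf, wedgeInf, LinearMap.comp_apply, toInf_stab h]
  rfl

theorem wedgeInf_eq_zero_of_mem {n : ℕ} (hn : 1 ≤ n) {N : ℕ} {w : Tens N}
    (h : w ∈ straightRel n N) : wedgeInf n N w = 0 := by
  rw [wedgeInf, LinearMap.comp_apply, Submodule.mkQ_apply, Submodule.Quotient.mk_eq_zero,
    mem_wedgeRel_iff hn]
  exact ⟨N, w, h, rfl⟩

theorem wedgeInf_eq_of_sub_mem {n : ℕ} (hn : 1 ≤ n) {N : ℕ} {v w : Tens N}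
    (h : v - w ∈ straightRel n N) : wedgeInf n N v = wedgeInf n N w := by
  rw [← sub_eq_zero, ← map_sub]
  exact wedgeInf_eq_zero_of_mem hn h

/-- A relation in the limit is already a relation at some finite stage, and it then persists at all
later stages. -/
theorem exists_stab_mem_of_wedgeInf_eq_zero {n : ℕ} (hn : 1 ≤ n) {N : ℕ} {w : Tens N}
    (h : wedgeInf n N w = 0) : ∃ M, ∀ L, M ≤ L → N ≤ L → stab N L w ∈ straightRel n L := by
  rw [wedgeInf, LinearMap.comp_apply, Submodule.mkQ_apply, Submodule.Quotient.mk_eq_zero,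
    mem_wedgeRel_iff hn] at h
  obtain ⟨M, v, hv, e⟩ := h
  refine ⟨M, fun L hM hN => ?_⟩
  have : stab N L w = stab M L v :=
    toInf_injective L (by rw [toInf_stab hN, toInf_stab hM, e])
  rw [this]
  exact stab_mem_straightRel hn hM hv

/-- Append the tail `-N, -N - 1, …` until it reaches the last index itself. The result contains `u_l
∧ u_{l+d} ∧ ⋯ ∧ u_l`, which straightens to zero. -/
theorem wedgeInf_single_eq_zero {n : ℕ} (hn : 1 ≤ n) {N : ℕ} {b : Fin N → ℤ} (j : Fin N)
    (hj : (j : ℕ) + 1 = N) (h : b j ≤ -(N : ℤ)) : wedgeInf n N (Finsupp.single b 1) = 0 := by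
  obtain ⟨d, hd⟩ := Int.eq_ofNat_of_zero_le (a := -(N : ℤ) - b j) (by omega)
  rw [← wedgeInf_stab n (show N ≤ N + d + 1 by omega), stab_single]
  refine wedgeInf_eq_zero_of_mem hn
    (single_mem_straightRel_of_interval hn d _ j (by omega) (b j) ?_ fun i hi' => ?_)
  · exact appendTail_of_lt _ _ rfl
  · rw [appendTail, dif_neg (by simp only; omega)]
    push_cast
    omega

/-! ### The basis of the Fock space -/

/-- The strictly decreasing sequence `λ_1, λ_2 - 1, …, λ_N - N + 1`. -/
def maya (N : ℕ) (lam : YoungDiagram) : Fin N → ℤ := fun k => (lam.rowLen k : ℤ) - (k : ℕ)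

theorem maya_strictAnti (N : ℕ) (lam : YoungDiagram) : StrictAnti (maya N lam) := fun i j h => by
  have h1 := lam.rowLen_anti i j (le_of_lt h)
  have h2 : (i : ℕ) < j := h
  simp only [maya]
  omega

theorem rowLen_eq_zero {lam : YoungDiagram} {k : ℕ} (h : lam.colLen 0 ≤ k) : lam.rowLen k = 0 := by
  by_contra h0
  have h1 : (k, 0) ∈ lam := YoungDiagram.mem_iff_lt_rowLen.mpr (Nat.pos_of_ne_zero h0)
  have h2 := YoungDiagram.mem_iff_lt_colLen.mp h1
  omega

theorem youngDiagram_ext_rowLen {lam mu : YoungDiagram} (h : ∀ k, lam.rowLen k = mu.rowLen k) :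
    lam = mu := by
  ext ⟨i, j⟩
  rw [YoungDiagram.mem_cells, YoungDiagram.mem_cells, YoungDiagram.mem_iff_lt_rowLen,
    YoungDiagram.mem_iff_lt_rowLen, h]

theorem maya_injOn (N : ℕ) : Set.InjOn (maya N) {lam | lam.colLen 0 ≤ N} := by
  intro lam hlam mu hmu h
  refine youngDiagram_ext_rowLen fun k => ?_
  rcases lt_or_ge k N with hk | hk
  · have := congrFun h ⟨k, hk⟩
    simp only [maya] at this
    omega
  · rw [rowLen_eq_zero (le_trans hlam hk), rowLen_eq_zero (le_trans hmu hk)]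

/-- The row lengths are `b_j + j`: weakly decreasing since `b` decreases strictly, and nonnegative
since the last index exceeds `-N`. -/
theorem exists_maya_eq {N : ℕ} {b : Fin N → ℤ} (hb : StrictAnti b) (h : ∀ j, -(N : ℤ) < b j) :
    ∃ lam : YoungDiagram, lam.colLen 0 ≤ N ∧ maya N lam = b := by
  have hstep : ∀ i j : Fin N, i ≤ j → b j + j ≤ b i + i := by
    cases N with
    | zero => exact fun i => i.elim0
    | succ N =>
      have : Antitone fun j : Fin (N + 1) => b j + (j : ℕ) := Fin.antitone_iff_succ_le.mpr
        fun i => by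
          have := hb (Fin.castSucc_lt_succ (i := i))
          simp only [Fin.val_succ, Fin.val_castSucc]
          push_cast
          omega
      exact fun i j hij => this hij
  have hpos : ∀ j : Fin N, 0 ≤ b j + j := fun j => by
    have hj := j.2
    have h1 := hstep j ⟨N - 1, by omega⟩ (Fin.le_def.mpr (Nat.le_sub_one_of_lt hj))
    have h2 := h ⟨N - 1, by omega⟩
    have : ((N - 1 : ℕ) : ℤ) = N - 1 := by omega
    simp only [this] at h1
    omega
  have hs : (List.ofFn fun j => (b j + j).toNat).SortedGE := by
    rw [List.sortedGE_ofFn_iff]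
    intro i j hij
    have := hstep i j hij
    change (b j + j).toNat ≤ (b i + i).toNat
    omega
  refine ⟨YoungDiagram.ofRowLens _ hs, ?_, ?_⟩
  · by_contra! hlt
    have h1 := YoungDiagram.mem_iff_lt_colLen.mpr hlt
    rw [YoungDiagram.mem_ofRowLens] at h1
    obtain ⟨h1, -⟩ := h1
    simp at h1
  · funext j
    have h1 := YoungDiagram.rowLen_ofRowLens (w := List.ofFn fun j => (b j + j).toNat) (hw := hs)
      ⟨j, by simp⟩
    simp only [maya]
    rw [h1]
    have := hpos j
    simp
    omega

theorem wedgeInf_maya (n : ℕ) {N : ℕ} {lam : YoungDiagram} (h : lam.colLen 0 ≤ N) :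
    wedgeInf n N (Finsupp.single (maya N lam) 1) = wedgeOf n lam := by
  rw [wedgeInf, LinearMap.comp_apply, toInf_single]
  refine congrArg _ (congrArg (fun s => Finsupp.single s 1) (Subtype.ext (funext fun k => ?_)))
  simp only [extendIndex, maya]
  split_ifs with hk
  · rfl
  · rw [rowLen_eq_zero (by omega)]
    simp

/-- The linear map `ℱ → ℱ_q` with `|λ⟩ ↦ |λ⟩`. -/
def fockMap (n : ℕ) : Fock →ₗ[K] FockQ n := Finsupp.linearCombination K (wedgeOf n)

theorem fockMap_single (n : ℕ) (lam : YoungDiagram) :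
    fockMap n (Finsupp.single lam 1) = wedgeOf n lam := by simp [fockMap]

/-- The truncation of the semi-infinite wedges to the first `N` factors. -/
def mayaMap (N : ℕ) : Fock →ₗ[K] Tens N := Finsupp.lmapDomain K K (maya N)

theorem mayaMap_mem_wedgeSpan (N : ℕ) (f : Fock) : mayaMap N f ∈ wedgeSpan N := by
  induction f using Finsupp.induction_linear with
  | zero => rw [map_zero]; exact Submodule.zero_mem _
  | add f g hf hg => rw [map_add]; exact Submodule.add_mem _ hf hg
  | single lam c =>
    rw [mayaMap, Finsupp.lmapDomain_apply, Finsupp.mapDomain_single, ← mul_one c, ← smul_eq_mul,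
      ← Finsupp.smul_single]
    exact Submodule.smul_mem _ _ (Submodule.subset_span ⟨_, maya_strictAnti N lam, rfl⟩)

theorem eventually_colLen_le (f : Fock) :
    ∃ M, ∀ lam ∈ f.support, lam.colLen 0 ≤ M :=
  ⟨f.support.sup fun lam => lam.colLen 0, fun _ h => Finset.le_sup (f := fun lam : YoungDiagram =>
    lam.colLen 0) h⟩

theorem wedgeInf_mayaMap (n : ℕ) {N : ℕ} {f : Fock} (h : ∀ lam ∈ f.support, lam.colLen 0 ≤ N) :
    wedgeInf n N (mayaMap N f) = fockMap n f := by
  rw [fockMap, Finsupp.linearCombination_apply, mayaMap, Finsupp.lmapDomain_apply,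
    Finsupp.mapDomain, Finsupp.sum, Finsupp.sum, map_sum]
  refine Finset.sum_congr rfl fun lam hlam => ?_
  rw [← wedgeInf_maya n (h lam hlam), ← map_smul, Finsupp.smul_single, smul_eq_mul, mul_one]

theorem stab_mayaMap {N M : ℕ} {f : Fock}
    (h : ∀ lam ∈ f.support, lam.colLen 0 ≤ N) : stab N M (mayaMap N f) = mayaMap M f := by
  rw [mayaMap, mayaMap, Finsupp.lmapDomain_apply, Finsupp.lmapDomain_apply,
    Finsupp.mapDomain, Finsupp.mapDomain, Finsupp.sum, Finsupp.sum, map_sum]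
  refine Finset.sum_congr rfl fun lam hlam => ?_
  rw [stab_single]
  congr 1
  funext j
  simp only [appendTail, maya]
  split_ifs with hj
  · rfl
  · rw [rowLen_eq_zero (le_trans (h lam hlam) (by omega))]
    simp

/-- A vanishing combination of the `|λ⟩` vanishes in a finite wedge power, where distinct diagrams
give distinct decreasing tensors and these are independent modulo the kernel. -/
theorem fockMap_injective {n : ℕ} (hn : 1 ≤ n) : Function.Injective (fockMap n) := by
  rw [← LinearMap.ker_eq_bot, LinearMap.ker_eq_bot']
  intro f hf
  obtain ⟨N, hN⟩ := eventually_colLen_le f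
  rw [← wedgeInf_mayaMap n hN] at hf
  obtain ⟨M, hM⟩ := exists_stab_mem_of_wedgeInf_eq_zero hn hf
  have h1 := hM (max M N) (le_max_left _ _) (le_max_right _ _)
  rw [stab_mayaMap hN, ← ker_antisym hn, LinearMap.mem_ker] at h1
  have h2 := eq_zero_of_mem_wedgeSpan hn (mayaMap_mem_wedgeSpan _ f) h1
  refine Finsupp.mapDomain_injOn {lam | lam.colLen 0 ≤ max M N} (maya_injOn _) ?_ ?_ h2
  · exact fun lam hlam => le_trans (hN lam hlam) (le_max_right _ _)
  · simp

/-- After straightening, a decreasing tensor either comes from a partition or has an index at most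
`-N`; then so is its last index, and it dies in the limit. -/
theorem wedgeInf_mem_range {n : ℕ} (hn : 1 ≤ n) {N : ℕ} (w : Tens N) :
    wedgeInf n N w ∈ LinearMap.range (fockMap n) := by
  have h : w ∈ wedgeSpan N ⊔ straightRel n N := by rw [wedgeSpan_sup_straightRel hn]; trivial
  suffices h' : wedgeSpan N ⊔ straightRel n N ≤ (LinearMap.range (fockMap n)).comap (wedgeInf n N)
    from h' h
  refine sup_le (Submodule.span_le.mpr ?_) fun v hv => ?_
  · rintro _ ⟨b, hb, rfl⟩
    change wedgeInf n N (Finsupp.single b 1) ∈ LinearMap.range (fockMap n)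
    by_cases hlow : ∃ j, b j ≤ -(N : ℤ)
    · obtain ⟨j, hj⟩ := hlow
      have hjN := j.2
      have hle : j ≤ ⟨N - 1, by omega⟩ := by rw [Fin.le_def]; simp only; omega
      rw [wedgeInf_single_eq_zero hn ⟨N - 1, by omega⟩ (by simp only; omega)
        (le_trans (hb.antitone hle) hj)]
      exact Submodule.zero_mem _
    · push Not at hlow
      obtain ⟨lam, h1, h2⟩ := exists_maya_eq hb hlow
      rw [← h2, wedgeInf_maya n h1]
      exact ⟨_, fockMap_single n lam⟩
  · rw [Submodule.mem_comap, wedgeInf_eq_zero_of_mem hn hv]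
    exact Submodule.zero_mem _

theorem exists_wedgeInf_eq (n : ℕ) (x : FockQ n) : ∃ N, ∃ w : Tens N, wedgeInf n N w = x := by
  obtain ⟨x, rfl⟩ := Submodule.Quotient.mk_surjective _ x
  induction x using Finsupp.induction_linear with
  | zero => exact ⟨0, 0, map_zero _⟩
  | add f g hf hg =>
    obtain ⟨N, v, hv⟩ := hf
    obtain ⟨M, w, hw⟩ := hg
    refine ⟨max N M, stab N _ v + stab M _ w, ?_⟩
    rw [map_add, wedgeInf_stab n (le_max_left _ _), wedgeInf_stab n (le_max_right _ _), hv, hw]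
    rfl
  | single s c =>
    obtain ⟨s, N, hs⟩ := s
    refine ⟨N, Finsupp.single (fun j => s j) c, ?_⟩
    rw [wedgeInf, LinearMap.comp_apply, toInf_single]
    refine congrArg _ (congrArg (fun s => Finsupp.single s c) (Subtype.ext (funext fun k => ?_)))
    simp only [extendIndex]
    split_ifs with hk
    · rfl
    · exact (hs k (by omega)).symm

theorem fockMap_bijective {n : ℕ} (hn : 1 ≤ n) : Function.Bijective (fockMap n) := by
  refine ⟨fockMap_injective hn, fun x => ?_⟩
  obtain ⟨N, w, rfl⟩ := exists_wedgeInf_eq n x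
  exact wedgeInf_mem_range hn w

/-- The isomorphism `ℱ ≃ ℱ_q`. -/
def fockEquiv {n : ℕ} (hn : 1 ≤ n) : Fock ≃ₗ[K] FockQ n :=
  LinearEquiv.ofBijective (fockMap n) (fockMap_bijective hn)

/-! ### Configurations of beads -/

/-- The space spanned by the finite sets of integers. -/
abbrev Conf : Type := Finset ℤ →₀ K

scoped instance : AddCommGroup Conf := Finsupp.instAddCommGroup
scoped instance : Ring (Module.End K Conf) := Module.End.instRing

theorem conf_hom_ext {M : Type*} [AddCommMonoid M] [Module K M] {f g : Conf →ₗ[K] M}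
    (h : ∀ B, f (Finsupp.single B 1) = g (Finsupp.single B 1)) : f = g :=
  Finsupp.lhom_ext' fun B => LinearMap.ext_ring (h B)

/-- The beads strictly between `x` and `x + n`. -/
def between (n : ℕ) (x : ℤ) (B : Finset ℤ) : Finset ℤ := B.filter fun b => x < b ∧ b < x + n

/-- The operator moving the bead at `x` to `x + n`. -/
def beadUp (n : ℕ) (x : ℤ) : Conf →ₗ[K] Conf :=
  Finsupp.linearCombination K fun B =>
    if x ∈ B ∧ x + n ∉ B then
      Finsupp.single (insert (x + n) (B.erase x)) ((-q⁻¹) ^ (between n x B).card)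
    else 0

theorem beadUp_single (n : ℕ) (x : ℤ) (B : Finset ℤ) : beadUp n x (Finsupp.single B 1) =
    if x ∈ B ∧ x + n ∉ B then
      (-q⁻¹) ^ (between n x B).card • Finsupp.single (insert (x + n) (B.erase x)) 1
    else 0 := by
  rw [beadUp, Finsupp.linearCombination_single, one_smul, Finsupp.smul_single, smul_eq_mul, mul_one]

theorem beadUp_single_of_mem {n : ℕ} {x : ℤ} {B : Finset ℤ} (h : x ∈ B) (h' : x + n ∉ B) :
    beadUp n x (Finsupp.single B 1) =
      (-q⁻¹) ^ (between n x B).card • Finsupp.single (insert (x + n) (B.erase x)) 1 := by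
  rw [beadUp_single, if_pos ⟨h, h'⟩]

theorem beadUp_single_of_notMem {n : ℕ} {x : ℤ} {B : Finset ℤ} (h : x ∉ B) :
    beadUp n x (Finsupp.single B 1) = 0 := by
  rw [beadUp_single, if_neg fun h' => h h'.1]

theorem beadUp_single_of_mem' {n : ℕ} {x : ℤ} {B : Finset ℤ} (h : x + n ∈ B) :
    beadUp n x (Finsupp.single B 1) = 0 := by
  rw [beadUp_single, if_neg fun h' => h'.2 h]

/-- After the move the place `x` is empty, as `n ≥ 1`. Consequently `1 + t R_x` and `1 - t R_x` are
inverse to each other. -/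
theorem beadUp_mul_self {n : ℕ} (hn : 1 ≤ n) (x : ℤ) : beadUp n x * beadUp n x = 0 := by
  refine conf_hom_ext fun B => ?_
  rw [Module.End.mul_apply, beadUp_single]
  split_ifs with h
  · rw [map_smul, beadUp_single_of_notMem, smul_zero]
    · rfl
    · simp only [Finset.mem_insert, Finset.mem_erase, not_or]
      exact ⟨by omega, fun h => h.1 rfl⟩
  · rw [map_zero]; rfl

/-- The configurations contained in `[l, u)`. -/
def confIn (l u : ℤ) : Submodule K Conf :=
  Finsupp.supported K K {B | ∀ b ∈ B, l ≤ b ∧ b < u}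

theorem single_mem_confIn {l u : ℤ} {B : Finset ℤ} (h : ∀ b ∈ B, l ≤ b ∧ b < u) :
    (Finsupp.single B 1 : Conf) ∈ confIn l u := Finsupp.single_mem_supported K 1 h

theorem confIn_mono {l u l' u' : ℤ} (hl : l' ≤ l) (hu : u ≤ u') : confIn l u ≤ confIn l' u' :=
  Finsupp.supported_mono fun _ hB b hb =>
    ⟨le_trans hl (hB b hb).1, lt_of_lt_of_le (hB b hb).2 hu⟩

theorem confIn_le_iff {l u : ℤ} {P : Submodule K Conf} :
    confIn l u ≤ P ↔ ∀ B : Finset ℤ, (∀ b ∈ B, l ≤ b ∧ b < u) → Finsupp.single B 1 ∈ P := by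
  rw [confIn, Finsupp.supported_eq_span_single, Submodule.span_le]
  exact ⟨fun h B hB => h ⟨B, hB, rfl⟩, by rintro h _ ⟨B, hB, rfl⟩; exact h B hB⟩

theorem confIn_ext {l u : ℤ} {M : Type*} [AddCommGroup M] [Module K M] {f g : Conf →ₗ[K] M}
    (h : ∀ B : Finset ℤ, (∀ b ∈ B, l ≤ b ∧ b < u) →
      f (Finsupp.single B 1) = g (Finsupp.single B 1)) {w : Conf} (hw : w ∈ confIn l u) :
    f w = g w := by
  have : confIn l u ≤ LinearMap.eqLocus f g := confIn_le_iff.mpr h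
  exact this hw

theorem beadUp_mem_confIn (n : ℕ) (x : ℤ) {l u : ℤ} {w : Conf} (hw : w ∈ confIn l u) :
    beadUp n x w ∈ confIn l (u + n) := by
  suffices h : confIn l u ≤ (confIn l (u + n)).comap (beadUp n x) from h hw
  refine confIn_le_iff.mpr fun B hB => ?_
  rw [Submodule.mem_comap, beadUp_single]
  split_ifs with h
  · refine Submodule.smul_mem _ _ (single_mem_confIn fun b hb => ?_)
    rw [Finset.mem_insert, Finset.mem_erase] at hb
    rcases hb with rfl | ⟨-, hb⟩
    · have := hB x h.1
      omega
    · have := hB b hb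
      omega
  · exact Submodule.zero_mem _

/-- Series of operators whose `k`-th coefficient raises beads by at most `k n`. -/
def Raises (n : ℕ) (F : PowerSeries (Module.End K Conf)) : Prop :=
  ∀ (k : ℕ) (l u : ℤ) (w : Conf), w ∈ confIn l u →
    PowerSeries.coeff k F w ∈ confIn l (u + k * n)

theorem Raises.one (n : ℕ) : Raises n 1 := by
  intro k l u w hw
  rw [PowerSeries.coeff_one]
  split_ifs with h
  · subst h; simpa using hw
  · exact Submodule.zero_mem _

theorem Raises.mul {n : ℕ} {F G : PowerSeries (Module.End K Conf)} (hF : Raises n F)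
    (hG : Raises n G) : Raises n (F * G) := by
  intro k l u w hw
  rw [PowerSeries.coeff_mul, LinearMap.sum_apply]
  refine Submodule.sum_mem _ fun p hp => ?_
  rw [Module.End.mul_apply]
  have := hF p.1 _ _ _ (hG p.2 _ _ _ hw)
  convert this using 2
  rw [← Finset.HasAntidiagonal.mem_antidiagonal.mp hp]
  push_cast
  ring

/-- The factor `1 + t R_x`. -/
def upFactor (n : ℕ) (x : ℤ) : PowerSeries (Module.End K Conf) :=
  1 + PowerSeries.X * PowerSeries.C (beadUp n x)

/-- The factor `1 - t R_x`. -/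
def upFactorNeg (n : ℕ) (x : ℤ) : PowerSeries (Module.End K Conf) :=
  1 - PowerSeries.X * PowerSeries.C (beadUp n x)

theorem coeff_zero_X_mul_C_mul {A : Type*} [Ring A] (a : A) (F : PowerSeries A) :
    PowerSeries.coeff 0 (PowerSeries.X * PowerSeries.C a * F) = 0 := by
  rw [mul_assoc, PowerSeries.coeff_zero_X_mul]

theorem coeff_succ_X_mul_C_mul {A : Type*} [Ring A] (a : A) (F : PowerSeries A) (k : ℕ) :
    PowerSeries.coeff (k + 1) (PowerSeries.X * PowerSeries.C a * F) =
      a * PowerSeries.coeff k F := by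
  rw [mul_assoc, PowerSeries.coeff_succ_X_mul, PowerSeries.coeff_C_mul]

theorem coeff_succ_mul_X_mul_C {A : Type*} [Ring A] (a : A) (F : PowerSeries A) (k : ℕ) :
    PowerSeries.coeff (k + 1) (F * (PowerSeries.X * PowerSeries.C a)) =
      PowerSeries.coeff k F * a := by
  rw [← mul_assoc, (PowerSeries.commute_X F).eq, mul_assoc, PowerSeries.coeff_succ_X_mul,
    PowerSeries.coeff_mul_C]

theorem coeff_zero_mul_X_mul_C {A : Type*} [Ring A] (a : A) (F : PowerSeries A) :
    PowerSeries.coeff 0 (F * (PowerSeries.X * PowerSeries.C a)) = 0 := by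
  rw [← mul_assoc, (PowerSeries.commute_X F).eq, mul_assoc, PowerSeries.coeff_zero_X_mul]

theorem Raises.upFactor (n : ℕ) (x : ℤ) : Raises n (upFactor n x) := by
  intro k l u w hw
  rw [QFock.upFactor, map_add, LinearMap.add_apply, ← mul_one (PowerSeries.C _), ← mul_assoc]
  refine Submodule.add_mem _ (Raises.one n k l u w hw) ?_
  cases k with
  | zero => rw [coeff_zero_X_mul_C_mul]; exact Submodule.zero_mem _
  | succ k =>
    rw [coeff_succ_X_mul_C_mul, Module.End.mul_apply]
    have := beadUp_mem_confIn n x (Raises.one n k l u w hw)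
    convert this using 2
    push_cast
    ring

theorem Raises.upFactorNeg (n : ℕ) (x : ℤ) : Raises n (upFactorNeg n x) := by
  intro k l u w hw
  rw [show QFock.upFactorNeg n x = 1 + 1 - QFock.upFactor n x by
    rw [QFock.upFactorNeg, QFock.upFactor]; abel, map_sub, map_add, LinearMap.sub_apply,
    LinearMap.add_apply]
  exact Submodule.sub_mem _ (Submodule.add_mem _ (Raises.one n k l u w hw)
    (Raises.one n k l u w hw)) (Raises.upFactor n x k l u w hw)

theorem X_mul_C_mul_self {A : Type*} [Ring A] {a : A} (h : a * a = 0) :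
    PowerSeries.X * PowerSeries.C a * (PowerSeries.X * PowerSeries.C a) = 0 := by
  rw [mul_assoc, ← mul_assoc (PowerSeries.C a), (PowerSeries.commute_X (PowerSeries.C a)).eq,
    mul_assoc PowerSeries.X, ← map_mul, h, map_zero, mul_zero, mul_zero]

theorem upFactor_mul_upFactorNeg {n : ℕ} (hn : 1 ≤ n) (x : ℤ) :
    upFactor n x * upFactorNeg n x = 1 := by
  have h := X_mul_C_mul_self (beadUp_mul_self hn x)
  rw [upFactor, upFactorNeg, add_mul, one_mul, mul_sub, h, mul_one, sub_zero, sub_add_cancel]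

/-- The product of the `1 + t R_x` over `s ≤ x < s + m`, smaller `x` acting first. -/
def upSeries (n : ℕ) (s : ℤ) : ℕ → PowerSeries (Module.End K Conf)
  | 0 => 1
  | m + 1 => upFactor n (s + m) * upSeries n s m

/-- The product of the `1 - t R_x` over `s ≤ x < s + m`, larger `x` acting first. -/
def upSeriesNeg (n : ℕ) (s : ℤ) : ℕ → PowerSeries (Module.End K Conf)
  | 0 => 1
  | m + 1 => upSeriesNeg n s m * upFactorNeg n (s + m)

theorem upSeries_mul_upSeriesNeg {n : ℕ} (hn : 1 ≤ n) (s : ℤ) (m : ℕ) :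
    upSeries n s m * upSeriesNeg n s m = 1 := by
  induction m with
  | zero => rw [upSeries, upSeriesNeg, one_mul]
  | succ m ih =>
    rw [upSeries, upSeriesNeg, mul_assoc, ← mul_assoc (upSeries n s m), ih, one_mul,
      upFactor_mul_upFactorNeg hn]

theorem Raises.upSeriesNeg (n : ℕ) (s : ℤ) (m : ℕ) : Raises n (upSeriesNeg n s m) := by
  induction m with
  | zero => exact Raises.one n
  | succ m ih => exact ih.mul (Raises.upFactorNeg n _)

theorem coeff_zero_upSeriesNeg (n : ℕ) (s : ℤ) (m : ℕ) :
    PowerSeries.coeff 0 (upSeriesNeg n s m) = 1 := by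
  induction m with
  | zero => rw [upSeriesNeg, PowerSeries.coeff_zero_one]
  | succ m ih =>
    rw [upSeriesNeg, upFactorNeg, mul_sub, mul_one, map_sub, coeff_zero_mul_X_mul_C, ih, sub_zero]

theorem coeff_succ_upSeriesNeg (n : ℕ) (s : ℤ) (m k : ℕ) :
    PowerSeries.coeff (k + 1) (upSeriesNeg n s (m + 1)) =
      PowerSeries.coeff (k + 1) (upSeriesNeg n s m) -
        PowerSeries.coeff k (upSeriesNeg n s m) * beadUp n (s + m) := by
  rw [upSeriesNeg, upFactorNeg, mul_sub, mul_one, map_sub, coeff_succ_mul_X_mul_C]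

theorem coeff_zero_upSeries (n : ℕ) (s : ℤ) (m : ℕ) :
    PowerSeries.coeff 0 (upSeries n s m) = 1 := by
  induction m with
  | zero => rw [upSeries, PowerSeries.coeff_zero_one]
  | succ m ih =>
    rw [upSeries, upFactor, add_mul, one_mul, map_add, coeff_zero_X_mul_C_mul, ih, add_zero]

theorem coeff_succ_upSeries (n : ℕ) (s : ℤ) (m k : ℕ) :
    PowerSeries.coeff (k + 1) (upSeries n s (m + 1)) =
      PowerSeries.coeff (k + 1) (upSeries n s m) +
        beadUp n (s + m) * PowerSeries.coeff k (upSeries n s m) := by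
  rw [upSeries, upFactor, add_mul, one_mul, map_add, coeff_succ_X_mul_C_mul]

/-- Adding a bead at `v`. -/
def addBead (v : ℤ) : Conf →ₗ[K] Conf := Finsupp.lmapDomain K K (insert v)

theorem addBead_single (v : ℤ) (B : Finset ℤ) :
    addBead v (Finsupp.single B 1) = Finsupp.single (insert v B) 1 := by
  simp [addBead, Finsupp.mapDomain_single]

/-- A bead at `v < x` is neither moved, nor an obstacle at `x + n`, nor jumped over. -/
theorem beadUp_addBead {n : ℕ} {x v u : ℤ} (h : v < x) {w : Conf} (hw : w ∈ confIn (v + 1) u) :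
    beadUp n x (addBead v w) = addBead v (beadUp n x w) := by
  suffices e : ((beadUp n x).comp (addBead v)) w = ((addBead v).comp (beadUp n x)) w from e
  refine confIn_ext (fun B hB => ?_) hw
  rw [LinearMap.comp_apply, LinearMap.comp_apply, addBead_single, beadUp_single, beadUp_single]
  have h1 : x ∈ insert v B ↔ x ∈ B := by
    rw [Finset.mem_insert, or_iff_right (by omega)]
  have h2 : x + n ∈ insert v B ↔ x + n ∈ B := by
    rw [Finset.mem_insert, or_iff_right (by omega)]
  simp only [h1, h2]
  split_ifs
  · have h3 : between n x (insert v B) = between n x B := by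
      rw [between, Finset.filter_insert, if_neg (by omega)]; rfl
    rw [map_smul, addBead_single, h3]
    congr 2
    rw [Finset.erase_insert_of_ne (by omega), Finset.insert_comm]
  · rw [map_zero]

/-- Every factor of the product looks for a bead to the left of all the beads present. -/
theorem coeff_upSeriesNeg_eq_zero {n : ℕ} {s u : ℤ} (m k : ℕ) {w : Conf}
    (hw : w ∈ confIn (s + m) u) : PowerSeries.coeff (k + 1) (upSeriesNeg n s m) w = 0 := by
  induction m with
  | zero => rw [upSeriesNeg, PowerSeries.coeff_one, if_neg (by omega)]; rfl
  | succ m ih =>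
    have h : beadUp n (s + m) w = 0 := by
      refine confIn_ext (g := 0) (fun B hB => ?_) hw
      rw [beadUp_single_of_notMem, LinearMap.zero_apply]
      intro h
      have := hB _ h
      push_cast at this
      omega
    rw [coeff_succ_upSeriesNeg, LinearMap.sub_apply, Module.End.mul_apply, h, map_zero, sub_zero]
    exact ih (confIn_mono (by push_cast; omega) le_rfl hw)

theorem addBead_mem_confIn {v u : ℤ} (hvu : v < u) {w : Conf} (hw : w ∈ confIn (v + 1) u) :
    addBead v w ∈ confIn v u := by
  suffices h : confIn (v + 1) u ≤ (confIn v u).comap (addBead v) from h hw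
  refine confIn_le_iff.mpr fun B hB => ?_
  rw [Submodule.mem_comap, addBead_single]
  refine single_mem_confIn fun b hb => ?_
  rw [Finset.mem_insert] at hb
  rcases hb with rfl | hb
  · omega
  · have := hB b hb
    omega

/-- A new smallest bead `v` is invisible to the factors with `x > v`, which act before; it is then
met by `1 - t R_v`, and the factors with `x < v` find nothing to move. This matches the effect on `∏
(1 - t y_j)` of one more tensor factor at the end. -/
theorem coeff_upSeriesNeg_addBead {n : ℕ} {s v u : ℤ} {m : ℕ} (hs : s ≤ v) (hv : v < s + m)
    (hvu : v < u) (k : ℕ) {w : Conf} (hw : w ∈ confIn (v + 1) u) :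
    PowerSeries.coeff (k + 1) (upSeriesNeg n s m) (addBead v w) =
      addBead v (PowerSeries.coeff (k + 1) (upSeriesNeg n s m) w) -
        beadUp n v (addBead v (PowerSeries.coeff k (upSeriesNeg n s m) w)) := by
  induction m generalizing k w u with
  | zero => push_cast at hv; omega
  | succ m ih =>
    rcases (show v ≤ s + m by push_cast at hv; omega).eq_or_lt with h | h
    · subst h
      rw [coeff_succ_upSeriesNeg, LinearMap.sub_apply, Module.End.mul_apply,
        coeff_upSeriesNeg_eq_zero m k (addBead_mem_confIn hvu hw), zero_sub,
        ← coeff_succ_upSeriesNeg,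
        coeff_upSeriesNeg_eq_zero (m + 1) k (by push_cast; rwa [← add_assoc]), map_zero, zero_sub]
      have h1 := beadUp_mem_confIn n (s + m) (addBead_mem_confIn hvu hw)
      cases k with
      | zero => rw [coeff_zero_upSeriesNeg, coeff_zero_upSeriesNeg]; rfl
      | succ k =>
        rw [coeff_upSeriesNeg_eq_zero m k h1,
          coeff_upSeriesNeg_eq_zero (m + 1) k (by push_cast; rwa [← add_assoc]), map_zero, map_zero]
    · have h1 := beadUp_mem_confIn n (s + m) hw
      rw [coeff_succ_upSeriesNeg, LinearMap.sub_apply, LinearMap.sub_apply, Module.End.mul_apply,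
        Module.End.mul_apply, beadUp_addBead h hw, ih h hvu k hw]
      cases k with
      | zero =>
        rw [coeff_zero_upSeriesNeg, coeff_zero_upSeriesNeg]
        simp only [Module.End.one_apply, map_sub]
        abel
      | succ k =>
        rw [ih h (by omega) k h1, coeff_succ_upSeriesNeg]
        simp only [LinearMap.sub_apply, Module.End.mul_apply, map_sub]
        abel

/-! ### The exact straightening relations -/

/-- The span of the straightening relations without correction terms. -/
def exactRel (n N : ℕ) : Submodule K (Tens N) :=
  Submodule.span K
    ({w | ∃ (i : Fin (N - 1)) (a : Fin N → ℤ), a (lo i) < a (hi i) ∧ a (hi i) < a (lo i) + n ∧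
      w = Finsupp.single a 1 + q⁻¹ • Finsupp.single (a ∘ adj i) 1} ∪
    {w | ∃ (i : Fin (N - 1)) (a : Fin N → ℤ), a (lo i) = a (hi i) ∧ w = Finsupp.single a 1})

theorem swap_mem_exactRel {n N : ℕ} (i : Fin (N - 1)) {a : Fin N → ℤ} (h : a (lo i) < a (hi i))
    (h' : a (hi i) < a (lo i) + n) :
    Finsupp.single a 1 + q⁻¹ • Finsupp.single (a ∘ adj i) 1 ∈ exactRel n N :=
  Submodule.subset_span (Or.inl ⟨i, a, h, h', rfl⟩)

theorem single_mem_exactRel {n N : ℕ} (i : Fin (N - 1)) {a : Fin N → ℤ} (h : a (lo i) = a (hi i)) :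
    (Finsupp.single a 1 : Tens N) ∈ exactRel n N :=
  Submodule.subset_span (Or.inr ⟨i, a, h, rfl⟩)

theorem exactRel_le {n N : ℕ} {P : Submodule K (Tens N)}
    (h1 : ∀ (i : Fin (N - 1)) (a : Fin N → ℤ), a (lo i) < a (hi i) → a (hi i) < a (lo i) + n →
      Finsupp.single a 1 + q⁻¹ • Finsupp.single (a ∘ adj i) 1 ∈ P)
    (h2 : ∀ (i : Fin (N - 1)) (a : Fin N → ℤ), a (lo i) = a (hi i) → Finsupp.single a 1 ∈ P) :
    exactRel n N ≤ P := by
  refine Submodule.span_le.mpr ?_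
  rintro _ (⟨i, a, h, h', rfl⟩ | ⟨i, a, h, rfl⟩)
  · exact h1 i a h h'
  · exact h2 i a h

theorem exactRel_le_straightRel {n : ℕ} (hn : 1 ≤ n) (N : ℕ) : exactRel n N ≤ straightRel n N :=
  exactRel_le (fun i _ h h' => single_add_smul_mem_straightRel hn i h h')
    fun i _ h => single_mem_straightRel_of_eq hn i h

/-! ### Appending a factor -/

/-- The map `w ↦ w ⊗ u_v`. -/
def snocTens (N : ℕ) (v : ℤ) : Tens N →ₗ[K] Tens (N + 1) :=
  Finsupp.lmapDomain K K (appendTail (N + 1) fun _ => v)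

theorem snocTens_single {N : ℕ} (v : ℤ) (a : Fin N → ℤ) :
    snocTens N v (Finsupp.single a 1) = Finsupp.single (appendTail (N + 1) (fun _ => v) a) 1 :=
  Finsupp.mapDomain_single

theorem appendTail_last {N : ℕ} (v : ℤ) (a : Fin N → ℤ) :
    appendTail (N + 1) (fun _ => v) a (Fin.last N) = v := by
  simp [appendTail]

theorem snocTens_mem_exactRel {n N : ℕ} (v : ℤ) {w : Tens N} (h : w ∈ exactRel n N) :
    snocTens N v w ∈ exactRel n (N + 1) := by
  suffices e : exactRel n N ≤ (exactRel n (N + 1)).comap (snocTens N v) from e h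
  have key : ∀ i : Fin (N - 1), ∃ i' : Fin (N + 1 - 1), (i' : ℕ) = i :=
    fun i => ⟨⟨i, by omega⟩, rfl⟩
  refine exactRel_le (fun i a h h' => ?_) fun i a h => ?_
  · obtain ⟨i', hi'⟩ := key i
    have h1 : ((lo i' : Fin (N + 1)) : ℕ) = lo i := hi'
    have h2 : ((hi i' : Fin (N + 1)) : ℕ) = hi i := by simp [hi, hi']
    rw [Submodule.mem_comap, map_add, map_smul, snocTens_single, snocTens_single,
      appendTail_comp_adj _ _ hi']
    refine swap_mem_exactRel i' ?_ ?_ <;>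
    rw [appendTail_of_lt _ a h1, appendTail_of_lt _ a h2] <;> assumption
  · obtain ⟨i', hi'⟩ := key i
    have h1 : ((lo i' : Fin (N + 1)) : ℕ) = lo i := hi'
    have h2 : ((hi i' : Fin (N + 1)) : ℕ) = hi i := by simp [hi, hi']
    rw [Submodule.mem_comap, snocTens_single]
    refine single_mem_exactRel i' ?_
    rw [appendTail_of_lt _ a h1, appendTail_of_lt _ a h2, h]

theorem heckeY_castSucc_snocTens {n N : ℕ} (j : Fin N) (v : ℤ) (w : Tens N) :
    heckeY n j.castSucc (snocTens N v w) = snocTens N v (heckeY n j w) := by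
  suffices e : (heckeY n j.castSucc).comp (snocTens N v) = (snocTens N v).comp (heckeY n j) from
    LinearMap.congr_fun e w
  refine tens_hom_ext_single fun a => ?_
  rw [LinearMap.comp_apply, LinearMap.comp_apply, snocTens_single, heckeY_single, heckeY_single,
    snocTens_single, appendTail_add_single _ _ (j := j) (j' := j.castSucc) rfl]

theorem heckeY_last_snocTens {n N : ℕ} (v : ℤ) (w : Tens N) :
    heckeY n (Fin.last N) (snocTens N v w) = snocTens N (v + n) w := by
  suffices e : (heckeY n (Fin.last N)).comp (snocTens N v) = snocTens N (v + n) from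
    LinearMap.congr_fun e w
  refine tens_hom_ext_single fun a => ?_
  rw [LinearMap.comp_apply, snocTens_single, heckeY_single, snocTens_single]
  congr 1
  funext j
  simp only [appendTail, Pi.add_apply, Pi.single_apply, Fin.ext_iff, Fin.val_last]
  split_ifs <;> first | rfl | (exfalso; omega) | simp

theorem snocTens_snocTens_self {n N : ℕ} (v : ℤ) (w : Tens N) :
    snocTens (N + 1) v (snocTens N v w) ∈ exactRel n (N + 2) := by
  induction w using Finsupp.induction_linear with
  | zero => rw [map_zero, map_zero]; exact Submodule.zero_mem _
  | add f g hf hg => rw [map_add, map_add]; exact Submodule.add_mem _ hf hg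
  | single a c =>
    rw [← mul_one c, ← smul_eq_mul, ← Finsupp.smul_single, map_smul, map_smul, snocTens_single,
      snocTens_single]
    refine Submodule.smul_mem _ _ (single_mem_exactRel ⟨N, by omega⟩ ?_)
    simp [appendTail, lo, hi]

/-- The exact rule for the last two factors, extended linearly in all preceding ones. -/
theorem snocTens_snocTens_swap {n N : ℕ} {c x : ℤ} (h : c < x) (h' : x < c + n) (w : Tens N) :
    snocTens (N + 1) x (snocTens N c w) + q⁻¹ • snocTens (N + 1) c (snocTens N x w) ∈
      exactRel n (N + 2) := by
  induction w using Finsupp.induction_linear with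
  | zero => simp only [map_zero, smul_zero, add_zero]; exact Submodule.zero_mem _
  | add f g hf hg =>
    simp only [map_add, smul_add]
    convert Submodule.add_mem _ hf hg using 1
    abel
  | single a k =>
    rw [← mul_one k, ← smul_eq_mul, ← Finsupp.smul_single]
    simp only [map_smul, snocTens_single]
    rw [smul_comm, ← smul_add]
    refine Submodule.smul_mem _ _ ?_
    set b := appendTail (N + 1 + 1) (fun _ => x) (appendTail (N + 1) (fun _ => c) a) with hb
    let i : Fin (N + 1 + 1 - 1) := ⟨N, by omega⟩
    have h1 : b (lo i) = c := by simp [hb, i, appendTail, lo]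
    have h2 : b (hi i) = x := by simp [hb, i, appendTail, hi]
    have h3 : b ∘ adj i = appendTail (N + 1 + 1) (fun _ => c) (appendTail (N + 1) (fun _ => x) a) := by
      funext s
      rw [Function.comp_apply]
      by_cases e1 : s = lo i
      · subst e1; rw [adj_lo, h2]; simp [appendTail, lo, i]
      by_cases e2 : s = hi i
      · subst e2; rw [adj_hi, h1]; simp [appendTail, hi, i]
      rw [adj_of_ne e1 e2, hb]
      have e3 : (s : ℕ) < N := by
        simp only [Fin.ext_iff, lo, hi, i] at e1 e2
        omega
      simp [appendTail, e3, show (s : ℕ) < N + 1 by omega]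
    rw [← h3]
    exact swap_mem_exactRel i (by rw [h1, h2]; exact h) (by rw [h1, h2]; exact h')

/-! ### From configurations to tensors -/

/-- The elements of `B` in decreasing order. -/
def descSeq {N : ℕ} (B : Finset ℤ) (h : B.card = N) : Fin N → ℤ :=
  fun j => B.orderEmbOfFin h j.rev

theorem descSeq_strictAnti {N : ℕ} (B : Finset ℤ) (h : B.card = N) : StrictAnti (descSeq B h) :=
  fun _ _ hij => (B.orderEmbOfFin h).strictMono (Fin.rev_lt_rev.mpr hij)

theorem image_descSeq {N : ℕ} (B : Finset ℤ) (h : B.card = N) :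
    Finset.univ.image (descSeq B h) = B := by
  ext x
  rw [Finset.mem_image, ← Finset.mem_coe, ← Finset.range_orderEmbOfFin B h]
  constructor
  · rintro ⟨j, -, rfl⟩
    exact ⟨j.rev, rfl⟩
  · rintro ⟨j, rfl⟩
    exact ⟨j.rev, Finset.mem_univ _, by simp [descSeq]⟩

theorem descSeq_eq {N : ℕ} {b : Fin N → ℤ} (hb : StrictAnti b) {B : Finset ℤ}
    (h : B.card = N) (e : Finset.univ.image b = B) : descSeq B h = b := by
  subst e
  have := Finset.orderEmbOfFin_unique h (f := b ∘ Fin.rev)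
    (fun x => Finset.mem_image_of_mem _ (Finset.mem_univ _))
    fun i j hij => hb (Fin.rev_lt_rev.mpr hij)
  funext j
  rw [descSeq, ← this]
  simp

theorem card_image_strictAnti {N : ℕ} {b : Fin N → ℤ} (hb : StrictAnti b) :
    (Finset.univ.image b).card = N := by
  rw [Finset.card_image_of_injective _ hb.injective, Finset.card_fin]

/-- The map sending a configuration with `N` beads to the tensor of its beads in decreasing
order. -/
def beadTens (N : ℕ) : Conf →ₗ[K] Tens N :=
  Finsupp.linearCombination K fun B =>
    if h : B.card = N then Finsupp.single (descSeq B h) 1 else 0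

theorem beadTens_single {N : ℕ} {B : Finset ℤ} (h : B.card = N) :
    beadTens N (Finsupp.single B 1) = Finsupp.single (descSeq B h) 1 := by
  rw [beadTens, Finsupp.linearCombination_single, one_smul, dif_pos h]

theorem beadTens_image {N : ℕ} {b : Fin N → ℤ} (hb : StrictAnti b) :
    beadTens N (Finsupp.single (Finset.univ.image b) 1) = Finsupp.single b 1 := by
  rw [beadTens_single (card_image_strictAnti hb), descSeq_eq hb _ rfl]

theorem beadTens_single_of_ne {N : ℕ} {B : Finset ℤ} (h : B.card ≠ N) :
    beadTens N (Finsupp.single B 1) = 0 := by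
  rw [beadTens, Finsupp.linearCombination_single, one_smul, dif_neg h]

theorem snocTens_beadTens_single (N : ℕ) {v : ℤ} {B : Finset ℤ} (hv : ∀ b ∈ B, v < b) :
    snocTens N v (beadTens N (Finsupp.single B 1)) =
      beadTens (N + 1) (Finsupp.single (insert v B) 1) := by
  have hvB : v ∉ B := fun h => lt_irrefl _ (hv v h)
  by_cases h : B.card = N
  · have hb : StrictAnti (appendTail (N + 1) (fun _ => v) (descSeq B h)) := by
      intro i j hij
      have hij' : (i : ℕ) < j := hij
      simp only [appendTail]
      rw [dif_pos (show (i : ℕ) < N by omega)]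
      split_ifs with hj
      · exact descSeq_strictAnti B h hij
      · exact hv _ (Finset.orderEmbOfFin_mem _ _ _)
    rw [beadTens_single h, snocTens_single, ← beadTens_image hb]
    congr 2
    ext x
    rw [Finset.mem_insert, Finset.mem_image]
    constructor
    · rintro ⟨j, -, rfl⟩
      refine Fin.lastCases (Or.inl (appendTail_last _ _)) (fun j => Or.inr ?_) j
      rw [appendTail_of_lt (j := j) (j' := j.castSucc) _ _ rfl]
      exact Finset.orderEmbOfFin_mem _ _ _
    · rintro (rfl | hx)
      · exact ⟨Fin.last N, Finset.mem_univ _, appendTail_last _ _⟩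
      · rw [← image_descSeq B h, Finset.mem_image] at hx
        obtain ⟨j, -, rfl⟩ := hx
        exact ⟨j.castSucc, Finset.mem_univ _, appendTail_of_lt _ _ rfl⟩
  · rw [beadTens_single_of_ne h, map_zero, beadTens_single_of_ne]
    rw [Finset.card_insert_of_notMem hvB]
    omega

theorem snocTens_beadTens {N : ℕ} {v u : ℤ} {w : Conf} (hw : w ∈ confIn (v + 1) u) :
    snocTens N v (beadTens N w) = beadTens (N + 1) (addBead v w) := by
  refine confIn_ext (f := (snocTens N v).comp (beadTens N))
    (g := (beadTens (N + 1)).comp (addBead v)) (fun B hB => ?_) hw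
  rw [LinearMap.comp_apply, LinearMap.comp_apply, addBead_single]
  exact snocTens_beadTens_single N fun b hb => by have := hB b hb; omega

/-- The appended `u_x` travels to the left past the smaller indices, all within distance less than
`n`, gaining `-q⁻¹` each time, and dies if it meets an equal index. The induction removes the
smallest bead, which is the first one to be passed. -/
theorem snocTens_beadTens_sub_mem {n : ℕ} (C : Finset ℤ) : ∀ (N : ℕ) (x : ℤ),
    (∀ c ∈ C, c < x → x < c + n) →
    snocTens N x (beadTens N (Finsupp.single C 1)) -
      (if x ∈ C then 0 else (-q⁻¹) ^ (C.filter fun c => c < x).card •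
        beadTens (N + 1) (Finsupp.single (insert x C) 1)) ∈ exactRel n (N + 1) := by
  induction C using Finset.induction_on_min with
  | empty =>
    intro N x _
    rw [snocTens_beadTens_single N (by simp)]
    simp
  | insert c C hc ih =>
    intro N x hx
    have hcC : c ∉ C := fun h => lt_irrefl _ (hc c h)
    rcases lt_trichotomy x c with h | h | h
    · have h1 : ∀ b ∈ insert c C, x < b := fun b hb => by
        rw [Finset.mem_insert] at hb
        rcases hb with rfl | hb
        · exact h
        · exact h.trans (hc b hb)
      rw [snocTens_beadTens_single N h1, if_neg fun h' => lt_irrefl _ (h1 x h'),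
        Finset.filter_false_of_mem fun b hb => not_lt.mpr (h1 b hb).le]
      simp
    · subst h
      rw [if_pos (Finset.mem_insert_self _ _), sub_zero]
      cases N with
      | zero =>
        rw [beadTens_single_of_ne, map_zero]
        · exact Submodule.zero_mem _
        · rw [Finset.card_insert_of_notMem hcC]; omega
      | succ N =>
        rw [← snocTens_beadTens_single N hc]
        exact snocTens_snocTens_self _ _
    · cases N with
      | zero =>
        rw [beadTens_single_of_ne, map_zero, zero_sub, beadTens_single_of_ne]
        · rw [smul_zero, ite_self, neg_zero]; exact Submodule.zero_mem _
        · intro h'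
          rw [Finset.card_eq_one] at h'
          obtain ⟨y, hy⟩ := h'
          have h1 : x = y := by
            rw [← Finset.mem_singleton, ← hy]; exact Finset.mem_insert_self _ _
          have h2 : c = y := by
            rw [← Finset.mem_singleton, ← hy]
            exact Finset.mem_insert_of_mem (Finset.mem_insert_self _ _)
          omega
        · rw [Finset.card_insert_of_notMem hcC]; omega
      | succ N =>
        rw [← snocTens_beadTens_single N hc]
        have h1 := snocTens_snocTens_swap (N := N) h (hx c (Finset.mem_insert_self _ _) h)
          (beadTens N (Finsupp.single C 1))
        have h2 := snocTens_mem_exactRel c (ih N x fun b hb => hx b (Finset.mem_insert_of_mem hb))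
        have h3 := Submodule.sub_mem _ h1 (Submodule.smul_mem _ q⁻¹ h2)
        have hxC : x ∈ insert c C ↔ x ∈ C := by
          rw [Finset.mem_insert, or_iff_right (by omega)]
        convert h3 using 1
        rw [map_sub, smul_sub]
        simp only [hxC]
        by_cases hm : x ∈ C
        · simp only [if_pos hm, map_zero, smul_zero, sub_zero]
          abel
        · simp only [if_neg hm, map_smul]
          rw [snocTens_beadTens_single (N + 1) (v := c) (B := insert x C) (fun b hb => by
            rw [Finset.mem_insert] at hb
            rcases hb with rfl | hb
            · exact h
            · exact hc b hb), Finset.insert_comm, Finset.filter_insert, if_pos h,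
            Finset.card_insert_of_notMem (fun h' => hcC (Finset.mem_filter.mp h').1), pow_succ',
            mul_smul, neg_smul]
          abel

/-- The indices that `u_{v+n}` must pass are exactly the beads strictly between `v` and `v + n`, so
sorting it in reproduces the factor of `R_v`. -/
theorem snocTens_add_beadTens_sub_mem {n N : ℕ} (hn : 1 ≤ n) {v u : ℤ} {w : Conf}
    (hw : w ∈ confIn (v + 1) u) :
    snocTens N (v + n) (beadTens N w) - beadTens (N + 1) (beadUp n v (addBead v w)) ∈
      exactRel n (N + 1) := by
  let F : Conf →ₗ[K] Tens (N + 1) := (snocTens N (v + n)).comp (beadTens N) -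
    (beadTens (N + 1)).comp ((beadUp n v).comp (addBead v))
  suffices h : confIn (v + 1) u ≤ (exactRel n (N + 1)).comap F from h hw
  refine confIn_le_iff.mpr fun B hB => ?_
  have h := snocTens_beadTens_sub_mem (n := n) B N (v + n) fun c hc _ => by
    have := hB c hc
    omega
  change snocTens N (v + n) (beadTens N (Finsupp.single B 1)) -
    beadTens (N + 1) (beadUp n v (addBead v (Finsupp.single B 1))) ∈ exactRel n (N + 1)
  have hvB : v ∉ B := fun h => by have := hB v h; omega
  convert h using 2
  rw [addBead_single]
  have hbet : between n v (insert v B) = B.filter fun c => c < v + n := by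
    rw [between, Finset.filter_insert, if_neg (by omega)]
    refine Finset.filter_congr fun b hb => ?_
    have := hB b hb
    omega
  by_cases hm : v + n ∈ B
  · rw [if_pos hm, beadUp_single_of_mem' (Finset.mem_insert_of_mem hm), map_zero]
  · rw [if_neg hm, beadUp_single_of_mem (Finset.mem_insert_self _ _)
      (by rw [Finset.mem_insert, not_or]; exact ⟨by omega, hm⟩), map_smul,
      Finset.erase_insert hvB, hbet]

/-! ### Elementary symmetric functions of the `y_j` -/

theorem coeff_zero_eSeries {N : ℕ} {A : Type*} [Ring A] (x : Fin N → A) :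
    PowerSeries.coeff 0 (eSeries x) = 1 := by
  induction N with
  | zero => simp [eSeries]
  | succ N ih =>
    rw [eSeries, List.ofFn_succ, List.prod_cons, sub_mul, one_mul, map_sub,
      coeff_zero_X_mul_C_mul, sub_zero]
    exact ih fun j => x j.succ

theorem coeff_succ_eSeries {N : ℕ} {A : Type*} [Ring A] (x : Fin (N + 1) → A) (k : ℕ) :
    PowerSeries.coeff (k + 1) (eSeries x) = PowerSeries.coeff (k + 1) (eSeries fun j => x j.succ) -
      x 0 * PowerSeries.coeff k (eSeries fun j => x j.succ) := by
  rw [eSeries, List.ofFn_succ, List.prod_cons, sub_mul, one_mul, map_sub, coeff_succ_X_mul_C_mul]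
  rfl

theorem coeff_succ_eSeries_last {N : ℕ} {A : Type*} [Ring A] (x : Fin (N + 1) → A) (k : ℕ) :
    PowerSeries.coeff (k + 1) (eSeries x) =
      PowerSeries.coeff (k + 1) (eSeries fun j => x j.castSucc) -
        PowerSeries.coeff k (eSeries fun j => x j.castSucc) * x (Fin.last N) := by
  rw [eSeries, List.ofFn_succ', List.prod_concat, mul_sub, mul_one, map_sub,
    coeff_succ_mul_X_mul_C]
  rfl

/-- Intertwining relations extend from operators to their elementary symmetric functions. -/
theorem coeff_eSeries_intertwine {V W : Type*} [AddCommGroup V] [Module K V] [AddCommGroup W]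
    [Module K W] (f : V →ₗ[K] W) {N : ℕ} (x : Fin N → Module.End K V) (x' : Fin N → Module.End K W)
    (h : ∀ j v, x' j (f v) = f (x j v)) (k : ℕ) (v : V) :
    PowerSeries.coeff k (eSeries x') (f v) = f (PowerSeries.coeff k (eSeries x) v) := by
  induction N generalizing k with
  | zero =>
    simp only [eSeries, List.ofFn_zero, List.prod_nil, PowerSeries.coeff_one]
    split_ifs
    · rfl
    · rw [LinearMap.zero_apply, LinearMap.zero_apply, map_zero]
  | succ N ih =>
    cases k with
    | zero => rw [coeff_zero_eSeries, coeff_zero_eSeries]; rfl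
    | succ k =>
      have ih' := ih (fun j => x j.succ) (fun j => x' j.succ) fun j v => h j.succ v
      rw [coeff_succ_eSeries, coeff_succ_eSeries, LinearMap.sub_apply, LinearMap.sub_apply,
        Module.End.mul_apply, Module.End.mul_apply, map_sub, ih', ih', h]

theorem eSeries_comp_perm {N : ℕ} {A : Type*} [Ring A] (x : Fin N → A)
    (hx : ∀ i j, Commute (x i) (x j)) (σ : Equiv.Perm (Fin N)) : eSeries (x ∘ σ) = eSeries x := by
  rw [eSeries, eSeries]
  refine List.Perm.prod_eq' (Equiv.Perm.ofFn_comp_perm σ fun j =>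
    1 - PowerSeries.X * PowerSeries.C (x j)) ?_
  rw [List.pairwise_ofFn]
  intro i j _
  refine (Commute.one_right _).sub_right (((PowerSeries.commute_X _).mul_right ?_))
  exact ((commute_one_sub (hx (σ j) (σ i))).symm)

/-- Split off the smallest bead `v`, the last tensor factor: `∏ (1 - t y_j)` is the product over the
other factors times `1 - t y_N`. By induction the other factors give configurations with all beads
beyond `v`; keeping `u_v` adds the bead `v`, and raising it gives `R_v`. Only exact straightening
rules enter. -/
theorem coeff_eSeries_beadTens_sub_mem {n : ℕ} (hn : 1 ≤ n) {s : ℤ} {m : ℕ} (B : Finset ℤ) :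
    ∀ N : ℕ, B.card = N → (∀ b ∈ B, s ≤ b ∧ b < s + m) → ∀ k : ℕ,
      PowerSeries.coeff k (eSeries fun j : Fin N => (heckeY n j : Module.End K (Tens N)))
        (beadTens N (Finsupp.single B 1)) -
      beadTens N (PowerSeries.coeff k (upSeriesNeg n s m) (Finsupp.single B 1)) ∈
        exactRel n N := by
  induction B using Finset.induction_on_min with
  | empty =>
    intro N hN _ k
    obtain rfl : N = 0 := by rw [← hN, Finset.card_empty]
    cases k with
    | zero =>
      rw [coeff_zero_eSeries, coeff_zero_upSeriesNeg]
      simp only [Module.End.one_apply, sub_self]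
      exact Submodule.zero_mem _
    | succ k =>
      rw [coeff_upSeriesNeg_eq_zero (u := 0) m k (single_mem_confIn (by simp)), map_zero, sub_zero]
      simp only [eSeries, List.ofFn_zero, List.prod_nil, PowerSeries.coeff_one]
      rw [if_neg (by omega)]
      exact Submodule.zero_mem _
  | insert v C hv ih =>
    intro N hN hB k
    have hvC : v ∉ C := fun h => lt_irrefl _ (hv v h)
    rw [Finset.card_insert_of_notMem hvC] at hN
    subst hN
    cases k with
    | zero =>
      rw [coeff_zero_eSeries, coeff_zero_upSeriesNeg]
      simp only [Module.End.one_apply, sub_self]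
      exact Submodule.zero_mem _
    | succ k =>
      have hvs := hB v (Finset.mem_insert_self _ _)
      have hC : ∀ b ∈ C, s ≤ b ∧ b < s + m := fun b hb => hB b (Finset.mem_insert_of_mem hb)
      have hmem : (Finsupp.single C 1 : Conf) ∈ confIn (v + 1) (s + m) :=
        single_mem_confIn fun b hb => ⟨by have := hv b hb; omega, (hC b hb).2⟩
      have h1 := snocTens_mem_exactRel v (ih _ rfl hC (k + 1))
      have h2 := snocTens_mem_exactRel (v + n) (ih _ rfl hC k)
      have h3 := snocTens_add_beadTens_sub_mem (N := C.card) hn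
        (Raises.upSeriesNeg n s m k _ _ _ hmem)
      rw [map_sub, snocTens_beadTens (Raises.upSeriesNeg n s m (k + 1) _ _ _ hmem)] at h1
      rw [map_sub] at h2
      rw [← addBead_single, coeff_upSeriesNeg_addBead hvs.1 hvs.2 hvs.2 k hmem, map_sub,
        ← snocTens_beadTens hmem, coeff_succ_eSeries_last, LinearMap.sub_apply,
        Module.End.mul_apply, heckeY_last_snocTens,
        coeff_eSeries_intertwine (snocTens C.card v) (fun j => heckeY n j) _
          (fun j w => heckeY_castSucc_snocTens j v w),
        coeff_eSeries_intertwine (snocTens C.card (v + n)) (fun j => heckeY n j) _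
          (fun j w => heckeY_castSucc_snocTens j (v + n) w)]
      convert Submodule.sub_mem _ h1 (Submodule.add_mem _ h2 h3) using 1
      abel

/-! ### Complete symmetric functions of the `y_j` -/

/-- If the elementary symmetric functions of `x` act on configurations by the `1 - t R_x`, then
the complete symmetric functions act by the `1 + t R_x`. -/
theorem hComplete_apply_sub_mem {n : ℕ} (hn : 1 ≤ n) {s : ℤ} {m N : ℕ}
    {J : Submodule K (Tens N)} {x : Fin N → Module.End K (Tens N)}
    (hx : ∀ i j, Commute (x i) (x j)) {p : Conf →ₗ[K] Tens N}
    (he : ∀ (k : ℕ) (w : Conf), w ∈ confIn s (s + m) →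
      PowerSeries.coeff k (eSeries x) (p w) - p (PowerSeries.coeff k (upSeriesNeg n s m) w) ∈ J)
    (hJ : ∀ (k : ℕ) (w : Tens N), w ∈ J → hComplete x k w ∈ J) (k : ℕ) :
    ∀ (u : ℤ) (w : Conf), w ∈ confIn s u → u + k * n ≤ s + m →
      hComplete x k (p w) - p (PowerSeries.coeff k (upSeries n s m) w) ∈ J := by
  induction k using Nat.strong_induction_on with
  | _ k ih =>
  intro u w hw hu
  rcases Nat.eq_zero_or_pos k with rfl | hk
  · rw [hComplete_zero, coeff_zero_upSeries]
    simp only [Module.End.one_apply, sub_self]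
    exact Submodule.zero_mem _
  -- Compare the coefficients of `t^k` in `H E = 1` for the `y`-type operators and for the bead
  -- operators. The term with `j = 0` is the one sought; the others involve `h_i` with `i < k`.
  have h1 := congrArg
    (fun F : PowerSeries (Module.End K (Tens N)) => PowerSeries.coeff k F (p w)) (hSeries_mul_eSeries x hx)
  have h2 := congrArg
    (fun F : PowerSeries (Module.End K Conf) => p (PowerSeries.coeff k F w)) (upSeries_mul_upSeriesNeg hn s m)
  simp only [PowerSeries.coeff_mul, PowerSeries.coeff_one, if_neg hk.ne', LinearMap.sum_apply,
    LinearMap.zero_apply, map_zero, map_sum, Module.End.mul_apply] at h1 h2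
  have hmem : (k, 0) ∈ Finset.HasAntidiagonal.antidiagonal k := by
    rw [Finset.HasAntidiagonal.mem_antidiagonal, add_zero]
  rw [← Finset.add_sum_erase _ _ hmem] at h1 h2
  simp only [hSeries, PowerSeries.coeff_mk, coeff_zero_eSeries, coeff_zero_upSeriesNeg,
    Module.End.one_apply] at h1 h2
  rw [eq_neg_of_add_eq_zero_left h1, eq_neg_of_add_eq_zero_left h2, neg_sub_neg,
    ← Finset.sum_sub_distrib]
  refine Submodule.sum_mem _ fun ij hij => ?_
  obtain ⟨i, j⟩ := ij
  obtain ⟨hne, hij⟩ := Finset.mem_erase.mp hij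
  rw [Finset.HasAntidiagonal.mem_antidiagonal] at hij
  simp only at hij
  have hj : j ≠ 0 := by
    rintro rfl
    exact hne (by simp [← hij])
  have h3 := Raises.upSeriesNeg n s m j _ _ _ hw
  -- Having raised beads by up to `j n`, the `j`-th coefficient leaves room for a further `i n`;
  -- this is what the bound on `u` provides for.
  have hu' : u + (j : ℤ) * n + i * n ≤ s + m := by
    rw [← hij] at hu
    push_cast at hu
    linarith
  have h4 := ih i (by omega) _ _ h3 hu'
  have hu'' : u ≤ s + m := by nlinarith [hu]
  -- The error made in `e_j` is carried through `h_i`, which requires `h_i` to preserve the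
  -- relations.
  have h5 := hJ i _ (he j w (confIn_mono le_rfl hu'' hw))
  rw [map_sub] at h5
  rw [← neg_mem_iff]
  convert Submodule.add_mem _ h4 h5 using 1
  abel

/-- The configurations with `c` beads. -/
def confCard (c : ℕ) : Submodule K Conf := Finsupp.supported K K {B | B.card = c}

theorem confCard_le_iff {c : ℕ} {P : Submodule K Conf} :
    confCard c ≤ P ↔ ∀ B : Finset ℤ, B.card = c → Finsupp.single B 1 ∈ P := by
  rw [confCard, Finsupp.supported_eq_span_single, Submodule.span_le]
  exact ⟨fun h B hB => h ⟨B, hB, rfl⟩, by rintro h _ ⟨B, hB, rfl⟩; exact h B hB⟩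

theorem beadUp_mem_confCard (n : ℕ) (x : ℤ) {c : ℕ} {w : Conf} (hw : w ∈ confCard c) :
    beadUp n x w ∈ confCard c := by
  suffices h : confCard c ≤ (confCard c).comap (beadUp n x) from h hw
  refine confCard_le_iff.mpr fun B hB => ?_
  rw [Submodule.mem_comap, beadUp_single]
  split_ifs with h
  · refine Submodule.smul_mem _ _ (Finsupp.single_mem_supported K 1 ?_)
    change (insert (x + n) (B.erase x)).card = c
    rw [Finset.card_insert_of_notMem fun h' => h.2 (Finset.mem_of_mem_erase h'),
      Finset.card_erase_add_one h.1, hB]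
  · exact Submodule.zero_mem _

theorem coeff_upSeriesNeg_mem_confCard (n : ℕ) (s : ℤ) (m k : ℕ) {c : ℕ} {w : Conf}
    (hw : w ∈ confCard c) : PowerSeries.coeff k (upSeriesNeg n s m) w ∈ confCard c := by
  induction m generalizing k w with
  | zero =>
    rw [upSeriesNeg, PowerSeries.coeff_one]
    split_ifs
    · exact hw
    · exact Submodule.zero_mem _
  | succ m ih =>
    cases k with
    | zero => rw [coeff_zero_upSeriesNeg]; exact hw
    | succ k =>
      rw [coeff_succ_upSeriesNeg, LinearMap.sub_apply, Module.End.mul_apply]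
      exact Submodule.sub_mem _ (ih _ hw) (ih _ (beadUp_mem_confCard n _ hw))

theorem beadTens_eq_zero {N c : ℕ} (h : c ≠ N) {w : Conf} (hw : w ∈ confCard c) :
    beadTens N w = 0 := by
  suffices h' : confCard c ≤ LinearMap.ker (beadTens N) from h' hw
  exact confCard_le_iff.mpr fun B hB => beadTens_single_of_ne (hB ▸ h)

/-- Bead moves preserve the number of beads, so configurations with the wrong number contribute zero
on both sides. -/
theorem coeff_eSeries_heckeY_sub_mem {n : ℕ} (hn : 1 ≤ n) {s : ℤ} {m : ℕ} (N k : ℕ) {w : Conf}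
    (hw : w ∈ confIn s (s + m)) :
    PowerSeries.coeff k (eSeries fun j : Fin N => (heckeY n j : Module.End K (Tens N)))
        (beadTens N w) - beadTens N (PowerSeries.coeff k (upSeriesNeg n s m) w) ∈
      exactRel n N := by
  let F : Conf →ₗ[K] Tens N := (PowerSeries.coeff k
    (eSeries fun j : Fin N => (heckeY n j : Module.End K (Tens N)))).comp (beadTens N) -
    (beadTens N).comp (PowerSeries.coeff k (upSeriesNeg n s m))
  suffices h : confIn s (s + m) ≤ (exactRel n N).comap F from h hw
  refine confIn_le_iff.mpr fun B hB => ?_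
  by_cases hc : B.card = N
  · exact coeff_eSeries_beadTens_sub_mem hn B N hc hB k
  · have h1 : (Finsupp.single B 1 : Conf) ∈ confCard B.card := Finsupp.single_mem_supported K 1 rfl
    have h2 := beadTens_eq_zero hc (coeff_upSeriesNeg_mem_confCard n s m k h1)
    change PowerSeries.coeff k
      (eSeries fun j : Fin N => (heckeY n j : Module.End K (Tens N)))
        (beadTens N (Finsupp.single B 1)) -
        beadTens N (PowerSeries.coeff k (upSeriesNeg n s m) (Finsupp.single B 1)) ∈ exactRel n N
    rw [h2, beadTens_eq_zero hc h1, map_zero, sub_zero]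
    exact Submodule.zero_mem _

/-! ### Reflection -/

/-- The reflection of configurations. -/
def negConf : Conf →ₗ[K] Conf := Finsupp.lmapDomain K K (Finset.image fun b => -b)

theorem negConf_single (B : Finset ℤ) :
    negConf (Finsupp.single B 1) = Finsupp.single (B.image fun b => -b) 1 := by
  simp [negConf, Finsupp.mapDomain_single]

theorem mem_image_neg {B : Finset ℤ} {x : ℤ} : x ∈ B.image (fun b => -b) ↔ -x ∈ B := by
  rw [Finset.mem_image]
  constructor
  · rintro ⟨b, hb, rfl⟩; rwa [neg_neg]
  · exact fun h => ⟨-x, h, neg_neg x⟩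

theorem image_neg_image_neg (B : Finset ℤ) : (B.image fun b => -b).image (fun b => -b) = B := by
  ext x
  rw [mem_image_neg, mem_image_neg, neg_neg]

theorem negConf_negConf (w : Conf) : negConf (negConf w) = w := by
  suffices e : negConf.comp negConf = LinearMap.id from LinearMap.congr_fun e w
  refine conf_hom_ext fun B => ?_
  rw [LinearMap.comp_apply, negConf_single, negConf_single, image_neg_image_neg, LinearMap.id_apply]

/-- The reflection of sequences. -/
def negSeq {N : ℕ} (a : Fin N → ℤ) : Fin N → ℤ := fun j => -a j.rev

/-- The reflection of tensors. -/
def negTens (N : ℕ) : Tens N →ₗ[K] Tens N := Finsupp.lmapDomain K K negSeq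

theorem negTens_single {N : ℕ} (a : Fin N → ℤ) :
    negTens N (Finsupp.single a 1) = Finsupp.single (negSeq a) 1 := Finsupp.mapDomain_single

theorem negTens_beadTens (N : ℕ) (w : Conf) :
    negTens N (beadTens N w) = beadTens N (negConf w) := by
  suffices e : (negTens N).comp (beadTens N) = (beadTens N).comp negConf from
    LinearMap.congr_fun e w
  refine conf_hom_ext fun B => ?_
  rw [LinearMap.comp_apply, LinearMap.comp_apply, negConf_single]
  have hcard : (B.image fun b => -b).card = B.card := Finset.card_image_of_injective _ neg_injective
  by_cases h : B.card = N
  · have hb : StrictAnti (negSeq (descSeq B h)) := fun i j hij =>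
      neg_lt_neg (descSeq_strictAnti B h (Fin.rev_lt_rev.mpr hij))
    rw [beadTens_single h, negTens_single, ← beadTens_image hb]
    congr 2
    ext x
    rw [mem_image_neg, ← Finset.ext_iff.mp (image_descSeq B h) (-x), Finset.mem_image,
      Finset.mem_image]
    constructor
    · rintro ⟨j, -, hj⟩
      exact ⟨j.rev, Finset.mem_univ _, by rw [← hj, negSeq, neg_neg]⟩
    · rintro ⟨j, -, hj⟩
      exact ⟨j.rev, Finset.mem_univ _, by rw [negSeq, Fin.rev_rev, hj, neg_neg]⟩
  · rw [beadTens_single_of_ne h, beadTens_single_of_ne (by rwa [hcard]), map_zero]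

/-- Negating the values and reversing the places keeps an ascending neighbouring pair ascending with
the same gap. -/
theorem negTens_mem_exactRel {n N : ℕ} {w : Tens N} (h : w ∈ exactRel n N) :
    negTens N w ∈ exactRel n N := by
  suffices e : exactRel n N ≤ (exactRel n N).comap (negTens N) from e h
  have key : ∀ i : Fin (N - 1), ∃ i' : Fin (N - 1), (lo i').rev = hi i ∧ (hi i').rev = lo i :=
    fun i => ⟨⟨N - 2 - i, by omega⟩, by simp only [Fin.ext_iff, Fin.val_rev, lo, hi]; omega,
      by simp only [Fin.ext_iff, Fin.val_rev, lo, hi]; omega⟩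
  have key2 : ∀ (i i' : Fin (N - 1)) (a : Fin N → ℤ), (lo i').rev = hi i → (hi i').rev = lo i →
      negSeq (a ∘ adj i) = negSeq a ∘ adj i' := by
    intro i i' a h1 h2
    funext s
    simp only [negSeq, Function.comp_apply]
    by_cases e1 : s = lo i'
    · subst e1; rw [h1, adj_lo, adj_hi, h2]
    by_cases e2 : s = hi i'
    · subst e2; rw [h2, adj_lo, adj_hi, h1]
    rw [adj_of_ne e1 e2, adj_of_ne]
    · rw [← h2]; exact fun h => e2 (Fin.rev_injective h)
    · rw [← h1]; exact fun h => e1 (Fin.rev_injective h)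
  refine exactRel_le (fun i a h h' => ?_) fun i a h => ?_
  · obtain ⟨i', h1, h2⟩ := key i
    rw [Submodule.mem_comap, map_add, map_smul, negTens_single, negTens_single, key2 i i' a h1 h2]
    refine swap_mem_exactRel i' ?_ ?_ <;> simp only [negSeq, h1, h2] <;> omega
  · obtain ⟨i', h1, h2⟩ := key i
    rw [Submodule.mem_comap, negTens_single]
    refine single_mem_exactRel i' ?_
    simp only [negSeq, h1, h2, h]

theorem heckeYInv_negTens {n N : ℕ} (j : Fin N) (w : Tens N) :
    heckeYInv n j (negTens N w) = negTens N (heckeY n j.rev w) := by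
  suffices e : (heckeYInv n j).comp (negTens N) = (negTens N).comp (heckeY n j.rev) from
    LinearMap.congr_fun e w
  refine tens_hom_ext_single fun a => ?_
  rw [LinearMap.comp_apply, LinearMap.comp_apply, negTens_single, heckeYInv_single, heckeY_single,
    negTens_single]
  congr 1
  funext s
  simp only [negSeq, Pi.sub_apply, Pi.add_apply, Pi.single_apply, Fin.rev_inj]
  ring

/-- Reflection turns the `y_j⁻¹` into the `y_j` in reversed order, and the order of commuting
factors is immaterial. -/
theorem coeff_eSeries_heckeYInv_sub_mem {n : ℕ} (hn : 1 ≤ n) {s : ℤ} {m : ℕ} (N k : ℕ) {w : Conf}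
    (hw : w ∈ confIn s (s + m)) :
    PowerSeries.coeff k (eSeries fun j : Fin N => (heckeYInv n j : Module.End K (Tens N)))
        ((beadTens N).comp negConf w) -
        (beadTens N).comp negConf (PowerSeries.coeff k (upSeriesNeg n s m) w) ∈
      exactRel n N := by
  have h := negTens_mem_exactRel (coeff_eSeries_heckeY_sub_mem hn N k hw)
  rw [map_sub, negTens_beadTens, ← eSeries_comp_perm
    (fun j : Fin N => (heckeY n j : Module.End K (Tens N)))
    (fun i j => heckeY_comm n i j) Fin.revPerm] at h
  have h2 := coeff_eSeries_intertwine (negTens N)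
    ((fun j : Fin N => (heckeY n j : Module.End K (Tens N))) ∘ Fin.revPerm)
    (fun j : Fin N => (heckeYInv n j : Module.End K (Tens N)))
    (fun j w => heckeYInv_negTens j w) k (beadTens N w)
  rw [← h2, negTens_beadTens] at h
  exact h

/-! ### Transposition -/

/-- The pairing for which the basis vectors are orthonormal. -/
def dotPair (ι : Type*) : (ι →₀ K) →ₗ[K] (ι →₀ K) →ₗ[K] K :=
  Finsupp.linearCombination K fun B => (Finsupp.lapply B : (ι →₀ K) →ₗ[K] K)

theorem dotPair_single {ι : Type*} (B : ι) (w : ι →₀ K) :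
    dotPair ι (Finsupp.single B 1) w = w B := by
  simp [dotPair]

theorem dotPair_single_right {ι : Type*} (B : ι) (w : ι →₀ K) :
    dotPair ι w (Finsupp.single B 1) = w B := by
  suffices e : (dotPair ι).flip (Finsupp.single B 1) = Finsupp.lapply B from
    LinearMap.congr_fun e w
  refine Finsupp.lhom_ext' fun C => LinearMap.ext_ring ?_
  change dotPair ι (Finsupp.single C 1) (Finsupp.single B 1) = (Finsupp.single C 1 : ι →₀ K) B
  classical
  rw [dotPair_single, Finsupp.single_apply, Finsupp.single_apply]
  simp only [eq_comm]

/-- `F` and `G` are transposed to each other. -/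
def IsTransposed {ι : Type*} (F G : (ι →₀ K) →ₗ[K] (ι →₀ K)) : Prop :=
  ∀ v w, dotPair ι (F v) w = dotPair ι v (G w)

theorem isTransposed_of_single {ι : Type*} {F G : (ι →₀ K) →ₗ[K] (ι →₀ K)}
    (h : ∀ B C, F (Finsupp.single B 1) C = G (Finsupp.single C 1) B) : IsTransposed F G := by
  intro v w
  suffices e : (dotPair ι).comp F = (dotPair ι).compl₂ G from LinearMap.congr_fun₂ e v w
  refine Finsupp.lhom_ext' fun B => LinearMap.ext_ring ?_
  refine Finsupp.lhom_ext' fun C => LinearMap.ext_ring ?_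
  change dotPair ι (F (Finsupp.single B 1)) (Finsupp.single C 1) =
    dotPair ι (Finsupp.single B 1) (G (Finsupp.single C 1))
  rw [dotPair_single, dotPair_single_right, h]

theorem IsTransposed.apply {ι : Type*} {F G : (ι →₀ K) →ₗ[K] (ι →₀ K)} (h : IsTransposed F G)
    (B C : ι) : F (Finsupp.single B 1) C = G (Finsupp.single C 1) B := by
  rw [← dotPair_single_right, h, dotPair_single]

theorem IsTransposed.comp {ι : Type*} {F G F' G' : (ι →₀ K) →ₗ[K] (ι →₀ K)}
    (h : IsTransposed F G) (h' : IsTransposed F' G') : IsTransposed (F ∘ₗ F') (G' ∘ₗ G) :=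
  fun v w => by rw [LinearMap.comp_apply, LinearMap.comp_apply, h, h']

theorem IsTransposed.eq {ι : Type*} {F F' G : (ι →₀ K) →ₗ[K] (ι →₀ K)}
    (h : IsTransposed F G) (h' : IsTransposed F' G) : F = F' := by
  refine Finsupp.lhom_ext' fun B => LinearMap.ext_ring (Finsupp.ext fun C => ?_)
  exact (h.apply B C).trans (h'.apply B C).symm

theorem IsTransposed.add {F G F' G' : Module.End K Conf} (h : IsTransposed F G)
    (h' : IsTransposed F' G') : IsTransposed (F + F') (G + G') := fun v w => by
  rw [LinearMap.add_apply, LinearMap.add_apply, map_add, map_add, LinearMap.add_apply, h, h']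

theorem IsTransposed.mul {F G F' G' : Module.End K Conf} (h : IsTransposed F G)
    (h' : IsTransposed F' G') : IsTransposed (F * F') (G' * G) := h.comp h'

/-- Conjugation by the reflection. -/
def conjNeg (F : Module.End K Conf) : Module.End K Conf := negConf * F * negConf

theorem conjNeg_mul (F G : Module.End K Conf) : conjNeg (F * G) = conjNeg F * conjNeg G := by
  refine LinearMap.ext fun w => ?_
  simp only [conjNeg, Module.End.mul_apply, negConf_negConf]

theorem conjNeg_add (F G : Module.End K Conf) : conjNeg (F + G) = conjNeg F + conjNeg G := by
  refine LinearMap.ext fun w => ?_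
  simp only [conjNeg, Module.End.mul_apply, LinearMap.add_apply, map_add]

/-- The reflected operator moves a bead from `-x` down to `-x - n`, and the transposed one moves it
back up. The beads jumped over are the same, so the matrix coefficients agree. -/
theorem isTransposed_conjNeg_beadUp (n : ℕ) (x : ℤ) :
    IsTransposed (conjNeg (beadUp n x)) (beadUp n (-x - n)) := by
  refine isTransposed_of_single fun B C => ?_
  have hx : -x - (n : ℤ) + n = -x := by ring
  have hnx : -(x + (n : ℤ)) = -x - n := by ring
  rw [conjNeg, Module.End.mul_apply, Module.End.mul_apply, negConf_single, beadUp_single,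
    beadUp_single]
  simp only [mem_image_neg, hx, hnx]
  have himg : (insert (x + n) ((B.image fun b => -b).erase x)).image (fun b => -b) =
      insert (-x - (n : ℤ)) (B.erase (-x)) := by
    ext y
    rw [mem_image_neg, Finset.mem_insert, Finset.mem_insert, Finset.mem_erase, Finset.mem_erase,
      mem_image_neg, neg_neg]
    constructor <;> rintro (h | h) <;> [left; right; left; right] <;>
      first | omega | exact ⟨by have := h.1; omega, h.2⟩
  have hiff : ((-x ∈ B ∧ -x - (n : ℤ) ∉ B) ∧ insert (-x - (n : ℤ)) (B.erase (-x)) = C) ↔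
      ((-x - (n : ℤ) ∈ C ∧ -x ∉ C) ∧ insert (-x) (C.erase (-x - (n : ℤ))) = B) := by
    constructor
    · rintro ⟨⟨h1, h2⟩, rfl⟩
      have hne : -x ≠ -x - (n : ℤ) := fun h => h2 (h ▸ h1)
      refine ⟨⟨Finset.mem_insert_self _ _, ?_⟩, ?_⟩
      · rw [Finset.mem_insert, not_or]
        exact ⟨hne, Finset.notMem_erase _ _⟩
      · rw [Finset.erase_insert fun h => h2 (Finset.mem_of_mem_erase h), Finset.insert_erase h1]
    · rintro ⟨⟨h1, h2⟩, rfl⟩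
      have hne : -x - (n : ℤ) ≠ -x := fun h => h2 (h ▸ h1)
      refine ⟨⟨Finset.mem_insert_self _ _, ?_⟩, ?_⟩
      · rw [Finset.mem_insert, not_or]
        exact ⟨hne, Finset.notMem_erase _ _⟩
      · rw [Finset.erase_insert fun h => h2 (Finset.mem_of_mem_erase h), Finset.insert_erase h1]
  have hl : negConf (if -x ∈ B ∧ -x - (n : ℤ) ∉ B then
      (-q⁻¹) ^ (between n x (B.image fun b => -b)).card •
        Finsupp.single (insert (x + n) ((B.image fun b => -b).erase x)) 1 else 0) C =
      if (-x ∈ B ∧ -x - (n : ℤ) ∉ B) ∧ insert (-x - (n : ℤ)) (B.erase (-x)) = C then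
        (-q⁻¹) ^ (between n x (B.image fun b => -b)).card else 0 := by
    by_cases h : -x ∈ B ∧ -x - (n : ℤ) ∉ B
    · rw [if_pos h, map_smul, negConf_single, himg, Finsupp.smul_apply, Finsupp.single_apply]
      simp only [h, not_false_eq_true, and_self, true_and, smul_eq_mul, mul_ite, mul_one, mul_zero]
    · rw [if_neg h, map_zero, if_neg fun h' => h h'.1]; rfl
  have hr : (if -x - (n : ℤ) ∈ C ∧ -x ∉ C then
      (-q⁻¹) ^ (between n (-x - n) C).card •
        Finsupp.single (insert (-x) (C.erase (-x - (n : ℤ)))) 1 else 0 : Conf) B =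
      if (-x - (n : ℤ) ∈ C ∧ -x ∉ C) ∧ insert (-x) (C.erase (-x - (n : ℤ))) = B then
        (-q⁻¹) ^ (between n (-x - n) C).card else 0 := by
    by_cases h : -x - (n : ℤ) ∈ C ∧ -x ∉ C
    · rw [if_pos h, Finsupp.smul_apply, Finsupp.single_apply]
      simp only [h, not_false_eq_true, and_self, true_and, smul_eq_mul, mul_ite, mul_one, mul_zero]
    · rw [if_neg h, if_neg fun h' => h h'.1]; rfl
  rw [hl, hr]
  by_cases h : (-x ∈ B ∧ -x - (n : ℤ) ∉ B) ∧ insert (-x - (n : ℤ)) (B.erase (-x)) = C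
  · rw [if_pos h, if_pos (hiff.mp h)]
    congr 1
    refine Finset.card_bij' (fun b _ => -b) (fun b _ => -b) (fun b hb => ?_) (fun b hb => ?_)
      (fun b _ => neg_neg b) (fun b _ => neg_neg b)
    · rw [between, Finset.mem_filter, mem_image_neg] at hb
      rw [between, Finset.mem_filter, ← h.2, Finset.mem_insert, Finset.mem_erase]
      exact ⟨Or.inr ⟨by omega, hb.1⟩, by omega, by omega⟩
    · rw [between, Finset.mem_filter, ← h.2, Finset.mem_insert, Finset.mem_erase] at hb
      rw [between, Finset.mem_filter, mem_image_neg, neg_neg]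
      refine ⟨?_, by omega, by omega⟩
      rcases hb.1 with h' | h'
      · omega
      · exact h'.2
  · rw [if_neg h, if_neg fun h' => h (hiff.mpr h')]

theorem upSeries_succ' (n : ℕ) (s : ℤ) (m : ℕ) :
    upSeries n s (m + 1) = upSeries n (s + 1) m * upFactor n s := by
  induction m with
  | zero => simp [upSeries]
  | succ m ih =>
    rw [upSeries, ih, ← mul_assoc, upSeries]
    congr 3
    push_cast
    ring

/-- Transposition reverses the order of the factors and `x ↦ -x - n` reverses the order of the
positions, so the result is again a product with smaller positions acting first. -/
theorem isTransposed_conjNeg_upSeries (n : ℕ) (s : ℤ) (m k : ℕ) :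
    IsTransposed (conjNeg (PowerSeries.coeff k (upSeries n s m)))
      (PowerSeries.coeff k (upSeries n (-s - n - m + 1) m)) := by
  induction m generalizing k with
  | zero =>
    rw [upSeries, upSeries, PowerSeries.coeff_one]
    split_ifs
    · refine fun v w => ?_
      rw [conjNeg, Module.End.mul_apply, Module.End.mul_apply]
      simp only [Module.End.one_apply, negConf_negConf]
    · refine fun v w => ?_
      rw [conjNeg, mul_zero, zero_mul]
      simp
  | succ m ih =>
    cases k with
    | zero =>
      rw [coeff_zero_upSeries, coeff_zero_upSeries]
      refine fun v w => ?_
      rw [conjNeg, Module.End.mul_apply, Module.End.mul_apply]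
      simp only [Module.End.one_apply, negConf_negConf]
    | succ k =>
      rw [coeff_succ_upSeries, upSeries_succ', upFactor, mul_add, mul_one, map_add,
        coeff_succ_mul_X_mul_C, conjNeg_add, conjNeg_mul,
        show -s - (n : ℤ) - ((m + 1 : ℕ) : ℤ) + 1 + 1 = -s - n - m + 1 by push_cast; ring,
        show -s - (n : ℤ) - ((m + 1 : ℕ) : ℤ) + 1 = -(s + m) - n by push_cast; ring]
      exact (ih (k + 1)).add ((isTransposed_conjNeg_beadUp n _).mul (ih k))

/-! ### Ribbons as paths -/

/-- The content of a cell. -/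
def content (c : ℕ × ℕ) : ℤ := (c.2 : ℤ) - c.1

/-- Paths with `n` cells whose steps go to the next row or to the previous column. -/
def IsPath (n : ℕ) (p : ℕ → ℕ × ℕ) : Prop :=
  ∀ j, j + 1 < n →
    ((p (j + 1)).1 = (p j).1 + 1 ∧ (p (j + 1)).2 = (p j).2) ∨
    ((p (j + 1)).1 = (p j).1 ∧ (p (j + 1)).2 + 1 = (p j).2)

theorem mem_tilings {n k : ℕ} {al be : YoungDiagram} {P : Finset (Finset (ℕ × ℕ))} :
    P ∈ tilings n k al be ↔ al ≤ be ∧ P.card = k ∧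
      (P : Set (Finset (ℕ × ℕ))).PairwiseDisjoint id ∧
      P.biUnion id = be.cells \ al.cells ∧
      ∀ R ∈ P, ∃ p, (p 0).1 = al.colLen (p 0).2 ∧ IsPath n p ∧ R = (Finset.range n).image p := by
  simp only [tilings, Finset.mem_filter]
  constructor
  · rintro ⟨-, h1, h2, h3, h4, h5⟩
    refine ⟨h1, h2, h3, h4, fun R hR => ?_⟩
    obtain ⟨c, ⟨p, rfl, hp, hR⟩, hc⟩ := h5 R hR
    exact ⟨p, hc, hp, hR⟩
  · rintro ⟨h1, h2, h3, h4, h5⟩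
    refine ⟨?_, h1, h2, h3, h4, fun R hR => ?_⟩
    · rw [Finset.mem_powerset]
      intro R hR
      rw [Finset.mem_powerset, ← h4]
      exact Finset.subset_biUnion_of_mem id hR
    · obtain ⟨p, hc, hp, hR⟩ := h5 R hR
      exact ⟨p 0, ⟨p, rfl, hp, hR⟩, hc⟩

theorem IsPath.content_eq {n : ℕ} {p : ℕ → ℕ × ℕ} (hp : IsPath n p) {j : ℕ} (hj : j < n) :
    content (p j) = content (p 0) - j := by
  induction j with
  | zero => simp
  | succ j ih =>
    have h1 := ih (by omega)
    have h2 := hp j hj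
    simp only [content] at h1 ⊢
    push_cast
    omega

theorem IsPath.row_le {n : ℕ} {p : ℕ → ℕ × ℕ} (hp : IsPath n p) {j : ℕ} (hj : j + 1 < n) :
    (p j).1 ≤ (p (j + 1)).1 ∧ (p (j + 1)).1 ≤ (p j).1 + 1 := by
  have := hp j hj
  omega

theorem cell_ext {c d : ℕ × ℕ} (h : c.1 = d.1) (h' : content c = content d) : c = d := by
  simp only [content] at h'
  exact Prod.ext h (by omega)

/-- Each step lowers the content by one, so a ribbon meets each diagonal at most once. -/
theorem IsPath.eq_of_content_eq {n : ℕ} {p : ℕ → ℕ × ℕ} (hp : IsPath n p) {c : ℕ × ℕ}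
    (hc : c ∈ (Finset.range n).image p) {j : ℕ} (hj : j < n) (h : content c = content (p j)) :
    c = p j := by
  obtain ⟨i, hi', rfl⟩ := Finset.mem_image.mp hc
  rw [Finset.mem_range] at hi'
  rw [hp.content_eq hi', hp.content_eq hj] at h
  rw [show i = j by omega]

theorem IsPath.content_mem {n : ℕ} {p : ℕ → ℕ × ℕ} (hp : IsPath n p) {c : ℕ × ℕ}
    (hc : c ∈ (Finset.range n).image p) :
    content (p 0) - n < content c ∧ content c ≤ content (p 0) := by
  obtain ⟨i, hi', rfl⟩ := Finset.mem_image.mp hc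
  rw [Finset.mem_range] at hi'
  rw [hp.content_eq hi']
  omega

theorem mem_of_lt_colLen {al : YoungDiagram} {c : ℕ × ℕ} (h : c.1 < al.colLen c.2) : c ∈ al :=
  YoungDiagram.mem_iff_lt_colLen.mpr h

/-- A ribbon whose initial cell is at the bottom of its column lies below every disjoint ribbon
whose initial cell is on a diagonal further to the right. -/
theorem IsPath.row_lt {n : ℕ} {al : YoungDiagram} {p p' : ℕ → ℕ × ℕ} (hp : IsPath n p)
    (hp' : IsPath n p') (hal : ∀ j < n, p j ∉ al) (hhead : (p' 0).1 = al.colLen (p' 0).2)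
    (hdisj : ∀ i < n, ∀ j < n, p i ≠ p' j) {t : ℕ} (ht : content (p' 0) + t = content (p 0)) :
    ∀ j, t + j < n → (p' j).1 < (p (t + j)).1 := by
  have hcont : ∀ j, t + j < n → content (p (t + j)) = content (p' j) := fun j hj => by
    rw [hp.content_eq hj, hp'.content_eq (by omega)]
    push_cast
    omega
  intro j
  induction j with
  | zero =>
    intro hj
    have h1 := hcont 0 hj
    have h2 : (p t).1 ≠ (p' 0).1 := fun h => hdisj t hj 0 (by omega) (cell_ext h h1)
    -- Otherwise `p t` would lie weakly below and to the left of the cell under the initial cell of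
    -- `p'`, and so in `al`.
    by_contra! h3
    rw [add_zero] at h3 h1
    have h4 : ((p' 0).1 - 1, (p' 0).2) ∈ al := mem_of_lt_colLen (by simp only; omega)
    refine hal t hj (al.isLowerSet (a := ((p' 0).1 - 1, (p' 0).2)) ?_ h4)
    simp only [content] at h1
    rw [Prod.le_def]
    simp only
    omega
  | succ j ih =>
    intro hj
    have h1 := ih (by omega)
    have h2 := (hp'.row_le (j := j) (by omega)).2
    have h3 := (hp.row_le (j := t + j) (by omega)).1
    have h4 := hcont (j + 1) hj
    -- Both paths descend one diagonal per step and rise by at most one row, so to change sides they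
    -- would have to share a cell.
    have h5 : (p (t + (j + 1))).1 ≠ (p' (j + 1)).1 :=
      fun h => hdisj _ hj (j + 1) (by omega) (cell_ext h h4)
    rw [show t + j + 1 = t + (j + 1) by ring] at h3
    omega

/-- In a tiling, the ribbon whose initial cell has maximal content is removable. -/
theorem removable {n k : ℕ} {al be : YoungDiagram} {P : Finset (Finset (ℕ × ℕ))}
    (hP : P ∈ tilings n k al be) {p : ℕ → ℕ × ℕ} (hp : IsPath n p)
    (hR : (Finset.range n).image p ∈ P)
    (hmax : ∀ c ∈ be.cells \ al.cells, content c ≤ content (p 0)) {j : ℕ} (hj : j < n) :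
    (((p j).1 + 1, (p j).2) ∈ be → ((p j).1 + 1, (p j).2) ∈ (Finset.range n).image p) ∧
    (((p j).1, (p j).2 + 1) ∈ be → ((p j).1, (p j).2 + 1) ∈ (Finset.range n).image p) := by
  obtain ⟨-, -, hdisj, hU, hrib⟩ := mem_tilings.mp hP
  have hmem : ∀ R ∈ P, ∀ c ∈ R, c ∈ be.cells \ al.cells := fun R hR c hc => by
    rw [← hU]; exact Finset.mem_biUnion.mpr ⟨R, hR, hc⟩
  have hpal : ∀ j < n, p j ∉ al := fun j hj h => by
    have := hmem _ hR (p j) (Finset.mem_image_of_mem _ (Finset.mem_range.mpr hj))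
    rw [Finset.mem_sdiff] at this
    exact this.2 h
  have key : ∀ e : ℕ × ℕ, p j ≤ e → e ∈ be → e ∉ (Finset.range n).image p →
      ∃ p' : ℕ → ℕ × ℕ, ∃ j' < n, ∃ t : ℕ, p' j' = e ∧ IsPath n p' ∧
        (p' 0).1 = al.colLen (p' 0).2 ∧ content (p' 0) + t = content (p 0) ∧
        ∀ i, t + i < n → (p' i).1 < (p (t + i)).1 := by
    intro e hle he hne
    have he2 : e ∈ be.cells \ al.cells := by
      rw [Finset.mem_sdiff]
      exact ⟨he, fun h => hpal j hj (al.isLowerSet hle h)⟩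
    rw [← hU, Finset.mem_biUnion] at he2
    obtain ⟨R', hR', he3⟩ := he2
    obtain ⟨p', hc', hp', rfl⟩ := hrib R' hR'
    obtain ⟨j', hj', rfl⟩ := Finset.mem_image.mp he3
    rw [Finset.mem_range] at hj'
    have hne' : (Finset.range n).image p ≠ (Finset.range n).image p' := fun h => hne (h ▸ he3)
    have hd := hdisj hR hR' hne'
    have h0 := hmax (p' 0) (hmem _ hR' _ (Finset.mem_image_of_mem _ (Finset.mem_range.mpr
      (by omega))))
    obtain ⟨t, ht⟩ := Int.eq_ofNat_of_zero_le (sub_nonneg.mpr h0)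
    refine ⟨p', j', hj', t, rfl, hp', hc', by omega, hp.row_lt hp' hpal hc' ?_ (by omega)⟩
    intro i hi' i' hi'' h
    refine Finset.disjoint_left.mp hd
      (Finset.mem_image_of_mem _ (Finset.mem_range.mpr hi')) ?_
    rw [h]
    exact Finset.mem_image_of_mem _ (Finset.mem_range.mpr hi'')
  constructor
  · intro he
    by_contra hne
    obtain ⟨p', j', hj', t, e, hp', hc', ht, hlt⟩ := key _
      (by rw [Prod.le_def]; simp) he hne
    have e1 : (p' j').1 = (p j).1 + 1 := by rw [e]
    have e2 : content (p' j') = content (p j) - 1 := by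
      rw [e]; simp only [content]; push_cast; ring
    rw [hp'.content_eq hj', hp.content_eq hj] at e2
    -- If `p` continues to this diagonal, its next cell would have to lie above the neighbour, more
    -- than one row up. If `p` ends at `p j`, then either the neighbour is the initial cell of its
    -- ribbon, forcing `p j` into `al`, or the preceding cell of that ribbon lies below `p j`, too
    -- low to be followed by the neighbour.
    rcases Nat.lt_or_ge (j + 1) n with h | h
    · have h1 := hlt j' (by omega)
      rw [show t + j' = j + 1 by omega] at h1
      have := (hp.row_le h).2
      omega
    · rcases Nat.eq_zero_or_pos j' with rfl | hj0
      · refine hpal j hj ?_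
        have h2 : (p' 0).2 = (p j).2 := by rw [e]
        rw [← Prod.mk.eta (p := p j)]
        refine mem_of_lt_colLen ?_
        simp only
        rw [← h2, ← hc']
        omega
      · have h1 := hlt (j' - 1) (by omega)
        rw [show t + (j' - 1) = j by omega] at h1
        have h2 := (hp'.row_le (j := j' - 1) (by omega)).2
        rw [show j' - 1 + 1 = j' by omega] at h2
        omega
  · intro he
    by_contra hne
    obtain ⟨p', j', hj', t, e, hp', hc', ht, hlt⟩ := key _
      (by rw [Prod.le_def]; simp) he hne
    have e1 : (p' j').1 = (p j).1 := by rw [e]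
    have e2 : content (p' j') = content (p j) + 1 := by
      rw [e]; simp only [content]; push_cast; ring
    rw [hp'.content_eq hj', hp.content_eq hj] at e2
    -- The cell of `p` preceding `p j` shares the diagonal of the right-hand neighbour and would lie
    -- strictly above it, although rows never decrease along `p`.
    have h1 := hlt j' (by omega)
    have h2 := (hp.row_le (j := t + j') (by omega)).1
    rw [show t + j' + 1 = j by omega] at h2
    omega

/-- In a tiling, the initial cells have distinct contents. -/
theorem eq_of_content_head_eq {n k : ℕ} (hn : 1 ≤ n) {al be : YoungDiagram}
    {P : Finset (Finset (ℕ × ℕ))}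
    (hP : P ∈ tilings n k al be) {p p' : ℕ → ℕ × ℕ} (hp : IsPath n p) (hp' : IsPath n p')
    (hR : (Finset.range n).image p ∈ P) (hR' : (Finset.range n).image p' ∈ P)
    (hc : (p 0).1 = al.colLen (p 0).2) (hc' : (p' 0).1 = al.colLen (p' 0).2)
    (h : content (p' 0) = content (p 0)) :
    (Finset.range n).image p = (Finset.range n).image p' := by
  obtain ⟨-, -, hdisj, hU, hrib⟩ := mem_tilings.mp hP
  by_contra hne
  have hd := hdisj hR hR' hne
  have hal : ∀ p : ℕ → ℕ × ℕ, (Finset.range n).image p ∈ P → ∀ j < n, p j ∉ al :=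
    fun p hR j hj h => by
      have : p j ∈ be.cells \ al.cells := by
        rw [← hU]
        exact Finset.mem_biUnion.mpr
          ⟨_, hR, Finset.mem_image_of_mem _ (Finset.mem_range.mpr hj)⟩
      rw [Finset.mem_sdiff] at this
      exact this.2 h
  have hd' : ∀ i < n, ∀ j < n, p i ≠ p' j := fun i hi' i' hi'' h => by
    refine Finset.disjoint_left.mp hd
      (Finset.mem_image_of_mem _ (Finset.mem_range.mpr hi')) ?_
    rw [h]
    exact Finset.mem_image_of_mem _ (Finset.mem_range.mpr hi'')
  -- With equal initial diagonals each ribbon would lie strictly below the other one.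
  have h1 := hp.row_lt hp' (hal p hR) hc' hd' (t := 0) (by simpa using h) 0 (by omega)
  have h2 := hp'.row_lt hp (hal p' hR') hc (fun i hi' j hj h => hd' j hj i hi' h.symm) (t := 0)
    (by simpa using h.symm) 0 (by omega)
  simp only [add_zero] at h1 h2
  omega

/-! ### Young diagrams and beads -/

/-- The beads of a Young diagram with at most `M` rows. -/
def beads (M : ℕ) (lam : YoungDiagram) : Finset ℤ := Finset.univ.image (maya M lam)

/-- The number of beads beyond `d`. -/
def above (B : Finset ℤ) (d : ℤ) : ℕ := (B.filter fun b => d < b).card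

theorem card_beads (M : ℕ) (lam : YoungDiagram) : (beads M lam).card = M :=
  card_image_strictAnti (maya_strictAnti M lam)

theorem neg_lt_of_mem_beads {M : ℕ} {lam : YoungDiagram} {b : ℤ} (h : b ∈ beads M lam) :
    -(M : ℤ) < b := by
  obtain ⟨i, -, rfl⟩ := Finset.mem_image.mp h
  simp only [maya]
  omega

/-- The rows `i` with `λ_i - i > c - r` form an initial segment, and row `r` belongs to it exactly
when `c < λ_r`. So the cells of a diagonal are governed by the number of beads beyond its content.
-/
theorem mem_iff_lt_above {M : ℕ} {lam : YoungDiagram} (h : lam.colLen 0 ≤ M) {c : ℕ × ℕ} :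
    c ∈ lam ↔ c.1 < above (beads M lam) (content c) := by
  obtain ⟨r, c⟩ := c
  have hcard : above (beads M lam) (content (r, c)) =
      (Finset.univ.filter fun i => content (r, c) < maya M lam i).card := by
    rw [above, beads, Finset.filter_image,
      Finset.card_image_of_injective _ (maya_strictAnti M lam).injective]
  rw [hcard]
  by_cases hmem : (r, c) ∈ lam
  · have h1 : r < M := by
      have h2 : (r, 0) ∈ lam := lam.isLowerSet (a := (r, c)) (by rw [Prod.le_def]; simp) hmem
      have := YoungDiagram.mem_iff_lt_colLen.mp h2
      omega
    have h2 : (Finset.univ.filter fun i : Fin M => (i : ℕ) ≤ r) ⊆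
        Finset.univ.filter fun i => content (r, c) < maya M lam i := by
      intro i hi'
      simp only [Finset.mem_filter, Finset.mem_univ, true_and] at hi' ⊢
      have h3 := YoungDiagram.mem_iff_lt_rowLen.mp hmem
      have h4 := lam.rowLen_anti i r hi'
      simp only [content, maya]
      omega
    have h3 : (Finset.univ.filter fun i : Fin M => (i : ℕ) ≤ r).card = r + 1 := by
      rw [show (Finset.univ.filter fun i : Fin M => (i : ℕ) ≤ r) = Finset.Iic ⟨r, h1⟩ by
        ext i; simp [Fin.le_def], Fin.card_Iic]
    have h4 := Finset.card_le_card h2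
    simp only [hmem, true_iff]
    omega
  · have h2 : (Finset.univ.filter fun i => content (r, c) < maya M lam i) ⊆
        Finset.univ.filter fun i : Fin M => (i : ℕ) < r := by
      intro i hi'
      simp only [Finset.mem_filter, Finset.mem_univ, true_and] at hi' ⊢
      by_contra! h3
      have h4 := lam.rowLen_anti r i h3
      refine hmem (YoungDiagram.mem_iff_lt_rowLen.mpr ?_)
      simp only [content, maya] at hi'
      omega
    have h3 : (Finset.univ.filter fun i : Fin M => (i : ℕ) < r).card ≤ r := by
      have := Finset.card_le_card_of_injOn (s := Finset.univ.filter fun i : Fin M => (i : ℕ) < r)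
        (t := Finset.range r) (fun i => (i : ℕ))
        (fun i hi' => by simpa using hi') (fun i _ j _ hij => Fin.ext hij)
      simpa using this
    have h4 := Finset.card_le_card h2
    simp only [hmem, false_iff, not_lt]
    omega

theorem above_sub_one (B : Finset ℤ) (d : ℤ) :
    above B (d - 1) = above B d + if d ∈ B then 1 else 0 := by
  have h : (B.filter fun b => d - 1 < b) =
      (B.filter fun b => d < b) ∪ B.filter fun b => b = d := by
    ext b
    simp only [Finset.mem_filter, Finset.mem_union]
    constructor
    · rintro ⟨h1, h2⟩
      rcases eq_or_ne b d with h | h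
      · exact Or.inr ⟨h1, h⟩
      · exact Or.inl ⟨h1, by omega⟩
    · rintro (⟨h1, h2⟩ | ⟨h1, h2⟩) <;> exact ⟨h1, by omega⟩
  rw [above, h, Finset.card_union_of_disjoint, Finset.filter_eq']
  · rw [above]; split_ifs <;> simp
  · rw [Finset.disjoint_left]
    intro b h1 h2
    rw [Finset.mem_filter] at h1 h2
    omega

/-- Lowering a bead by `n` changes, by one, exactly the counts at the `n` contents that it crosses;
this is the origin of ribbons. -/
theorem above_move {B : Finset ℤ} {n : ℕ} {x : ℤ} (h : x + n ∈ B) (h' : x ∉ B) (d : ℤ) :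
    above (insert x (B.erase (x + n))) d + (if x ≤ d ∧ d < x + n then 1 else 0) = above B d := by
  have hx : x ∉ (B.erase (x + n)).filter fun b => d < b := fun hx =>
    h' (Finset.mem_of_mem_erase (Finset.mem_filter.mp hx).1)
  have hn : x ≠ x + n := fun e => h' (e ▸ h)
  have h1 : ((B.erase (x + n)).filter fun b => d < b).card + (if d < x + n then 1 else 0) =
      above B d := by
    rw [Finset.filter_erase, above]
    split_ifs with hd
    · exact Finset.card_erase_add_one (Finset.mem_filter.mpr ⟨h, hd⟩)
    · rw [Finset.erase_eq_of_notMem fun hm => hd (Finset.mem_filter.mp hm).2, add_zero]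
  have h2 : above (insert x (B.erase (x + n))) d =
      ((B.erase (x + n)).filter fun b => d < b).card + if d < x then 1 else 0 := by
    rw [above, Finset.filter_insert]
    split_ifs with hd
    · exact Finset.card_insert_of_notMem hx
    · rfl
  rw [h2, ← h1, add_assoc]
  congr 1
  split_ifs <;> omega

/-- The beads not beyond `d` lie in `(-M, d]` and miss `x`, so there are at most `M + d - 1` of
them. This keeps the columns of `rimPath` nonnegative, so that `Int.toNat` loses nothing there. -/
theorem one_le_above_add {M : ℕ} {lam : YoungDiagram} {x d : ℤ} (hx : x ∉ beads M lam)
    (hM : -(M : ℤ) < x) (hd : x ≤ d) : 1 ≤ (above (beads M lam) d : ℤ) + d := by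
  have h : (beads M lam).filter (fun b => ¬ d < b) ⊆ (Finset.Ioc (-(M : ℤ)) d).erase x := by
    intro b hb
    rw [Finset.mem_filter] at hb
    have := neg_lt_of_mem_beads hb.1
    rw [Finset.mem_erase, Finset.mem_Ioc]
    exact ⟨fun e => hx (e ▸ hb.1), this, by omega⟩
  have h1 := Finset.card_le_card h
  rw [Finset.card_erase_of_mem (Finset.mem_Ioc.mpr ⟨hM, hd⟩), Int.card_Ioc] at h1
  have h2 := Finset.card_filter_add_card_filter_not (s := beads M lam) (fun b => d < b)
  rw [card_beads] at h2
  simp only [above]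
  omega

theorem exists_beads_eq {M : ℕ} {B : Finset ℤ} (hB : B.card = M) (h : ∀ b ∈ B, -(M : ℤ) < b) :
    ∃ lam : YoungDiagram, lam.colLen 0 ≤ M ∧ beads M lam = B := by
  obtain ⟨lam, h1, h2⟩ := exists_maya_eq (descSeq_strictAnti B hB)
    fun j => h _ (Finset.orderEmbOfFin_mem _ _ _)
  exact ⟨lam, h1, by rw [beads, h2, image_descSeq]⟩

theorem beads_injOn {M : ℕ} {lam mu : YoungDiagram} (h : lam.colLen 0 ≤ M) (h' : mu.colLen 0 ≤ M)
    (e : beads M lam = beads M mu) : lam = mu := by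
  ext c
  rw [YoungDiagram.mem_cells, YoungDiagram.mem_cells, mem_iff_lt_above h, mem_iff_lt_above h', e]

/-! ### Moving a bead adds a ribbon -/

/-- Each diagonal crossed by the bead loses exactly its last cell, the one in row `above - 1`. -/
theorem mem_iff_of_beads_eq {n M : ℕ} {be be' : YoungDiagram} (hbe : be.colLen 0 ≤ M)
    (hbe' : be'.colLen 0 ≤ M) {x : ℤ} (h1 : x + n ∈ beads M be) (h0 : x ∉ beads M be)
    (hB : beads M be' = insert x ((beads M be).erase (x + n))) {c : ℕ × ℕ} :
    c ∈ be' ↔ c ∈ be ∧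
      ¬ (x ≤ content c ∧ content c < x + n ∧ c.1 + 1 = above (beads M be) (content c)) := by
  have h := above_move h1 h0 (content c)
  rw [mem_iff_lt_above hbe, mem_iff_lt_above hbe', hB]
  split_ifs at h with hc
  · simp only [hc.1, hc.2, true_and]
    omega
  · constructor
    · exact fun h' => ⟨by omega, fun h'' => hc ⟨h''.1, h''.2.1⟩⟩
    · rintro ⟨h', -⟩
      omega

theorem le_of_beads_eq {n M : ℕ} {be be' : YoungDiagram} (hbe : be.colLen 0 ≤ M)
    (hbe' : be'.colLen 0 ≤ M) {x : ℤ} (h1 : x + n ∈ beads M be) (h0 : x ∉ beads M be)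
    (hB : beads M be' = insert x ((beads M be).erase (x + n))) : be' ≤ be := fun _ hc =>
  ((mem_iff_of_beads_eq hbe hbe' h1 h0 hB).mp hc).1

/-- The skew diagram between two Young diagrams which differ by the move of one bead. -/
theorem sdiff_eq_image {n M : ℕ} {be be' : YoungDiagram} (hbe : be.colLen 0 ≤ M)
    (hbe' : be'.colLen 0 ≤ M) {x : ℤ} (h1 : x + n ∈ beads M be) (h0 : x ∉ beads M be)
    (hB : beads M be' = insert x ((beads M be).erase (x + n))) {p : ℕ → ℕ × ℕ} (hp : IsPath n p)
    (hp0 : content (p 0) = x + n - 1)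
    (hrow : ∀ j < n, (p j).1 + 1 = above (beads M be) (content (p j))) :
    be.cells \ be'.cells = (Finset.range n).image p := by
  ext c
  rw [Finset.mem_sdiff, YoungDiagram.mem_cells, YoungDiagram.mem_cells,
    mem_iff_of_beads_eq hbe hbe' h1 h0 hB, Finset.mem_image]
  constructor
  · rintro ⟨h2, h3⟩
    have h4 : x ≤ content c ∧ content c < x + n ∧ c.1 + 1 = above (beads M be) (content c) := by
      by_contra h4; exact h3 ⟨h2, h4⟩
    obtain ⟨j, hj⟩ := Int.eq_ofNat_of_zero_le (a := x + n - 1 - content c) (by omega)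
    have hjn : j < n := by omega
    have h5 : content (p j) = content c := by rw [hp.content_eq hjn, hp0]; omega
    refine ⟨j, Finset.mem_range.mpr hjn, cell_ext ?_ h5⟩
    have := hrow j hjn
    rw [h5] at this
    omega
  · rintro ⟨j, hj, rfl⟩
    rw [Finset.mem_range] at hj
    have h2 := hrow j hj
    refine ⟨(mem_iff_lt_above hbe).mpr (by omega), fun h => h.2 ⟨?_, ?_, h2⟩⟩ <;>
    rw [hp.content_eq hj, hp0] <;> omega

/-- The last cells on the diagonals with contents `h, h - 1, …`. -/
def rimPath (B : Finset ℤ) (h : ℤ) (j : ℕ) : ℕ × ℕ :=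
  (above B (h - j) - 1, ((above B (h - j) : ℤ) - 1 + (h - j)).toNat)

theorem rimPath_spec {n M : ℕ} {be : YoungDiagram} {x : ℤ} (hM : -(M : ℤ) < x)
    (h1 : x + n ∈ beads M be) (h0 : x ∉ beads M be) {j : ℕ} (hj : j < n) :
    (rimPath (beads M be) (x + n - 1) j).1 + 1 = above (beads M be) (x + n - 1 - j) ∧
      content (rimPath (beads M be) (x + n - 1) j) = x + n - 1 - j := by
  have h2 := above_move h1 h0 (x + n - 1 - j)
  rw [if_pos (by omega)] at h2
  have h3 := one_le_above_add h0 hM (d := x + n - 1 - j) (by omega)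
  simp only [rimPath, content]
  omega

/-- From content `d` to `d - 1` the count of beads grows by one exactly if `d` carries a bead: then
the rim goes up a row, otherwise one column back. -/
theorem rimPath_isPath {n M : ℕ} {be : YoungDiagram} {x : ℤ} (hM : -(M : ℤ) < x)
    (h1 : x + n ∈ beads M be) (h0 : x ∉ beads M be) :
    IsPath n (rimPath (beads M be) (x + n - 1)) := by
  intro j hj
  obtain ⟨h2, h3⟩ := rimPath_spec hM h1 h0 (j := j) (by omega)
  obtain ⟨h4, h5⟩ := rimPath_spec hM h1 h0 hj
  have h6 := above_sub_one (beads M be) (x + n - 1 - j)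
  rw [show x + (n : ℤ) - 1 - ((j + 1 : ℕ) : ℤ) = x + n - 1 - j - 1 by push_cast; ring] at h4 h5
  simp only [content] at h3 h5
  split_ifs at h6 <;> omega

theorem exists_rim {n M : ℕ} {be be' : YoungDiagram} (hbe : be.colLen 0 ≤ M)
    (hbe' : be'.colLen 0 ≤ M) {x : ℤ} (hM : -(M : ℤ) < x) (hn : 1 ≤ n)
    (h1 : x + n ∈ beads M be) (h0 : x ∉ beads M be)
    (hB : beads M be' = insert x ((beads M be).erase (x + n))) :
    ∃ p, IsPath n p ∧ content (p 0) = x + n - 1 ∧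
      (∀ j < n, (p j).1 + 1 = above (beads M be) (content (p j))) ∧
      be.cells \ be'.cells = (Finset.range n).image p := by
  have hp := rimPath_isPath hM h1 h0
  have hp0 : content (rimPath (beads M be) (x + n - 1) 0) = x + n - 1 := by
    simpa using (rimPath_spec hM h1 h0 (j := 0) (by omega)).2
  have hrow : ∀ j < n, (rimPath (beads M be) (x + n - 1) j).1 + 1 =
      above (beads M be) (content (rimPath (beads M be) (x + n - 1) j)) := fun j hj => by
    obtain ⟨h2, h3⟩ := rimPath_spec hM h1 h0 hj
    rw [h3, h2]
  exact ⟨_, hp, hp0, hrow, sdiff_eq_image hbe hbe' h1 h0 hB hp hp0 hrow⟩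

theorem IsPath.card_rows {n : ℕ} {p : ℕ → ℕ × ℕ} (hp : IsPath n p) {j : ℕ} (hj : j < n) :
    (((Finset.range (j + 1)).image p).image Prod.fst) = Finset.Icc (p 0).1 (p j).1 ∧
      (p 0).1 ≤ (p j).1 := by
  induction j with
  | zero => simp
  | succ j ih =>
    obtain ⟨h1, h2⟩ := ih (by omega)
    have h3 := hp.row_le hj
    refine ⟨?_, by omega⟩
    rw [Finset.range_add_one, Finset.image_insert, Finset.image_insert, h1]
    ext r
    rw [Finset.mem_insert, Finset.mem_Icc, Finset.mem_Icc]
    omega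

theorem above_eq_card_between_add {n : ℕ} (hn : 1 ≤ n) (x : ℤ) (B : Finset ℤ) :
    above B x = (between n x B).card + above B (x + n - 1) := by
  rw [above, above, between, ← Finset.card_union_of_disjoint]
  · congr 1
    ext b
    simp only [Finset.mem_union, Finset.mem_filter]
    constructor
    · rintro ⟨h1, h2⟩
      rcases lt_or_ge b (x + n) with h | h
      · exact Or.inl ⟨h1, h2, h⟩
      · exact Or.inr ⟨h1, by omega⟩
    · rintro (⟨h1, h2⟩ | ⟨h1, h2⟩) <;> exact ⟨h1, by omega⟩
  · rw [Finset.disjoint_left]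
    intro b h1 h2
    rw [Finset.mem_filter] at h1 h2
    omega

/-- The first and the last row of the ribbon differ by the number of beads in `(x, x + n)`, so the
spin weight equals the power of `-q⁻¹` in `R_x`. -/
theorem card_rows_sdiff {n M : ℕ} {be be' : YoungDiagram} (hbe : be.colLen 0 ≤ M)
    (hbe' : be'.colLen 0 ≤ M) {x : ℤ} (hM : -(M : ℤ) < x) (hn : 1 ≤ n)
    (h1 : x + n ∈ beads M be) (h0 : x ∉ beads M be)
    (hB : beads M be' = insert x ((beads M be).erase (x + n))) :
    ((be.cells \ be'.cells).image Prod.fst).card - 1 = (between n x (beads M be)).card := by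
  obtain ⟨p, hp, hp0, hrow, hR⟩ := exists_rim hbe hbe' hM hn h1 h0 hB
  obtain ⟨h2, h3⟩ := hp.card_rows (j := n - 1) (by omega)
  rw [show n - 1 + 1 = n by omega] at h2
  rw [hR, h2, Nat.card_Icc]
  have h4 := hrow 0 (by omega)
  have h5 := hrow (n - 1) (by omega)
  rw [hp.content_eq (show n - 1 < n by omega)] at h5
  rw [hp0] at h4 h5
  rw [show x + (n : ℤ) - 1 - ((n - 1 : ℕ) : ℤ) = x by omega] at h5
  have h6 := above_eq_card_between_add hn x (beads M be)
  omega

/-- The last ribbon of a tiling. -/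
theorem exists_last_ribbon {n k M : ℕ} (hn : 1 ≤ n) {al be : YoungDiagram} (hbe : be.colLen 0 ≤ M)
    {x : ℤ} (hmax : ∀ c ∈ be.cells \ al.cells, content c < x + n)
    (hex : ∃ c ∈ be.cells \ al.cells, content c = x + n - 1)
    {P : Finset (Finset (ℕ × ℕ))} (hP : P ∈ tilings n k al be) :
    x + n ∈ beads M be ∧ x ∉ beads M be ∧ ∃ p, IsPath n p ∧ (Finset.range n).image p ∈ P ∧
      (p 0).1 = al.colLen (p 0).2 ∧ content (p 0) = x + n - 1 ∧
      ∀ j < n, (p j).1 + 1 = above (beads M be) (content (p j)) := by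
  obtain ⟨-, -, -, hU, hrib⟩ := mem_tilings.mp hP
  have hmem : ∀ R ∈ P, ∀ c ∈ R, c ∈ be.cells \ al.cells := fun R hR c hc => by
    rw [← hU]; exact Finset.mem_biUnion.mpr ⟨R, hR, hc⟩
  obtain ⟨e, he, hce⟩ := hex
  rw [← hU, Finset.mem_biUnion] at he
  obtain ⟨R, hR, heR⟩ := he
  obtain ⟨p, hc, hp, rfl⟩ := hrib R hR
  have hpmem : ∀ j < n, p j ∈ (Finset.range n).image p := fun j hj =>
    Finset.mem_image_of_mem _ (Finset.mem_range.mpr hj)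
  have hp0 : content (p 0) = x + n - 1 := by
    have h1 := (hp.content_mem heR).2
    have h2 := hmax _ (hmem _ hR _ (hpmem 0 (by omega)))
    omega
  have hrem := fun j hj => removable hP hp hR (fun c hc => by have := hmax c hc; omega)
    (j := j) hj
  have hbemem : ∀ j < n, p j ∈ be := fun j hj => by
    have := hmem _ hR _ (hpmem j hj)
    rw [Finset.mem_sdiff] at this
    exact this.1
  have hrow : ∀ j < n, (p j).1 + 1 = above (beads M be) (content (p j)) := by
    intro j hj
    have h1 := (mem_iff_lt_above hbe).mp (hbemem j hj)
    -- If a cell of the ribbon were not last on its diagonal, its neighbour above and then the next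
    -- cell on the diagonal would belong to the same ribbon, which would meet that diagonal twice.
    by_contra hne
    have h2 : ((p j).1 + 1, (p j).2 + 1) ∈ be := by
      rw [mem_iff_lt_above hbe, show content ((p j).1 + 1, (p j).2 + 1) = content (p j) by
        simp [content]]
      simp only
      omega
    have h3 := (hrem j hj).1 (be.isLowerSet (a := ((p j).1 + 1, (p j).2 + 1))
      (by rw [Prod.le_def]; simp) h2)
    obtain ⟨i, hi', h4⟩ := Finset.mem_image.mp h3
    rw [Finset.mem_range] at hi'
    have h5 := (hrem i hi').2
    rw [h4] at h5
    have h6 := hp.eq_of_content_eq (h5 h2) hj (by simp [content])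
    have := congrArg Prod.fst h6
    simp only at this
    omega
  refine ⟨?_, ?_, p, hp, hR, hc, hp0, hrow⟩
  · have h1 := above_sub_one (beads M be) (x + n)
    -- Without a bead at `x + n` the diagram would contain the cell to the right of the initial
    -- cell; it would belong to the ribbon, yet its content is too large.
    by_contra hnot
    rw [if_neg hnot, ← hp0, ← hrow 0 (by omega)] at h1
    have h2 : ((p 0).1, (p 0).2 + 1) ∈ be := by
      rw [mem_iff_lt_above hbe, show content ((p 0).1, (p 0).2 + 1) = x + n by
        simp only [content] at hp0 ⊢; push_cast; omega]
      simp only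
      omega
    have h3 := (hp.content_mem ((hrem 0 (by omega)).2 h2)).2
    simp only [content] at h3
    push_cast at h3
    omega
  -- Dually, a bead at `x` would put a cell of the diagram above the final cell of the ribbon, with
  -- content too small for the ribbon.
  · intro hx
    have h1 := above_sub_one (beads M be) x
    have h2 := hp.content_eq (show n - 1 < n by omega)
    rw [hp0, show x + (n : ℤ) - 1 - ((n - 1 : ℕ) : ℤ) = x by omega] at h2
    have h3 := hrow (n - 1) (by omega)
    rw [h2] at h3
    rw [if_pos hx, ← h3] at h1
    have h4 : ((p (n - 1)).1 + 1, (p (n - 1)).2) ∈ be := by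
      rw [mem_iff_lt_above hbe, show content ((p (n - 1)).1 + 1, (p (n - 1)).2) = x - 1 by
        simp only [content] at h2 ⊢; push_cast; omega]
      simp only
      omega
    have h5 := (hp.content_mem ((hrem (n - 1) (by omega)).1 h4)).1
    rw [hp0] at h5
    simp only [content] at h2 h5
    push_cast at h5
    omega

/-- Removing the last ribbon of a tiling. -/
theorem erase_mem_tilings {n k M : ℕ} (hn : 1 ≤ n) {al be be' : YoungDiagram}
    (hbe : be.colLen 0 ≤ M) (hbe' : be'.colLen 0 ≤ M) {x : ℤ}
    (hmax : ∀ c ∈ be.cells \ al.cells, content c < x + n)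
    (hex : ∃ c ∈ be.cells \ al.cells, content c = x + n - 1)
    (h1 : x + n ∈ beads M be) (h0 : x ∉ beads M be)
    (hB : beads M be' = insert x ((beads M be).erase (x + n)))
    {P : Finset (Finset (ℕ × ℕ))} (hP : P ∈ tilings n (k + 1) al be) :
    be.cells \ be'.cells ∈ P ∧ P.erase (be.cells \ be'.cells) ∈ tilings n k al be' ∧
      ∀ c ∈ be'.cells \ al.cells, content c < x + n - 1 := by
  obtain ⟨-, -, p, hp, hR, hc, hp0, hrow⟩ := exists_last_ribbon hn hbe hmax hex hP
  have hRe := sdiff_eq_image hbe hbe' h1 h0 hB hp hp0 hrow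
  have hle := le_of_beads_eq hbe hbe' h1 h0 hB
  obtain ⟨hal, hcard, hdisj, hU, hrib⟩ := mem_tilings.mp hP
  rw [hRe]
  have hU' : (P.erase ((Finset.range n).image p)).biUnion id = be'.cells \ al.cells := by
    ext c
    rw [Finset.mem_biUnion, Finset.mem_sdiff]
    constructor
    · rintro ⟨R, hR', hcR⟩
      obtain ⟨hne, hR'⟩ := Finset.mem_erase.mp hR'
      have h2 : c ∈ be.cells \ al.cells := by
        rw [← hU]; exact Finset.mem_biUnion.mpr ⟨R, hR', hcR⟩
      rw [Finset.mem_sdiff] at h2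
      refine ⟨?_, h2.2⟩
      by_contra h3
      have h4 : c ∈ be.cells \ be'.cells := Finset.mem_sdiff.mpr ⟨h2.1, h3⟩
      rw [hRe] at h4
      exact Finset.disjoint_left.mp (hdisj hR' hR hne) hcR h4
    · rintro ⟨h2, h3⟩
      have h4 : c ∈ be.cells \ al.cells := Finset.mem_sdiff.mpr ⟨hle h2, h3⟩
      rw [← hU, Finset.mem_biUnion] at h4
      obtain ⟨R, hR', hcR⟩ := h4
      refine ⟨R, Finset.mem_erase.mpr ⟨?_, hR'⟩, hcR⟩
      rintro rfl
      rw [id_eq, ← hRe, Finset.mem_sdiff] at hcR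
      exact hcR.2 h2
  refine ⟨hR, mem_tilings.mpr ⟨?_, ?_, ?_, hU', ?_⟩, ?_⟩
  · intro c hcal
    by_contra h3
    have h4 : c ∈ be.cells \ be'.cells := Finset.mem_sdiff.mpr ⟨hal hcal, h3⟩
    have h5 : c ∈ be.cells \ al.cells := by
      rw [← hU]; exact Finset.mem_biUnion.mpr ⟨_, hR, by rwa [hRe] at h4⟩
    exact (Finset.mem_sdiff.mp h5).2 hcal
  · rw [Finset.card_erase_of_mem hR, hcard]
    rfl
  · exact hdisj.subset fun R hR' => Finset.mem_of_mem_erase hR'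
  · exact fun R hR' => hrib R (Finset.mem_of_mem_erase hR')
  · intro c hc2
    rw [← hU', Finset.mem_biUnion] at hc2
    obtain ⟨R, hR', hcR⟩ := hc2
    obtain ⟨hne, hR'⟩ := Finset.mem_erase.mp hR'
    obtain ⟨p', hc', hp', rfl⟩ := hrib R hR'
    have h2 := (hp'.content_mem hcR).2
    have h3 : p' 0 ∈ be.cells \ al.cells := by
      rw [← hU]
      exact Finset.mem_biUnion.mpr
        ⟨_, hR', Finset.mem_image_of_mem _ (Finset.mem_range.mpr (by omega))⟩
    have h4 := hmax _ h3
    -- Initial contents are distinct within a tiling, so the remaining ones are strictly smaller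
    -- than the one removed.
    have h5 : content (p' 0) ≠ content (p 0) := fun h =>
      hne (eq_of_content_head_eq hn hP hp hp' hR hR' hc hc' h).symm
    omega

/-- Adding a last ribbon to a tiling. -/
theorem insert_mem_tilings {n k M : ℕ} (hn : 1 ≤ n) {al be be' : YoungDiagram}
    (hbe : be.colLen 0 ≤ M) (hbe' : be'.colLen 0 ≤ M) {x : ℤ} (hM : -(M : ℤ) < x)
    (h1 : x + n ∈ beads M be) (h0 : x ∉ beads M be)
    (hB : beads M be' = insert x ((beads M be).erase (x + n)))
    (hmax : ∀ c ∈ be'.cells \ al.cells, content c < x + n - 1)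
    {P : Finset (Finset (ℕ × ℕ))} (hP : P ∈ tilings n k al be') :
    be.cells \ be'.cells ∉ P ∧ insert (be.cells \ be'.cells) P ∈ tilings n (k + 1) al be := by
  obtain ⟨p, hp, hp0, hrow, hR⟩ := exists_rim hbe hbe' hM hn h1 h0 hB
  have hle := le_of_beads_eq hbe hbe' h1 h0 hB
  obtain ⟨hal, hcard, hdisj, hU, hrib⟩ := mem_tilings.mp hP
  have hsub : ∀ R ∈ P, R ⊆ be'.cells \ al.cells := fun R hR' => by
    rw [← hU]; exact Finset.subset_biUnion_of_mem id hR'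
  have hd : ∀ R ∈ P, Disjoint (be.cells \ be'.cells) R := fun R hR' =>
    Finset.disjoint_of_subset_right ((hsub R hR').trans Finset.sdiff_subset)
      Finset.sdiff_disjoint
  have hp0mem : p 0 ∈ be.cells \ be'.cells := by
    rw [hR]; exact Finset.mem_image_of_mem _ (Finset.mem_range.mpr (by omega))
  have hnot : be.cells \ be'.cells ∉ P := fun h =>
    Finset.disjoint_left.mp (hd _ h) hp0mem hp0mem
  refine ⟨hnot, mem_tilings.mpr ⟨hal.trans hle, ?_, ?_, ?_, ?_⟩⟩
  · rw [Finset.card_insert_of_notMem hnot, hcard]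
  · rw [Finset.coe_insert]
    exact (Set.pairwiseDisjoint_insert).mpr ⟨hdisj, fun R hR' _ => hd R hR'⟩
  · rw [Finset.biUnion_insert, hU, id_eq]
    ext c
    simp only [Finset.mem_union, Finset.mem_sdiff, YoungDiagram.mem_cells]
    constructor
    · rintro (⟨h2, h3⟩ | ⟨h2, h3⟩)
      · exact ⟨h2, fun h => h3 (hal h)⟩
      · exact ⟨hle h2, h3⟩
    · rintro ⟨h2, h3⟩
      by_cases h4 : c ∈ be'
      · exact Or.inr ⟨h4, h3⟩
      · exact Or.inl ⟨h2, h4⟩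
  · intro R hR'
    rcases Finset.mem_insert.mp hR' with rfl | hR'
    · refine ⟨p, ?_, hp, hR⟩
      have h2 : p 0 ∉ al := fun h => (Finset.mem_sdiff.mp hp0mem).2 (hal h)
      have h3 : al.colLen (p 0).2 ≤ (p 0).1 := by
        by_contra! h; exact h2 (mem_of_lt_colLen h)
      refine le_antisymm ?_ h3
      by_contra! h4
      -- The cell under the initial cell has content `x + n`; outside `al` it would lie in `be'` and
      -- violate the content bound.
      have h5 : ((p 0).1 - 1, (p 0).2) ∉ al := fun h => by
        have := YoungDiagram.mem_iff_lt_colLen.mp h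
        omega
      have h6 : ((p 0).1 - 1, (p 0).2) ∈ be :=
        be.isLowerSet (a := p 0) (by rw [Prod.le_def]; simp) (Finset.mem_sdiff.mp hp0mem).1
      have h7 : content ((p 0).1 - 1, (p 0).2) = x + n := by
        simp only [content] at hp0 ⊢
        omega
      have h8 : ((p 0).1 - 1, (p 0).2) ∈ be' := by
        rw [mem_iff_of_beads_eq hbe hbe' h1 h0 hB]
        exact ⟨h6, fun h => by omega⟩
      have := hmax _ (Finset.mem_sdiff.mpr ⟨h8, h5⟩)
      omega
    · exact hrib R hR'

/-! ### The recursion for the ribbon coefficients and its match with bead moves. -/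

theorem tilings_eq_empty_of_not_le {n k : ℕ} {al be : YoungDiagram} (h : ¬ al ≤ be) :
    tilings n k al be = ∅ := by
  rw [Finset.eq_empty_iff_forall_notMem]
  exact fun P hP => h (mem_tilings.mp hP).1

theorem twiceSpin_insert {P : Finset (Finset (ℕ × ℕ))} {R : Finset (ℕ × ℕ)} (h : R ∉ P) :
    twiceSpin (insert R P) = ((R.image Prod.fst).card - 1) + twiceSpin P := by
  rw [twiceSpin, twiceSpin, Finset.sum_insert h]

theorem neg_q_zpow_neg (a b : ℕ) :
    (-q) ^ (-((a + b : ℕ) : ℤ)) = (-q⁻¹) ^ a * (-q) ^ (-(b : ℤ)) := by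
  have h : -q ≠ 0 := neg_ne_zero.mpr q_ne_zero
  rw [Nat.cast_add, neg_add, zpow_add₀ h, zpow_neg, zpow_natCast, ← inv_pow, inv_neg]

/-- The recursion for the ribbon coefficients obtained by removing the last ribbon. -/
theorem ribbonCoeff_succ {n k M : ℕ} (hn : 1 ≤ n) {al be be' : YoungDiagram}
    (hbe : be.colLen 0 ≤ M) (hbe' : be'.colLen 0 ≤ M) {x : ℤ} (hM : -(M : ℤ) < x)
    (hmax : ∀ c ∈ be.cells \ al.cells, content c < x + n)
    (hex : ∃ c ∈ be.cells \ al.cells, content c = x + n - 1)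
    (h1 : x + n ∈ beads M be) (h0 : x ∉ beads M be)
    (hB : beads M be' = insert x ((beads M be).erase (x + n)))
    (hmax' : ∀ c ∈ be'.cells \ al.cells, content c < x + n - 1) :
    ribbonCoeff n (k + 1) al be =
      (-q⁻¹) ^ (between n x (beads M be)).card * ribbonCoeff n k al be' := by
  rw [ribbonCoeff, ribbonCoeff, Finset.mul_sum]
  refine Finset.sum_bij' (fun P _ => P.erase (be.cells \ be'.cells))
    (fun P _ => insert (be.cells \ be'.cells) P)
    (fun P hP => (erase_mem_tilings hn hbe hbe' hmax hex h1 h0 hB hP).2.1)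
    (fun P hP => (insert_mem_tilings hn hbe hbe' hM h1 h0 hB hmax' hP).2)
    (fun P hP => Finset.insert_erase (erase_mem_tilings hn hbe hbe' hmax hex h1 h0 hB hP).1)
    (fun P hP => Finset.erase_insert (insert_mem_tilings hn hbe hbe' hM h1 h0 hB hmax' hP).1)
    fun P hP => ?_
  have hR := (erase_mem_tilings hn hbe hbe' hmax hex h1 h0 hB hP).1
  conv_lhs => rw [← Finset.insert_erase hR]
  rw [twiceSpin_insert (Finset.notMem_erase _ _), neg_q_zpow_neg,
    card_rows_sdiff hbe hbe' hM hn h1 h0 hB]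

/-- The target determines the source of a move, so a matrix coefficient has a single term; this is
the form needed when the last ribbon is removed. -/
theorem beadUp_apply (n : ℕ) (x : ℤ) (w : Conf) (C : Finset ℤ) : beadUp n x w C =
    if x + n ∈ C ∧ x ∉ C then
      (-q⁻¹) ^ (between n x C).card * w (insert x (C.erase (x + n))) else 0 := by
  by_cases hC : x + n ∈ C ∧ x ∉ C
  · rw [if_pos hC]
    have hxn : x ≠ x + n := fun e => hC.2 (e ▸ hC.1)
    suffices e : (Finsupp.lapply C : Conf →ₗ[K] K).comp (beadUp n x) =
        (-q⁻¹) ^ (between n x C).card • Finsupp.lapply (insert x (C.erase (x + n))) from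
      LinearMap.congr_fun e w
    refine conf_hom_ext fun B => ?_
    rw [LinearMap.comp_apply, LinearMap.smul_apply, Finsupp.lapply_apply, Finsupp.lapply_apply,
      beadUp_single]
    by_cases hB : B = insert x (C.erase (x + n))
    · have h1 : x ∈ B := hB ▸ Finset.mem_insert_self _ _
      have h2 : x + n ∉ B := by
        rw [hB, Finset.mem_insert, not_or]
        exact ⟨hxn.symm, Finset.notMem_erase _ _⟩
      have h3 : insert (x + n) (B.erase x) = C := by
        rw [hB, Finset.erase_insert fun h => hC.2 (Finset.mem_of_mem_erase h),
          Finset.insert_erase hC.1]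
      have h4 : between n x B = between n x C := by
        ext b
        simp only [hB, between, Finset.mem_filter, Finset.mem_insert, Finset.mem_erase]
        constructor
        · rintro ⟨h | h, h'⟩
          · omega
          · exact ⟨h.2, h'⟩
        · exact fun h => ⟨Or.inr ⟨by omega, h.1⟩, h.2⟩
      rw [if_pos ⟨h1, h2⟩, h3, ← hB, h4, Finsupp.smul_apply, Finsupp.single_eq_same,
        Finsupp.single_eq_same]
    · rw [Finsupp.single_apply, if_neg hB, smul_zero]
      split_ifs with h
      · rw [Finsupp.smul_apply, Finsupp.single_apply, if_neg, smul_zero]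
        rintro rfl
        refine hB ?_
        rw [Finset.erase_insert fun h' => h.2 (Finset.mem_of_mem_erase h'), Finset.insert_erase h.1]
      · rfl
  · rw [if_neg hC]
    suffices e : (Finsupp.lapply C : Conf →ₗ[K] K).comp (beadUp n x) = 0 from
      LinearMap.congr_fun e w
    refine conf_hom_ext fun B => ?_
    rw [LinearMap.comp_apply, Finsupp.lapply_apply, beadUp_single, LinearMap.zero_apply]
    split_ifs with h
    · rw [Finsupp.smul_apply, Finsupp.single_apply, if_neg, smul_zero]
      rintro rfl
      refine hC ⟨Finset.mem_insert_self _ _, ?_⟩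
      rw [Finset.mem_insert, not_or]
      exact ⟨fun e => h.2 (e ▸ h.1), Finset.notMem_erase _ _⟩
    · rfl

open Classical in
theorem ribbonCoeff_zero (n : ℕ) (al be : YoungDiagram) :
    ribbonCoeff n 0 al be = if al = be then 1 else 0 := by
  split_ifs with h
  · subst h
    have : tilings n 0 al al = {∅} := by
      ext P
      rw [Finset.mem_singleton]
      constructor
      · exact fun hP => Finset.card_eq_zero.mp (mem_tilings.mp hP).2.1
      · rintro rfl
        exact mem_tilings.mpr ⟨le_rfl, rfl, by simp, by simp, by simp⟩
    rw [ribbonCoeff, this, Finset.sum_singleton, twiceSpin, Finset.sum_empty]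
    simp
  · rw [ribbonCoeff, Finset.sum_eq_zero]
    intro P hP
    exfalso
    obtain ⟨h1, h2, -, h3, -⟩ := mem_tilings.mp hP
    rw [Finset.card_eq_zero] at h2
    subst h2
    refine h (le_antisymm h1 fun c hc => ?_)
    by_contra h4
    have : c ∈ be.cells \ al.cells := Finset.mem_sdiff.mpr ⟨hc, h4⟩
    rw [← h3] at this
    simp at this

open Classical in
/-- The ribbon coefficients of the skew diagrams whose contents are less than `y`. -/
def ribbonCoeffBelow (n k : ℕ) (y : ℤ) (al be : YoungDiagram) : K :=
  if ∀ c ∈ be.cells \ al.cells, content c < y then ribbonCoeff n k al be else 0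

theorem ribbonCoeffBelow_of_forall {n k : ℕ} {y : ℤ} {al be : YoungDiagram}
    (h : ∀ c ∈ be.cells \ al.cells, content c < y) :
    ribbonCoeffBelow n k y al be = ribbonCoeff n k al be := if_pos h

theorem ribbonCoeffBelow_of_exists {n k : ℕ} {y : ℤ} {al be : YoungDiagram}
    (h : ∃ c ∈ be.cells \ al.cells, y ≤ content c) : ribbonCoeffBelow n k y al be = 0 := by
  obtain ⟨c, hc, h⟩ := h
  exact if_neg fun h' => not_lt.mpr h (h' c hc)

/-- Raising the content bound by one admits exactly the tableaux whose last ribbon starts on the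
diagonal `x + n - 1`. Such a ribbon can occur only if `be` has a bead at `x + n` and none at `x`,
and removing it moves that bead back. -/
theorem ribbonCoeffBelow_succ {n k M : ℕ} (hn : 1 ≤ n) {al be : YoungDiagram}
    (hbe : be.colLen 0 ≤ M) {x : ℤ} :
    (¬ (x + n ∈ beads M be ∧ x ∉ beads M be) →
      ribbonCoeffBelow n (k + 1) (x + n) al be = ribbonCoeffBelow n (k + 1) (x + n - 1) al be) ∧
    (x + n ∈ beads M be → x ∉ beads M be → -(M : ℤ) < x → ∀ be' : YoungDiagram,
      be'.colLen 0 ≤ M → beads M be' = insert x ((beads M be).erase (x + n)) →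
      ribbonCoeffBelow n (k + 1) (x + n) al be = ribbonCoeffBelow n (k + 1) (x + n - 1) al be +
        (-q⁻¹) ^ (between n x (beads M be)).card * ribbonCoeffBelow n k (x + n - 1) al be') := by
  by_cases hmax : ∀ c ∈ be.cells \ al.cells, content c < x + n
  swap
  · push Not at hmax
    obtain ⟨c, hc, hcx⟩ := hmax
    have e1 : ribbonCoeffBelow n (k + 1) (x + n) al be = 0 :=
      ribbonCoeffBelow_of_exists ⟨c, hc, hcx⟩
    have e2 : ribbonCoeffBelow n (k + 1) (x + n - 1) al be = 0 :=
      ribbonCoeffBelow_of_exists ⟨c, hc, by omega⟩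
    refine ⟨fun _ => by rw [e1, e2], fun h1 h0 hM be' hbe' hB => ?_⟩
    rw [Finset.mem_sdiff] at hc
    rw [e1, e2, ribbonCoeffBelow_of_exists ⟨c, Finset.mem_sdiff.mpr
      ⟨(mem_iff_of_beads_eq hbe hbe' h1 h0 hB).mpr ⟨hc.1, fun h => by omega⟩, hc.2⟩, by omega⟩]
    simp
  rw [ribbonCoeffBelow_of_forall hmax]
  by_cases hex : ∃ c ∈ be.cells \ al.cells, content c = x + n - 1
  · have e2 : ribbonCoeffBelow n (k + 1) (x + n - 1) al be = 0 := by
      obtain ⟨c, hc, hcx⟩ := hex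
      exact ribbonCoeffBelow_of_exists ⟨c, hc, hcx.ge⟩
    simp only [e2, zero_add]
    constructor
    · intro h
      rw [ribbonCoeff, Finset.sum_eq_zero]
      intro P hP
      obtain ⟨h1, h0, -⟩ := exists_last_ribbon hn hbe hmax hex hP
      exact absurd ⟨h1, h0⟩ h
    · intro h1 h0 hM be' hbe' hB
      by_cases hmax' : ∀ c ∈ be'.cells \ al.cells, content c < x + n - 1
      · rw [ribbonCoeffBelow_of_forall hmax',
          ribbonCoeff_succ hn hbe hbe' hM hmax hex h1 h0 hB hmax']
      -- If what remains still reaches the diagonal `x + n - 1`, no tiling exists, since two initial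
      -- cells would share a diagonal.
      · have e3 : ribbonCoeff n (k + 1) al be = 0 := Finset.sum_eq_zero fun P hP =>
          absurd (erase_mem_tilings hn hbe hbe' hmax hex h1 h0 hB hP).2.2 hmax'
        push Not at hmax'
        rw [e3, ribbonCoeffBelow_of_exists hmax', mul_zero]
  · have hmax2 : ∀ c ∈ be.cells \ al.cells, content c < x + n - 1 := fun c hc => by
      have h1 := hmax c hc
      have h2 : content c ≠ x + n - 1 := fun h => hex ⟨c, hc, h⟩
      omega
    rw [ribbonCoeffBelow_of_forall hmax2]
    refine ⟨fun _ => rfl, fun h1 h0 hM be' hbe' hB => ?_⟩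
    -- No cell of the skew shape lies on the diagonal `x + n - 1`, so removing the rim ribbon would
    -- cut into `al`.
    obtain ⟨p, hp, hp0, -, hR⟩ := exists_rim hbe hbe' hM hn h1 h0 hB
    have h2 : p 0 ∈ be.cells \ be'.cells := by
      rw [hR]; exact Finset.mem_image_of_mem _ (Finset.mem_range.mpr (by omega))
    rw [Finset.mem_sdiff] at h2
    have h3 : ¬ al ≤ be' := fun h => hex ⟨p 0, Finset.mem_sdiff.mpr ⟨h2.1, fun h' => h2.2 (h h')⟩, hp0⟩
    have h4 : ribbonCoeff n k al be' = 0 := by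
      rw [ribbonCoeff, tilings_eq_empty_of_not_le h3, Finset.sum_empty]
    rw [ribbonCoeffBelow, h4, ite_self, mul_zero, add_zero]

theorem colLen_le_iff_forall {M : ℕ} {lam : YoungDiagram} (h : lam.colLen 0 ≤ M) {c : ℕ × ℕ}
    (hc : c ∈ lam) : c.1 < M := by
  have h2 : (c.1, 0) ∈ lam := lam.isLowerSet (a := c) (by rw [Prod.le_def]; simp) hc
  have := YoungDiagram.mem_iff_lt_colLen.mp h2
  omega

/-- The matrix coefficients of the products of the operators `1 + t R_x` count ribbon tableaux. -/
theorem coeff_upSeries_beads_below {n M : ℕ} (hn : 1 ≤ n) {al : YoungDiagram}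
    (hal : al.colLen 0 ≤ M) (m : ℕ) : ∀ (k : ℕ) (be : YoungDiagram), be.colLen 0 ≤ M →
    PowerSeries.coeff k (upSeries n (1 - M) m) (Finsupp.single (beads M al) 1) (beads M be) =
      ribbonCoeffBelow n k (m - M + n) al be := by
  have hzero : ∀ (m : ℕ) (be : YoungDiagram), be.colLen 0 ≤ M →
      PowerSeries.coeff 0 (upSeries n (1 - M) m) (Finsupp.single (beads M al) 1) (beads M be) =
        ribbonCoeffBelow n 0 (m - M + n) al be := by
    intro m be hbe
    rw [coeff_zero_upSeries, Module.End.one_apply, Finsupp.single_apply, ribbonCoeffBelow,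
      ribbonCoeff_zero]
    by_cases h : al = be
    · subst h
      rw [if_pos rfl, if_pos rfl, if_pos (by simp)]
    · rw [if_neg fun e => h (beads_injOn hal hbe e), if_neg h, ite_self]
  induction m with
  | zero =>
    intro k be hbe
    cases k with
    | zero => exact hzero 0 be hbe
    | succ k =>
      rw [upSeries, PowerSeries.coeff_one, if_neg (by omega), LinearMap.zero_apply,
        Finsupp.zero_apply, ribbonCoeffBelow]
      split_ifs with hmax
      -- With no factors the bound is `n - M`. A ribbon occupies `n` consecutive diagonals, all with
      -- content greater than `-M` since there are at most `M` rows, so none fits.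
      · rw [ribbonCoeff, Finset.sum_eq_zero]
        intro P hP
        exfalso
        obtain ⟨-, hcard, -, hU, hrib⟩ := mem_tilings.mp hP
        obtain ⟨R, hR⟩ := Finset.card_pos.mp (show 0 < P.card by omega)
        obtain ⟨p, -, hp, rfl⟩ := hrib R hR
        have hmem : ∀ j < n, p j ∈ be.cells \ al.cells := fun j hj => by
          rw [← hU]
          exact Finset.mem_biUnion.mpr
            ⟨_, hR, Finset.mem_image_of_mem _ (Finset.mem_range.mpr hj)⟩
        have h1 := hmax _ (hmem 0 (by omega))
        have h2 := hp.content_eq (show n - 1 < n by omega)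
        have h3 := colLen_le_iff_forall hbe (Finset.mem_sdiff.mp (hmem (n - 1) (by omega))).1
        simp only [content] at h1 h2
        push_cast at h1
        omega
      · rfl
  | succ m ih =>
    intro k be hbe
    cases k with
    | zero => exact hzero (m + 1) be hbe
    | succ k =>
      obtain ⟨s1, s2⟩ := ribbonCoeffBelow_succ (k := k) hn (al := al) hbe (x := 1 - M + m)
      have e1 : (1 : ℤ) - M + m + n = ((m + 1 : ℕ) : ℤ) - M + n := by push_cast; ring
      have e2 : (1 : ℤ) - M + m + n - 1 = m - M + n := by ring
      rw [e2, e1] at s1 s2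
      rw [coeff_succ_upSeries, LinearMap.add_apply, Finsupp.add_apply, ih _ _ hbe,
        Module.End.mul_apply, beadUp_apply]
      by_cases hb : (1 : ℤ) - M + m + n ∈ beads M be ∧ (1 : ℤ) - M + m ∉ beads M be
      · rw [if_pos hb]
        have hx : (1 : ℤ) - M + m ≠ 1 - M + m + n := fun e => hb.2 (e ▸ hb.1)
        obtain ⟨be', hbe', hB⟩ := exists_beads_eq (M := M)
          (B := insert ((1 : ℤ) - M + m) ((beads M be).erase (1 - M + m + n)))
          (by
            rw [Finset.card_insert_of_notMem fun h => hb.2 (Finset.mem_of_mem_erase h),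
              Finset.card_erase_add_one hb.1, card_beads])
          (fun b hb' => by
            rcases Finset.mem_insert.mp hb' with rfl | hb'
            · omega
            · exact neg_lt_of_mem_beads (Finset.mem_of_mem_erase hb'))
        rw [← hB, ih k be' hbe']
        rw [e1] at hB hb
        exact (s2 hb.1 hb.2 (by omega) be' hbe' hB).symm
      · rw [if_neg hb, add_zero]
        rw [e1] at hb
        exact (s1 hb).symm

/-! ### The action of the centre -/

theorem map_hComplete {N : ℕ} {A B : Type*} [Semiring A] [Semiring B] (f : A →+* B) (x : Fin N → A)
    (k : ℕ) : f (hComplete x k) = hComplete (fun j => f (x j)) k := by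
  rw [hComplete, hComplete, map_sum]
  refine Finset.sum_congr rfl fun g _ => ?_
  rw [map_list_prod, List.map_ofFn]
  rfl

/-- The opposite ring reverses the ordered products, which is harmless for commuting variables. -/
theorem unop_hComplete_op {N : ℕ} {A : Type*} [Semiring A] {x : Fin N → A}
    (hx : ∀ i j, Commute (x i) (x j)) (k : ℕ) :
    (hComplete (fun j => MulOpposite.op (x j)) k).unop = hComplete x k := by
  rw [hComplete, hComplete, Finset.unop_sum]
  refine Finset.sum_congr rfl fun g _ => ?_
  rw [MulOpposite.unop_list_prod, List.map_ofFn]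
  refine List.Perm.prod_eq' (List.reverse_perm _) ?_
  rw [List.pairwise_reverse, List.pairwise_ofFn]
  exact fun i j _ => hx _ _

theorem heckeRep_hComplete_hy {n : ℕ} (hn : 1 ≤ n) (N k : ℕ) :
    (heckeRep hn N (hComplete hy k)).unop =
      hComplete (fun j : Fin N => (heckeY n j : Module.End K (Tens N))) k := by
  have h := map_hComplete (heckeRep hn N).toRingHom hy k
  refine (congrArg MulOpposite.unop h).trans ?_
  rw [← unop_hComplete_op fun i j => heckeY_comm n i j]
  congr 2
  funext j
  exact heckeRep_hy hn j

theorem heckeYInv_comm (n : ℕ) {N : ℕ} (i j : Fin N) :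
    Commute (heckeYInv n i : Module.End K (Tens N)) (heckeYInv n j) := by
  refine tens_hom_ext_single fun a => ?_
  rw [Module.End.mul_apply, Module.End.mul_apply, heckeYInv_single, heckeYInv_single,
    heckeYInv_single, heckeYInv_single, sub_right_comm]

theorem heckeRep_hComplete_hyInv {n : ℕ} (hn : 1 ≤ n) (N k : ℕ) :
    (heckeRep hn N (hComplete hyInv k)).unop =
      hComplete (fun j : Fin N => (heckeYInv n j : Module.End K (Tens N))) k := by
  have h := map_hComplete (heckeRep hn N).toRingHom hyInv k
  refine (congrArg MulOpposite.unop h).trans ?_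
  rw [← unop_hComplete_op fun i j => heckeYInv_comm n i j]
  congr 2
  funext j
  exact heckeRep_hyInv hn j

theorem map_tPerm {N : ℕ} {A B : Type*} [Monoid A] [Monoid B] (f : A →* B) (T : Fin (N - 1) → A)
    (σ : Equiv.Perm (Fin N)) : f (tPerm T σ) = tPerm (fun i => f (T i)) σ := by
  rw [tPerm, tPerm, map_list_prod, List.map_map]
  rfl

theorem antisym_eq_heckeRep {n : ℕ} (hn : 1 ≤ n) (N : ℕ) :
    antisym n N = (heckeRep hn N (∑ σ, tPerm hT σ)).unop := by
  rw [antisym, map_sum]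
  congr 1
  refine Finset.sum_congr rfl fun σ _ => ?_
  have h := map_tPerm (heckeRep hn N).toRingHom.toMonoidHom hT σ
  refine Eq.trans ?_ h.symm
  congr 1
  funext i
  exact (heckeRep_hT hn i).symm

/-- The antisymmetrizer is the action of `∑ T_σ`, with which a central element commutes. -/
theorem antisym_heckeRep_center {n : ℕ} (hn : 1 ≤ n) {N : ℕ} {z : AffineHecke N (q⁻¹ ^ 2)}
    (hz : z ∈ Subalgebra.center K (AffineHecke N (q⁻¹ ^ 2))) {w : Tens N}
    (hw : antisym n N w = 0) : antisym n N ((heckeRep hn N z).unop w) = 0 := by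
  have h := congrArg (fun a => (heckeRep hn N a).unop w)
    (Subalgebra.mem_center_iff.mp hz (∑ σ, tPerm hT σ))
  simp only [map_mul, MulOpposite.unop_mul, ← antisym_eq_heckeRep hn, Module.End.mul_apply] at h
  rw [← h, hw, map_zero]

theorem heckeRep_center_mem_straightRel {n : ℕ} (hn : 1 ≤ n) {N : ℕ}
    {z : AffineHecke N (q⁻¹ ^ 2)} (hz : z ∈ Subalgebra.center K (AffineHecke N (q⁻¹ ^ 2)))
    {w : Tens N} (hw : w ∈ straightRel n N) : (heckeRep hn N z).unop w ∈ straightRel n N := by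
  rw [← ker_antisym hn, LinearMap.mem_ker] at hw ⊢
  exact antisym_heckeRep_center hn hz hw

/-! ### Configurations and Young diagrams -/

open Classical in
/-- The map sending the configuration of a Young diagram with at most `M` rows to this diagram, and
all other configurations to zero. -/
def confToFock (M : ℕ) : Conf →ₗ[K] Fock :=
  Finsupp.linearCombination K fun B =>
    if h : ∃ lam : YoungDiagram, lam.colLen 0 ≤ M ∧ beads M lam = B then
      Finsupp.single h.choose 1 else 0

theorem confToFock_beads {M : ℕ} {lam : YoungDiagram} (h : lam.colLen 0 ≤ M) :
    confToFock M (Finsupp.single (beads M lam) 1) = Finsupp.single lam 1 := by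
  have h' : ∃ mu : YoungDiagram, mu.colLen 0 ≤ M ∧ beads M mu = beads M lam := ⟨lam, h, rfl⟩
  rw [confToFock, Finsupp.linearCombination_single, one_smul, dif_pos h',
    beads_injOn h'.choose_spec.1 h h'.choose_spec.2]

theorem confToFock_of_not {M : ℕ} {B : Finset ℤ}
    (h : ¬ ∃ lam : YoungDiagram, lam.colLen 0 ≤ M ∧ beads M lam = B) :
    confToFock M (Finsupp.single B 1) = 0 := by
  rw [confToFock, Finsupp.linearCombination_single, one_smul, dif_neg h]

open Classical in
theorem confToFock_apply (M : ℕ) (w : Conf) (lam : YoungDiagram) :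
    confToFock M w lam = if lam.colLen 0 ≤ M then w (beads M lam) else 0 := by
  by_cases hl : lam.colLen 0 ≤ M
  · rw [if_pos hl]
    suffices e : (Finsupp.lapply lam : Fock →ₗ[K] K).comp (confToFock M) =
        Finsupp.lapply (beads M lam) from LinearMap.congr_fun e w
    refine conf_hom_ext fun B => ?_
    rw [LinearMap.comp_apply, Finsupp.lapply_apply, Finsupp.lapply_apply, Finsupp.single_apply]
    by_cases h : ∃ mu : YoungDiagram, mu.colLen 0 ≤ M ∧ beads M mu = B
    · obtain ⟨mu, hmu, rfl⟩ := h
      rw [confToFock_beads hmu, Finsupp.single_apply]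
      by_cases e : mu = lam
      · subst e; rw [if_pos rfl, if_pos rfl]
      · rw [if_neg e, if_neg fun e' => e (beads_injOn hmu hl e')]
    · rw [confToFock_of_not h, if_neg fun e => h ⟨lam, hl, e.symm⟩]
      rfl
  · rw [if_neg hl]
    suffices e : (Finsupp.lapply lam : Fock →ₗ[K] K).comp (confToFock M) = 0 from
      LinearMap.congr_fun e w
    refine conf_hom_ext fun B => ?_
    rw [LinearMap.comp_apply, Finsupp.lapply_apply, LinearMap.zero_apply]
    by_cases h : ∃ mu : YoungDiagram, mu.colLen 0 ≤ M ∧ beads M mu = B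
    · obtain ⟨mu, hmu, rfl⟩ := h
      rw [confToFock_beads hmu, Finsupp.single_apply, if_neg]
      rintro rfl
      exact hl hmu
    · rw [confToFock_of_not h]
      rfl

theorem beadTens_beads (M : ℕ) (lam : YoungDiagram) :
    beadTens M (Finsupp.single (beads M lam) 1) = Finsupp.single (maya M lam) 1 :=
  beadTens_image (maya_strictAnti M lam)

theorem mayaMap_single (M : ℕ) (lam : YoungDiagram) :
    mayaMap M (Finsupp.single lam 1) = Finsupp.single (maya M lam) 1 := Finsupp.mapDomain_single

/-- A configuration of `M` beads that is not that of a diagram has a bead at or below `-M`, and its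
wedge vanishes in the limit. -/
theorem wedgeInf_beadTens {n : ℕ} (hn : 1 ≤ n) (M : ℕ) (w : Conf) :
    wedgeInf n M (beadTens M w) = fockMap n (confToFock M w) := by
  suffices e : (wedgeInf n M).comp (beadTens M) = (fockMap n).comp (confToFock M) from
    LinearMap.congr_fun e w
  refine conf_hom_ext fun B => ?_
  rw [LinearMap.comp_apply, LinearMap.comp_apply]
  by_cases h : ∃ lam : YoungDiagram, lam.colLen 0 ≤ M ∧ beads M lam = B
  · obtain ⟨lam, hlam, rfl⟩ := h
    rw [confToFock_beads hlam, beadTens_beads, wedgeInf_maya n hlam, fockMap_single]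
  · rw [confToFock_of_not h, map_zero]
    by_cases hc : B.card = M
    · have h2 : ∃ b ∈ B, b ≤ -(M : ℤ) := by
        by_contra! h3
        exact h (exists_beads_eq hc h3)
      obtain ⟨b, hb, hbM⟩ := h2
      rw [beadTens_single hc]
      rw [← image_descSeq B hc, Finset.mem_image] at hb
      obtain ⟨j, -, rfl⟩ := hb
      have hj := j.2
      refine wedgeInf_single_eq_zero hn ⟨M - 1, by omega⟩ (by simp only; omega) (le_trans ?_ hbM)
      exact (descSeq_strictAnti B hc).antitone (Fin.le_def.mpr (Nat.le_sub_one_of_lt hj))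
    · rw [beadTens_single_of_ne hc, map_zero]

/-- With no beads at or below `-M` nothing has to be discarded, so the comparison holds before
passing to the limit. -/
theorem beadTens_eq_mayaMap {M : ℕ} {u : ℤ} {w : Conf} (hw : w ∈ confIn (1 - M) u) :
    beadTens M w = mayaMap M (confToFock M w) := by
  refine confIn_ext (f := beadTens M) (g := (mayaMap M).comp (confToFock M)) (fun B hB => ?_) hw
  rw [LinearMap.comp_apply]
  by_cases hc : B.card = M
  · obtain ⟨lam, hlam, rfl⟩ := exists_beads_eq hc fun b hb => by have := (hB b hb).1; omega
    rw [confToFock_beads hlam, beadTens_beads, mayaMap_single]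
  · rw [confToFock_of_not, beadTens_single_of_ne hc, map_zero]
    rintro ⟨lam, -, rfl⟩
    exact hc (card_beads M lam)

theorem Raises.upSeries (n : ℕ) (s : ℤ) (m : ℕ) : Raises n (upSeries n s m) := by
  induction m with
  | zero => exact Raises.one n
  | succ m ih => exact (Raises.upFactor n _).mul ih

theorem snd_lt_card {lam : YoungDiagram} {c : ℕ × ℕ} (hc : c ∈ lam) : c.2 < lam.card := by
  have h1 := YoungDiagram.mem_iff_lt_rowLen.mp (show (c.1, c.2) ∈ lam from hc)
  have h2 : (lam.row c.1).card ≤ lam.cells.card := Finset.card_le_card (Finset.filter_subset _ _)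
  rw [← YoungDiagram.rowLen_eq_card] at h2
  exact lt_of_lt_of_le h1 h2

theorem rowLen_le_card (lam : YoungDiagram) (i : ℕ) : lam.rowLen i ≤ lam.card := by
  rw [YoungDiagram.rowLen_eq_card]
  exact Finset.card_le_card (Finset.filter_subset _ _)

theorem colLen_le_card (lam : YoungDiagram) (j : ℕ) : lam.colLen j ≤ lam.card := by
  rw [YoungDiagram.colLen_eq_card]
  exact Finset.card_le_card (Finset.filter_subset _ _)

theorem le_card_of_mem_beads {M : ℕ} {lam : YoungDiagram} {b : ℤ} (h : b ∈ beads M lam) :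
    b ≤ lam.card := by
  obtain ⟨i, -, rfl⟩ := Finset.mem_image.mp h
  have := rowLen_le_card lam i
  simp only [maya]
  omega

/-- Contents of cells are smaller than the size of the diagram, so a large bound imposes no
condition. -/
theorem ribbonCoeffBelow_eq {n k : ℕ} {y : ℤ} {al be : YoungDiagram}
    (h : ribbonCoeff n k al be ≠ 0 → (be.card : ℤ) ≤ y) :
    ribbonCoeffBelow n k y al be = ribbonCoeff n k al be := by
  by_cases h0 : ribbonCoeff n k al be = 0
  · rw [ribbonCoeffBelow, h0, ite_self]
  · refine ribbonCoeffBelow_of_forall fun c hc => ?_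
    have h1 := h h0
    have h2 := snd_lt_card (Finset.mem_sdiff.mp hc).1
    simp only [content]
    omega

theorem ribbonV_single_apply (n k : ℕ) (lam mu : YoungDiagram) :
    ribbonV n k (Finsupp.single lam 1) mu = ribbonCoeff n k lam mu := by
  rw [ribbonV, Finsupp.linearCombination_single, one_smul]
  rfl

theorem ribbonU_single_apply (n k : ℕ) (lam nu : YoungDiagram) :
    ribbonU n k (Finsupp.single lam 1) nu = ribbonCoeff n k nu lam := by
  rw [ribbonU, Finsupp.linearCombination_single, one_smul]
  rfl

theorem isTransposed_ribbon (n k : ℕ) : IsTransposed (ribbonU n k) (ribbonV n k) :=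
  isTransposed_of_single fun lam mu => by rw [ribbonU_single_apply, ribbonV_single_apply]

/-! ### The operators `V_k` -/

theorem confToFock_upSeries {n : ℕ} (hn : 1 ≤ n) {k M : ℕ} {lam : YoungDiagram}
    (hM : lam.card + k * n ≤ M) :
    confToFock M (PowerSeries.coeff k (upSeries n (1 - M) (M + lam.card + k * n))
      (Finsupp.single (beads M lam) 1)) = ribbonV n k (Finsupp.single lam 1) := by
  have hlam := colLen_le_card lam 0
  ext mu
  rw [confToFock_apply, ribbonV_single_apply]
  split_ifs with hmu
  · rw [coeff_upSeries_beads_below hn (by omega) _ k mu hmu]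
    refine ribbonCoeffBelow_eq fun h => ?_
    have := (ribbonCoeff_ne_zero h).2
    push_cast
    have h2 : (mu.card : ℤ) ≤ lam.card + k * n := by exact_mod_cast this
    omega
  -- A diagram reached from `λ` has at most `λ.card + k n` cells, hence at most `M` rows.
  · by_contra h
    have h1 := (ribbonCoeff_ne_zero (Ne.symm h)).2
    have h2 := colLen_le_card mu 0
    omega

/-- The operators `h_k(y)` act by `V_k`. -/
theorem hComplete_heckeY_maya_sub_mem {n : ℕ} (hn : 1 ≤ n) {k M : ℕ} {lam : YoungDiagram}
    (hM : lam.card + k * n ≤ M) :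
    (heckeRep hn M (hComplete hy k)).unop (Finsupp.single (maya M lam) 1) -
      mayaMap M (ribbonV n k (Finsupp.single lam 1)) ∈ straightRel n M := by
  have hw : (Finsupp.single (beads M lam) 1 : Conf) ∈ confIn (1 - M) (lam.card + 1) :=
    single_mem_confIn fun b hb => by
      have h1 := neg_lt_of_mem_beads hb
      have h2 := le_card_of_mem_beads hb
      omega
  -- The positions run from `1 - M` to `λ.card + k n`: enough for beads that start at most at
  -- `λ.card` and rise `k` times by `n`.
  have h := hComplete_apply_sub_mem hn (s := 1 - M) (m := M + lam.card + k * n)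
    (J := straightRel n M) (fun i j => heckeY_comm n i j) (p := beadTens M)
    (fun k w hw => exactRel_le_straightRel hn M (coeff_eSeries_heckeY_sub_mem hn M k hw))
    (fun k w hw => by
      rw [← heckeRep_hComplete_hy hn]
      exact heckeRep_center_mem_straightRel hn (hComplete_hy_mem_center k) hw)
    k _ _ hw (by push_cast; omega)
  rw [beadTens_beads, beadTens_eq_mayaMap (Raises.upSeries n _ _ k _ _ _ hw),
    confToFock_upSeries hn hM, ← heckeRep_hComplete_hy hn] at h
  exact h

/-! ### The operators `U_k` -/

/-- The additional positions lie below every bead and act first, so they move nothing. -/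
theorem coeff_upSeries_extend {n : ℕ} (s : ℤ) (t m k : ℕ) {u : ℤ} {w : Conf}
    (hw : w ∈ confIn s u) :
    PowerSeries.coeff k (upSeries n (s - t) (m + t)) w = PowerSeries.coeff k (upSeries n s m) w := by
  induction t with
  | zero => simp
  | succ t ih =>
    have h : beadUp n (s - ((t + 1 : ℕ) : ℤ)) w = 0 := by
      refine confIn_ext (g := 0) (fun B hB => ?_) hw
      rw [beadUp_single_of_notMem, LinearMap.zero_apply]
      intro h
      have := (hB _ h).1
      push_cast at this
      omega
    rw [← ih, ← add_assoc, upSeries_succ',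
      show s - ((t + 1 : ℕ) : ℤ) + 1 = s - t by push_cast; ring]
    cases k with
    | zero =>
      rw [upFactor, mul_add, mul_one, map_add, coeff_zero_mul_X_mul_C, add_zero]
    | succ k =>
      rw [upFactor, mul_add, mul_one, map_add, coeff_succ_mul_X_mul_C, LinearMap.add_apply,
        Module.End.mul_apply, h, map_zero, add_zero]

theorem confToFock_conjNeg_upSeries {n : ℕ} (hn : 1 ≤ n) {k M : ℕ} {lam : YoungDiagram}
    (hM : lam.card ≤ M) :
    confToFock M (conjNeg (PowerSeries.coeff k
        (upSeries n (-(lam.card : ℤ) - n) (M + lam.card + (k + 1) * n)))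
      (Finsupp.single (beads M lam) 1)) = ribbonU n k (Finsupp.single lam 1) := by
  have hlam := colLen_le_card lam 0
  ext mu
  rw [confToFock_apply, ribbonU_single_apply]
  split_ifs with hmu
  · have hw : (Finsupp.single (beads M mu) 1 : Conf) ∈ confIn (1 - M) (mu.card + 1) :=
      single_mem_confIn fun b hb => by
        have h1 := neg_lt_of_mem_beads hb
        have h2 := le_card_of_mem_beads hb
        omega
    rw [(isTransposed_conjNeg_upSeries n _ _ k).apply,
      -- Transposition turns the range of positions into `1 - M - (k + 1) n, …, λ.card`. The lowest
      -- `(k + 1) n` of these are void; the margin of `n` in the original range makes the remaining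
      -- length exactly `M + λ.card`.
      show -(-(lam.card : ℤ) - n) - n - ((M + lam.card + (k + 1) * n : ℕ) : ℤ) + 1 =
        1 - M - ((k + 1) * n : ℕ) by push_cast; ring,
      coeff_upSeries_extend _ _ _ _ hw, coeff_upSeries_beads_below hn hmu _ k lam (by omega)]
    refine ribbonCoeffBelow_eq fun _ => ?_
    push_cast
    omega
  · by_contra h
    have h1 := (ribbonCoeff_ne_zero (Ne.symm h)).1
    refine hmu ?_
    by_contra h2
    have h3 : (M, 0) ∈ mu := YoungDiagram.mem_iff_lt_colLen.mpr (by omega)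
    have h4 := YoungDiagram.mem_iff_lt_colLen.mp (h1 h3)
    omega

/-- The operators `h_k(y⁻¹)` act by `U_k` in the limit. -/
theorem wedgeInf_hComplete_heckeYInv_maya {n : ℕ} (hn : 1 ≤ n) {k M : ℕ} {lam : YoungDiagram}
    (hM : lam.card ≤ M) :
    wedgeInf n M ((heckeRep hn M (hComplete hyInv k)).unop (Finsupp.single (maya M lam) 1)) =
      fockMap n (ribbonU n k (Finsupp.single lam 1)) := by
  have hw : negConf (Finsupp.single (beads M lam) 1) ∈ confIn (-(lam.card : ℤ) - n) M := by
    rw [negConf_single]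
    refine single_mem_confIn fun b hb => ?_
    rw [mem_image_neg] at hb
    have h1 := neg_lt_of_mem_beads hb
    have h2 := le_card_of_mem_beads hb
    omega
  -- The upper end of the range is `M + k n`, since reflected beads lie below `M` and rise by at
  -- most `k n`.
  have h := hComplete_apply_sub_mem hn (s := -(lam.card : ℤ) - n)
    (m := M + lam.card + (k + 1) * n)
    (J := straightRel n M) (fun i j => heckeYInv_comm n i j) (p := (beadTens M).comp negConf)
    (fun k w hw => exactRel_le_straightRel hn M (coeff_eSeries_heckeYInv_sub_mem hn M k hw))
    (fun k w hw => by
      rw [← heckeRep_hComplete_hyInv hn]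
      exact heckeRep_center_mem_straightRel hn (hComplete_hyInv_mem_center k) hw)
    k _ _ hw (by push_cast; linarith)
  rw [LinearMap.comp_apply, LinearMap.comp_apply, negConf_negConf, beadTens_beads,
    ← heckeRep_hComplete_hyInv hn] at h
  rw [wedgeInf_eq_of_sub_mem hn h, wedgeInf_beadTens hn]
  exact congrArg _ (confToFock_conjNeg_upSeries hn hM)

/-! ### The thermodynamic limit -/

theorem eventually_wedgeInf_mayaMap {n : ℕ} {X : ∀ N : ℕ, Tens N →ₗ[K] Tens N}
    {Y : Fock →ₗ[K] Fock}
    (h : ∀ lam : YoungDiagram, ∀ᶠ M : ℕ in Filter.atTop,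
      wedgeInf n M (X M (Finsupp.single (maya M lam) 1)) = fockMap n (Y (Finsupp.single lam 1)))
    (f : Fock) :
    ∀ᶠ M : ℕ in Filter.atTop, wedgeInf n M (X M (mayaMap M f)) = fockMap n (Y f) := by
  induction f using Finsupp.induction_linear with
  | zero => simp
  | add f g hf hg =>
    filter_upwards [hf, hg] with M hf hg
    simp only [map_add, hf, hg]
  | single lam c =>
    filter_upwards [h lam] with M hM
    rw [← mul_one c, ← smul_eq_mul, ← Finsupp.smul_single]
    simp only [map_smul, mayaMap_single, hM]

/-- For large `M` the stabilized `w` and a combination of decreasing tensors of partitions differ by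
an element of the kernel. The operators preserve the kernel, so it suffices to know their effect on
basis wedges. -/
theorem isThermoLimit_conj {n : ℕ} (hn : 1 ≤ n) {X : ∀ N : ℕ, Tens N →ₗ[K] Tens N}
    {Y : Fock →ₗ[K] Fock}
    (hX : ∀ (N : ℕ) (w : Tens N), antisym n N w = 0 → antisym n N (X N w) = 0)
    (h : ∀ lam : YoungDiagram, ∀ᶠ M : ℕ in Filter.atTop,
      wedgeInf n M (X M (Finsupp.single (maya M lam) 1)) = fockMap n (Y (Finsupp.single lam 1))) :
    IsThermoLimit n X ((fockEquiv hn).conj Y) := by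
  refine ⟨hX, fun N w => ?_⟩
  obtain ⟨f, hf⟩ := (fockMap_bijective hn).2 (wedgeInf n N w)
  obtain ⟨L, hL⟩ := eventually_colLen_le f
  have hL' : ∀ lam ∈ f.support, lam.colLen 0 ≤ max N L := fun lam hlam =>
    le_trans (hL lam hlam) (le_max_right _ _)
  have h1 : wedgeInf n (max N L) (stab N (max N L) w - mayaMap (max N L) f) = 0 := by
    rw [map_sub, wedgeInf_stab n (le_max_left _ _), wedgeInf_mayaMap n hL', hf, sub_self]
  obtain ⟨M₀, hM₀⟩ := exists_stab_mem_of_wedgeInf_eq_zero hn h1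
  filter_upwards [eventually_wedgeInf_mayaMap h f, Filter.eventually_ge_atTop M₀,
    Filter.eventually_ge_atTop (max N L)] with M e1 e2 e3
  have h2 := hM₀ M e2 e3
  have h3 : stab (max N L) M (stab N (max N L) w) = stab N M w := toInf_injective M (by
    rw [toInf_stab e3, toInf_stab (le_max_left _ _), toInf_stab (le_trans (le_max_left _ _) e3)])
  rw [map_sub, h3, stab_mayaMap hL', ← ker_antisym hn] at h2
  have h4 : X M (stab N M w) - X M (mayaMap M f) ∈ straightRel n M := by
    rw [← map_sub, ← ker_antisym hn]
    exact hX M _ h2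
  rw [wedgeToFock_mk, wedgeToFock_mk, wedgeInf_eq_of_sub_mem hn h4, e1, ← hf,
    LinearEquiv.conj_apply_apply]
  have h5 : (fockEquiv hn).symm (fockMap n f) = f := (fockEquiv hn).symm_apply_apply f
  rw [h5]
  rfl

theorem isThermoLimit_ribbonV {n : ℕ} (hn : 1 ≤ n) (k : ℕ) :
    IsThermoLimit n (fun N => (heckeRep hn N (hComplete hy k)).unop)
      ((fockEquiv hn).conj (ribbonV n k)) := by
  refine isThermoLimit_conj hn
    (fun N w hw => antisym_heckeRep_center hn (hComplete_hy_mem_center k) hw) fun lam => ?_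
  obtain ⟨L, hL⟩ := eventually_colLen_le (ribbonV n k (Finsupp.single lam 1))
  filter_upwards [Filter.eventually_ge_atTop (lam.card + k * n), Filter.eventually_ge_atTop L]
    with M hM hML
  rw [wedgeInf_eq_of_sub_mem hn (hComplete_heckeY_maya_sub_mem hn hM),
    wedgeInf_mayaMap n fun mu hmu => le_trans (hL mu hmu) hML]

theorem isThermoLimit_ribbonU {n : ℕ} (hn : 1 ≤ n) (k : ℕ) :
    IsThermoLimit n (fun N => (heckeRep hn N (hComplete hyInv k)).unop)
      ((fockEquiv hn).conj (ribbonU n k)) := by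
  refine isThermoLimit_conj hn
    (fun N w hw => antisym_heckeRep_center hn (hComplete_hyInv_mem_center k) hw) fun lam => ?_
  filter_upwards [Filter.eventually_ge_atTop lam.card] with M hM
  exact wedgeInf_hComplete_heckeYInv_maya hn hM

/-! ### Commutation -/

theorem eventually_hComplete_mayaMap_sub_mem {n : ℕ} (hn : 1 ≤ n) (k : ℕ) (f : Fock) :
    ∀ᶠ M : ℕ in Filter.atTop, (heckeRep hn M (hComplete hy k)).unop (mayaMap M f) -
      mayaMap M (ribbonV n k f) ∈ straightRel n M := by
  induction f using Finsupp.induction_linear with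
  | zero => simp
  | add f g hf hg =>
    filter_upwards [hf, hg] with M hf hg
    simp only [map_add]
    rw [add_sub_add_comm]
    exact Submodule.add_mem _ hf hg
  | single lam c =>
    filter_upwards [Filter.eventually_ge_atTop (lam.card + k * n)] with M hM
    rw [← mul_one c, ← smul_eq_mul, ← Finsupp.smul_single]
    simp only [map_smul, mayaMap_single]
    rw [← smul_sub]
    exact Submodule.smul_mem _ _ (hComplete_heckeY_maya_sub_mem hn hM)

/-- At a large finite `M` both compositions are computed by `h_i(y) h_j(y)`. Central elements
preserve the relations, so the two comparisons compose, and injectivity of `fockMap` returns the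
identity to the Fock space. -/
theorem ribbonV_comm {n : ℕ} (hn : 1 ≤ n) (i j : ℕ) :
    ribbonV n i ∘ₗ ribbonV n j = ribbonV n j ∘ₗ ribbonV n i := by
  refine LinearMap.ext fun f => ?_
  have key : ∀ i j : ℕ, ∀ᶠ M : ℕ in Filter.atTop,
      wedgeInf n M ((heckeRep hn M (hComplete hy j * hComplete hy i)).unop (mayaMap M f)) =
        fockMap n (ribbonV n i (ribbonV n j f)) := fun i j => by
    obtain ⟨L, hL⟩ := eventually_colLen_le (ribbonV n i (ribbonV n j f))
    filter_upwards [eventually_hComplete_mayaMap_sub_mem hn j f,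
      eventually_hComplete_mayaMap_sub_mem hn i (ribbonV n j f),
      Filter.eventually_ge_atTop L] with M h1 h2 h3
    have h4 := heckeRep_center_mem_straightRel hn (hComplete_hy_mem_center i) h1
    rw [map_sub] at h4
    have h5 := Submodule.add_mem _ h4 h2
    rw [sub_add_sub_cancel] at h5
    rw [map_mul, MulOpposite.unop_mul, Module.End.mul_apply, wedgeInf_eq_of_sub_mem hn h5,
      wedgeInf_mayaMap n fun mu hmu => le_trans (hL mu hmu) h3]
  obtain ⟨M, h1, h2⟩ := ((key i j).and (key j i)).exists
  have h3 : (hComplete hy j * hComplete hy i : AffineHecke M (q⁻¹ ^ 2)) =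
      hComplete hy i * hComplete hy j :=
    Subalgebra.mem_center_iff.mp (hComplete_hy_mem_center i) _
  rw [h3] at h1
  exact fockMap_injective hn (h1.symm.trans h2)

/-- The coefficients of `U_k` are those of `V_k` transposed, and transposition reverses
compositions. -/
theorem ribbonU_comm {n : ℕ} (hn : 1 ≤ n) (i j : ℕ) :
    ribbonU n i ∘ₗ ribbonU n j = ribbonU n j ∘ₗ ribbonU n i := by
  have h1 := (isTransposed_ribbon n i).comp (isTransposed_ribbon n j)
  rw [ribbonV_comm hn] at h1
  exact h1.eq ((isTransposed_ribbon n j).comp (isTransposed_ribbon n i))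

end QFock
end

theorem mainTheorem10 (n : ℕ) (hn : 1 ≤ n) :
    ∃ (ρ : ∀ N : ℕ, QFock.AffineHecke N (QFock.q⁻¹ ^ 2) →ₐ[QFock.K]
          (Module.End QFock.K (QFock.Tens N))ᵐᵒᵖ)
      (Φ : QFock.Fock ≃ₗ[QFock.K] QFock.FockQ n),
      (∀ (N : ℕ) (i : Fin (N - 1)), (ρ N (QFock.hT i)).unop = QFock.heckeT n i) ∧
      (∀ (N : ℕ) (j : Fin N), (ρ N (QFock.hy j)).unop = QFock.heckeY n j) ∧
      (∀ lam : YoungDiagram, Φ (Finsupp.single lam 1) = QFock.wedgeOf n lam) ∧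
      (∀ k : ℕ, 1 ≤ k →
        (∀ N : ℕ,
          QFock.hComplete QFock.hy k ∈
            Subalgebra.center QFock.K (QFock.AffineHecke N (QFock.q⁻¹ ^ 2)) ∧
          QFock.hComplete QFock.hyInv k ∈
            Subalgebra.center QFock.K (QFock.AffineHecke N (QFock.q⁻¹ ^ 2))) ∧
        QFock.IsThermoLimit n (fun N => (ρ N (QFock.hComplete QFock.hyInv k)).unop)
          (Φ.conj (QFock.ribbonU n k)) ∧
        QFock.IsThermoLimit n (fun N => (ρ N (QFock.hComplete QFock.hy k)).unop)
          (Φ.conj (QFock.ribbonV n k))) ∧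
      (∀ i j : ℕ, 1 ≤ i → 1 ≤ j →
        QFock.ribbonU n i ∘ₗ QFock.ribbonU n j = QFock.ribbonU n j ∘ₗ QFock.ribbonU n i ∧
        QFock.ribbonV n i ∘ₗ QFock.ribbonV n j = QFock.ribbonV n j ∘ₗ QFock.ribbonV n i) := by
  refine ⟨QFock.heckeRep hn, QFock.fockEquiv hn, fun N i => ?_, fun N j => ?_,
    fun lam => QFock.fockMap_single n lam,
    fun k _ => ⟨fun N => ⟨QFock.hComplete_hy_mem_center k, QFock.hComplete_hyInv_mem_center k⟩,
      QFock.isThermoLimit_ribbonU hn k, QFock.isThermoLimit_ribbonV hn k⟩,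
    fun i j _ _ => ⟨QFock.ribbonU_comm hn i j, QFock.ribbonV_comm hn i j⟩⟩
  · rw [QFock.heckeRep_hT, MulOpposite.unop_op]
  · rw [QFock.heckeRep_hy, MulOpposite.unop_op]
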